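/- **Setting.** Let $\widetilde W$ be an irreducible affine Weyl group with simple reflections $s_0,s_1,\dots,s_n$, finite Weyl group $W=\langle s_1,\dots,s_n\rangle$, simple roots $\alpha_1,\dots,\alpha_n$, highest root $\xi$, $\alpha_0=-\xi$, coroot lattice $Q^\vee$ and fundamental coweights $\omega_1^\vee,\dots,\omega_n^\vee$. For $\lambda\in Q^\vee$ let $t_\lambda\in\widetilde W$ be the translation by $\lambda$, and let $k_j$ be the least positive integer with $k_j\omega_j^\vee\in Q^\vee$. The Dynkin diagrams are labelled as follows (arrows on multiple edges point to the shorter root, and the affine node is $0$). * $\widetilde A_n$ ($n\ge1$): the cycle $0,1,\dots,n$ (for $n=1$: $s_0s_1$ has infinite order). * $\widetilde B_n$ ($n\ge2$): the path $1-2-\cdots-(n-1)\Rightarrow n$ with $0$ joined to $2$ (for $n=2$: $0\Rightarrow2\Leftarrow1$). * $\widetilde C_n$ ($n\ge2$): the path $0\Rightarrow1-\cdots-(n-1)\Leftarrow n$. * $\widetilde D_n$ ($n\ge4$): the path $1-2-\cdots-(n-1)$ with $0$ joined to $2$ and $n$ joined to $n-2$. * $\widetilde E_6$: the path $1-2-3-4-5$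 with a branch $3-6-0$. $\widetilde E_7$: the path $0-1-\cdots-6$ with $7$ joined to $3$. $\widetilde E_8$: the path $0-1-\cdots-7$ with $8$ joined to $5$. * $\widetilde F_4$: the path $0-1-2\Rightarrow3-4$. $\widetilde G_2$: the path $0-1\Rrightarrow2$, with $s_1s_2$ of order $6$. An infinite word $\mathbf i=s_{i_1}s_{i_2}\cdots$ is *reduced* if all its finite prefixes are reduced. Its limit element $[\mathbf i]$ is its class under equality of the inversion sets $\mathrm{Inv}(\mathbf i)=\{s_{i_1}\cdots s_{i_{k-1}}s_{i_k}s_{i_{k-1}}\cdots s_{i_1}: k\ge1\}$. An element of $\widetilde W$ is *fully commutative* if none of its reduced words has a consecutive subword $s_as_bs_a\cdots$ with $m_{ab}$ letters, where $3\le m_{ab}<\infty$ is the order of $s_as_b$. An infinite reduced word is *fully commutative* if all the elements $s_{i_1}\cdots s_{i_k}$ are. **Theorem.** (1) In type $\widetilde A_n$, for every Coxeter word $c$ (each generator once, in any order) the infinite word $c^\infty$ is reduced and fully commutative, and an infinite reduced word $\mathbf i$ is fully commutative if and only if $[\mathbf i]=[c^\infty]$ for some Coxeter word $c$. (2) In the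 other types, consider the following list of finite words $u$ with coweights. | type | $u$ | coweight | |---|---|---| | $\widetilde B_n$ | $s_2s_0s_1\cdot s_2s_3\cdots s_{n-1}\cdot s_ns_{n-1}\cdots s_3$ (for $n=2$: $s_2s_0s_1$) | $\omega_1^\vee$ | | | $s_2s_0s_3s_4\cdots s_n\,s_2s_1s_3s_4\cdots s_n$ | $\omega_n^\vee$ | | $\widetilde C_n$ | $s_1s_0s_1s_2\cdots s_ns_{n-1}\cdots s_2$ (for $n=2$: $s_1s_0s_1s_2$) | $\omega_1^\vee$ | | | $s_0s_1\cdots s_n$ | $\omega_n^\vee$ | | $\widetilde D_n$ | $s_2s_0s_1s_2s_3\cdots s_{n-2}s_{n-1}s_ns_{n-2}s_{n-3}\cdots s_3$ (for $n=4$: $s_2s_0s_1s_2s_3s_4$) | $\omega_1^\vee$ | | | $s_2s_0s_3s_4\cdots s_{n-1}\,s_2s_1s_3s_4\cdots s_{n-2}s_n$ (for $n=4$: $s_2s_0s_3s_2s_1s_4$) | $\omega_{n-1}^\vee$ | | | $s_2s_1s_3s_4\cdots s_{n-1}\,s_2s_0s_3s_4\cdots s_{n-2}s_n$ (for $n=4$: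 $s_2s_1s_3s_2s_0s_4$) | $\omega_n^\vee$ | | $\widetilde E_6$ | $s_3s_2s_5s_4s_3s_1s_2s_6s_3s_4s_0s_6$ | $\omega_5^\vee$ | | | $s_3s_2s_0s_6s_3s_1s_2s_4s_3s_5s_4s_6$ | $\omega_1^\vee$ | | $\widetilde E_7$ | $s_3s_7s_5s_4s_3s_2s_6s_5s_4s_3s_7s_1s_2s_3s_0s_1s_2s_4$ | $\omega_6^\vee$ | | $\widetilde E_8$, $\widetilde F_4$ | none | | | $\widetilde G_2$ | $s_0s_1s_2s_1s_2$ | $\omega_2^\vee$ | Then, in each of these types: * for every $u$ listed for the type, $u^\infty$ is a fully commutative infinite reduced word; * an infinite reduced word $\mathbf i$ is fully commutative if and only if $[\mathbf i]=[w\,u^\infty]$ for some $u$ listed for the type and some finite word $w$ such that $w\,u^\infty$ is a fully commutative infinite reduced word; * if $u$ is listed with coweight $\omega_j^\vee$ and $w$ is a finite word such that $w\,u^\infty$ is a fully commutative infinite reduced word, then $[w\,u^\infty]=[t_{v(k_j\omega_j^\vee)}^\infty]$ for some $v\in W$. -/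

import Mathlib

noncomputable section

namespace AffineFC

/-! ### Affine Cartan matrices and Coxeter groups

The nodes of an affine Dynkin diagram of rank `n` are `0, 1, …, n`, the affine node being `0`.
A diagram is given by a function `arr : ℕ → ℕ → ℕ`, where `arr i j` is the number of directed edges
from node `i` to node `j`, that is `-2⟨α_i, α_j⟩ / ⟨α_j, α_j⟩`. -/

/-- The Cartan matrix of a diagram: `A i j = ⟨α_i, α_j^∨⟩`. -/
def cartanOf (n : ℕ) (arr : ℕ → ℕ → ℕ) : Matrix (Fin (n + 1)) (Fin (n + 1)) ℤ :=
  Matrix.of fun i j => if i = j then 2 else -(arr i j : ℤ)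

/-- Arrows of a diagram given by a list of triples `(i, j, m)`; such a triple stands for `m` directed
edges from `i` to `j` together with one directed edge from `j` to `i`. -/
def arrowsOfList (e : List (ℕ × ℕ × ℕ)) (i j : ℕ) : ℕ :=
  (e.map fun t => (if t.1 = i ∧ t.2.1 = j then t.2.2 else 0)
    + (if t.1 = j ∧ t.2.1 = i then 1 else 0)).sum

/-- `Ã_n` for `n ≥ 1`: the cycle `0 - 1 - ⋯ - n - 0`; for `n = 1` there are two edges in each
direction. -/
def cartanA (n : ℕ) : Matrix (Fin (n + 1)) (Fin (n + 1)) ℤ :=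
  cartanOf n fun i j =>
    (if j = (i + 1) % (n + 1) then 1 else 0) + (if i = (j + 1) % (n + 1) then 1 else 0)

/-- `B̃_n` for `n ≥ 2`: the path `1 - 2 - ⋯ - n` and the edge `0 - 2`. Every edge at the short simple
root `α_n` is a double edge towards `n`; for `n ≥ 3` this is only the edge `n-1 ⇒ n`, for `n = 2` the
diagram is `0 ⇒ 2 ⇐ 1`. -/
def cartanB (n : ℕ) : Matrix (Fin (n + 1)) (Fin (n + 1)) ℤ :=
  cartanOf n fun i j =>
    if (i = 0 ∧ j = 2) ∨ (i = 2 ∧ j = 0) ∨ (1 ≤ i ∧ j = i + 1) ∨ (1 ≤ j ∧ i = j + 1) then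
      (if j = n then 2 else 1)
    else 0

/-- `C̃_n` for `n ≥ 2`: the path `0 ⇒ 1 - 2 - ⋯ - (n-1) ⇐ n`. -/
def cartanC (n : ℕ) : Matrix (Fin (n + 1)) (Fin (n + 1)) ℤ :=
  cartanOf n fun i j =>
    if j = i + 1 ∨ i = j + 1 then (if i = 0 ∨ i = n then 2 else 1) else 0

/-- `D̃_n` for `n ≥ 4`: the path `1 - 2 - ⋯ - (n-1)` and the edges `0 - 2` and `(n-2) - n`. -/
def cartanD (n : ℕ) : Matrix (Fin (n + 1)) (Fin (n + 1)) ℤ :=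
  cartanOf n fun i j =>
    if (i = 0 ∧ j = 2) ∨ (i = 2 ∧ j = 0) ∨ (1 ≤ i ∧ j = i + 1 ∧ j < n) ∨
      (1 ≤ j ∧ i = j + 1 ∧ i < n) ∨ (i + 2 = n ∧ j = n) ∨ (j + 2 = n ∧ i = n) then 1 else 0

/-- `Ẽ_6`: the path `1 - 2 - 3 - 4 - 5` with the branch `3 - 6 - 0`. -/
def cartanE6 : Matrix (Fin (6 + 1)) (Fin (6 + 1)) ℤ :=
  cartanOf 6 (arrowsOfList [(1, 2, 1), (2, 3, 1), (3, 4, 1), (4, 5, 1), (3, 6, 1), (6, 0, 1)])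

/-- `Ẽ_7`: the path `0 - 1 - ⋯ - 6` with the branch `3 - 7`. -/
def cartanE7 : Matrix (Fin (7 + 1)) (Fin (7 + 1)) ℤ :=
  cartanOf 7 (arrowsOfList
    [(0, 1, 1), (1, 2, 1), (2, 3, 1), (3, 4, 1), (4, 5, 1), (5, 6, 1), (3, 7, 1)])

/-- `Ẽ_8`: the path `0 - 1 - ⋯ - 7` with the branch `5 - 8`. -/
def cartanE8 : Matrix (Fin (8 + 1)) (Fin (8 + 1)) ℤ :=
  cartanOf 8 (arrowsOfList
    [(0, 1, 1), (1, 2, 1), (2, 3, 1), (3, 4, 1), (4, 5, 1), (5, 6, 1), (6, 7, 1), (5, 8, 1)])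

/-- `F̃_4`: the path `0 - 1 - 2 ⇒ 3 - 4`. -/
def cartanF4 : Matrix (Fin (4 + 1)) (Fin (4 + 1)) ℤ :=
  cartanOf 4 (arrowsOfList [(0, 1, 1), (1, 2, 1), (2, 3, 2), (3, 4, 1)])

/-- `G̃_2`: the path `0 - 1 ⇛ 2`. -/
def cartanG2 : Matrix (Fin (2 + 1)) (Fin (2 + 1)) ℤ :=
  cartanOf 2 (arrowsOfList [(0, 1, 1), (1, 2, 3)])

/-- The order of `s_i s_j` as a function of `⟨α_i, α_j^∨⟩⟨α_j, α_i^∨⟩`; the value `0` stands for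
`∞`, as in `CoxeterMatrix`. -/
def bondOrder (d : ℤ) : ℕ :=
  if d = 0 then 2 else if d = 1 then 3 else if d = 2 then 4 else if d = 3 then 6 else 0

theorem bondOrder_ne_one (d : ℤ) : bondOrder d ≠ 1 := by
  unfold bondOrder
  split_ifs <;> decide

variable {n : ℕ}

/-- The Coxeter matrix of the Weyl group with Cartan matrix `A`. -/
def coxeter (A : Matrix (Fin (n + 1)) (Fin (n + 1)) ℤ) : CoxeterMatrix (Fin (n + 1)) where
  M := Matrix.of fun i j => if i = j then 1 else bondOrder (A i j * A j i)
  isSymm := by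
    ext i j
    simp only [Matrix.transpose_apply, Matrix.of_apply, eq_comm (a := j) (b := i),
      mul_comm (A j i)]
  diagonal i := by simp
  off_diagonal i j h := by simpa [h] using bondOrder_ne_one (A i j * A j i)

/-- The affine Weyl group `W̃` with its simple reflections `s_0, …, s_n`. -/
abbrev system (A : Matrix (Fin (n + 1)) (Fin (n + 1)) ℤ) :
    CoxeterSystem (coxeter A) (coxeter A).Group :=
  (coxeter A).toCoxeterSystem

/-! ### Infinite reduced words -/

/-- The prefix `i_1 ⋯ i_k` of an infinite word. -/
def prefixWord (i : ℕ → Fin (n + 1)) (k : ℕ) : List (Fin (n + 1)) :=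
  (List.range k).map i

/-- All finite prefixes are reduced. -/
def IsInfReduced (A : Matrix (Fin (n + 1)) (Fin (n + 1)) ℤ) (i : ℕ → Fin (n + 1)) : Prop :=
  ∀ k, (system A).IsReduced (prefixWord i k)

/-- No reduced word of `w` has a consecutive subword `a b a ⋯` with `m_{ab}` letters, where
`3 ≤ m_{ab} < ∞`. -/
def IsFC (A : Matrix (Fin (n + 1)) (Fin (n + 1)) ℤ) (w : (coxeter A).Group) : Prop :=
  ∀ ω : List (Fin (n + 1)), (system A).IsReduced ω → (system A).wordProd ω = w →
    ∀ a b : Fin (n + 1), 3 ≤ coxeter A a b →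
      ¬ CoxeterSystem.braidWord (coxeter A) a b <:+: ω

/-- `i` is a fully commutative infinite reduced word: it is reduced and every element
`s_{i_1} ⋯ s_{i_k}` is fully commutative. -/
def IsInfFC (A : Matrix (Fin (n + 1)) (Fin (n + 1)) ℤ) (i : ℕ → Fin (n + 1)) : Prop :=
  IsInfReduced A i ∧ ∀ k, IsFC A ((system A).wordProd (prefixWord i k))

/-- The inversion set of an infinite word, as the set of the reflections
`s_{i_1} ⋯ s_{i_{k-1}} s_{i_k} s_{i_{k-1}} ⋯ s_{i_1}`. Two infinite reduced words define the same
limit element iff their inversion sets are equal. -/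
def Inv (A : Matrix (Fin (n + 1)) (Fin (n + 1)) ℤ) (i : ℕ → Fin (n + 1)) :
    Set (coxeter A).Group :=
  {t | ∃ k, t = (system A).wordProd (prefixWord i k) * (system A).simple (i k) *
    ((system A).wordProd (prefixWord i k))⁻¹}

/-- The infinite word `w u u u ⋯` (used only for nonempty `u`). -/
def infWord (w u : List (Fin (n + 1))) (k : ℕ) : Fin (n + 1) :=
  if k < w.length then w.getD k 0 else u.getD ((k - w.length) % u.length) 0

/-- A Coxeter word: every generator occurs exactly once, in some order. -/
def IsCoxeterWord (c : List (Fin (n + 1))) : Prop :=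
  c.Perm (List.finRange (n + 1))

/-! ### The affine action and infinite translation elements

A point `x` is represented by its pairings `p j = ⟨x, α_j⟩` with `α_0 = -ξ, α_1, …, α_n`, where `ξ`
is the highest root. -/

/-- The coroot `α_i^∨` (with `α_0^∨ = -ξ^∨`). -/
def coroot (A : Matrix (Fin (n + 1)) (Fin (n + 1)) ℤ) (i : Fin (n + 1)) : Fin (n + 1) → ℝ :=
  fun j => (A j i : ℝ)

/-- The space `V`, spanned by the coroots. -/
def V (A : Matrix (Fin (n + 1)) (Fin (n + 1)) ℤ) : Submodule ℝ (Fin (n + 1) → ℝ) :=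
  Submodule.span ℝ (Set.range (coroot A))

/-- The coroot lattice `Q^∨`, generated by the simple coroots `α_1^∨, …, α_n^∨`. -/
def corootLattice (A : Matrix (Fin (n + 1)) (Fin (n + 1)) ℤ) : AddSubgroup (Fin (n + 1) → ℝ) :=
  AddSubgroup.closure (coroot A '' {i | i ≠ 0})

/-- The action of `s_i`: for `i ≠ 0` the linear reflection `x ↦ x - ⟨x, α_i⟩ α_i^∨`, for `i = 0` the
reflection `x ↦ x - (⟨x, α_0⟩ + 1) α_0^∨` in the hyperplane `⟨x, ξ⟩ = 1`. -/
def reflect (A : Matrix (Fin (n + 1)) (Fin (n + 1)) ℤ) (i : Fin (n + 1))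
    (p : Fin (n + 1) → ℝ) : Fin (n + 1) → ℝ :=
  p - (p i + if i = 0 then 1 else 0) • coroot A i

/-- The action of `s_{i_1} s_{i_2} ⋯ s_{i_k}`. -/
def act (A : Matrix (Fin (n + 1)) (Fin (n + 1)) ℤ) (ω : List (Fin (n + 1)))
    (p : Fin (n + 1) → ℝ) : Fin (n + 1) → ℝ :=
  ω.foldr (reflect A) p

/-- `ω` is the fundamental coweight `ω_k^∨`: `⟨α_j, ω⟩ = δ_{jk}` for `1 ≤ j ≤ n`. -/
def IsFundamentalCoweight (A : Matrix (Fin (n + 1)) (Fin (n + 1)) ℤ) (k : Fin (n + 1))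
    (ω : Fin (n + 1) → ℝ) : Prop :=
  k ≠ 0 ∧ ω ∈ V A ∧ ∀ j, j ≠ 0 → ω j = if j = k then 1 else 0

/-- `τ` is a reduced word of the translation `t_l`. -/
def IsTranslationWord (A : Matrix (Fin (n + 1)) (Fin (n + 1)) ℤ) (τ : List (Fin (n + 1)))
    (l : Fin (n + 1) → ℝ) : Prop :=
  (system A).IsReduced τ ∧ ∀ p ∈ V A, act A τ p = p + l

/-- The infinite word `i` belongs to the coweight `ω_k^∨`: its limit element is `[t_{v(mω_k^∨)}^∞]`
for some element `v` of the finite Weyl group (given by a word `v` without the letter `0`), where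
`m` is the smallest positive integer with `mω_k^∨ ∈ Q^∨`. -/
def BelongsToCoweight (A : Matrix (Fin (n + 1)) (Fin (n + 1)) ℤ) (k : Fin (n + 1))
    (i : ℕ → Fin (n + 1)) : Prop :=
  ∃ (ω : Fin (n + 1) → ℝ) (m : ℕ) (v τ : List (Fin (n + 1))),
    IsFundamentalCoweight A k ω ∧
    IsLeast {m : ℕ | 0 < m ∧ (m : ℝ) • ω ∈ corootLattice A} m ∧
    (0 : Fin (n + 1)) ∉ v ∧
    IsTranslationWord A τ (act A v ((m : ℝ) • ω)) ∧
    IsInfReduced A (infWord [] τ) ∧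
    Inv A i = Inv A (infWord [] τ)

/-! ### Lists of words -/

/-- The ascending word `a, a+1, …, b` (empty if `b < a`). -/
def up (a b : ℕ) : List ℕ := List.range' a (b + 1 - a)

/-- The descending word `a, a-1, …, b` (empty if `a < b`). -/
def down (a b : ℕ) : List ℕ := (List.range' b (a + 1 - b)).reverse

/-- A word in the labels `0, …, n`. -/
def toWord (n : ℕ) (l : List ℕ) : List (Fin (n + 1)) := l.map (Fin.ofNat (n + 1))

/-- `rows` is a full list of the fully commutative infinite words of type `A`, a row `(u, k)`
standing for the words `w u^∞`, of coweight `ω_k^∨`: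
* every `u^∞` is a fully commutative infinite reduced word;
* the fully commutative infinite reduced words are exactly those infinite reduced words whose limit
  element is that of a fully commutative infinite reduced word `w u^∞` with `u` in the list;
* every fully commutative infinite reduced word `w u^∞` belongs to the coweight of its row. -/
def IsFullList {n : ℕ} (A : Matrix (Fin (n + 1)) (Fin (n + 1)) ℤ)
    (rows : List (List ℕ × ℕ)) : Prop :=
  (∀ r ∈ rows, IsInfFC A (infWord [] (toWord n r.1))) ∧
  (∀ i : ℕ → Fin (n + 1), IsInfReduced A i →
    (IsInfFC A i ↔ ∃ r ∈ rows, ∃ w : List (Fin (n + 1)),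
      IsInfFC A (infWord w (toWord n r.1)) ∧ Inv A i = Inv A (infWord w (toWord n r.1)))) ∧
  (∀ r ∈ rows, ∀ w : List (Fin (n + 1)), IsInfFC A (infWord w (toWord n r.1)) →
    BelongsToCoweight A (Fin.ofNat (n + 1) r.2) (infWord w (toWord n r.1)))

end AffineFC

end

/-! ### The root representation and the sign of a root. -/

namespace AffineFC

variable {n : ℕ} {A : Matrix (Fin (n + 1)) (Fin (n + 1)) ℤ}

/-! ### The root representation -/

/-! A functional f on the root lattice is regarded as a labelling of the diagram by its values on
the simple roots; the Weyl group acts on such states, and the letter a may be fired at f when f is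
negative at a. The inversions of a word that can be fired letter by letter (`NegWord`) are roots on
which f is negative. Therefore such a word is reduced, and every reduced word of its product can be
fired as well (`negWord_of_wordProd_eq`). A braid word can only be fired from a state that is
negative at both of its nodes. So if no state in the orbit of f is negative at two adjacent nodes
(`Good`), all words fired from f are fully commutative.

Conversely, let w_k be the prefixes of an infinite reduced word. The vectors w_k ρ are unbounded
while their pairing with the null root δ is constant, so their directions accumulate at a nonzero
functional e that vanishes on δ (level zero). A root that is strictly negative on e is eventually an
inversion of the prefixes considered. If the word is fully commutative, then e is good and the word
is fired from e (`IsLimitDirection.good`, `IsLimitDirection.infNeg`), since otherwise a braid word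
could be assembled from eventual inversions. Two facts about level zero enter: orbits are finite
(`IsAffine.finite_orbit`), because the invariant form is positive semidefinite with kernel spanned
by δ; and every state of an orbit can be reached by firing (`IsAffine.exists_negWord`), by a double
count weighted with the marks.

A good level zero state determines the limit element of any infinite word fired from it. Every
letter recurs in such a word (`InfNeg.recurrent`), and the letters in front of a fireable letter
commute with it, so that it can be pulled to the front; hence two such words have the same
inversions (`InfNeg.inv_eq`). Up to positive scaling, every good level zero state is conjugate to a
fundamental coweight (`Good.exists_fcw`). What has to be known is therefore which coweights are good
and, outside type A, one closed fired word u in the orbit of each good one; a fired word that leads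
to the start of u supplies w. A reduced word of the translation by a positive multiple of e is
itself a closed fired word at e (`IsTranslation.negWord`), which gives the statement on
translations. `isFullList_of_isRow` turns these data into the classification.

In types B, C, D the group acts by signed permutations and the good coweights are those with
coordinates 1, 0, …, 0 or proportional to a vector of signs. The exceptional types are finite
computations with integer lists. In type A, up to positive scaling, the states in the orbits of
coweights are the acyclic orientations of the cycle, that is, those of Coxeter words, and firing the
first letter of a Coxeter word rotates the word. -/

/-- Generalized Cartan matrices all of whose rank two submatrices are of finite type or of
type `Ã_1`. -/
structure IsCartan (A : Matrix (Fin (n + 1)) (Fin (n + 1)) ℤ) : Prop where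
  diag : ∀ i, A i i = 2
  off : ∀ i j, i ≠ j → (A i j, A j i) ∈
    [(0, 0), (-1, -1), (-1, -2), (-2, -1), (-1, -3), (-3, -1), (-2, -2)]

theorem coxeter_apply_of_ne (A : Matrix (Fin (n + 1)) (Fin (n + 1)) ℤ) {i j : Fin (n + 1)}
    (h : i ≠ j) : coxeter A i j = bondOrder (A i j * A j i) :=
  if_neg h

/-- The simple root `α_i`, as a coefficient vector. -/
def sroot (i : Fin (n + 1)) : Fin (n + 1) → ℤ := Pi.single i 1

/-- The pairing of a root vector with the simple coroot `α_i^∨`. -/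
def corootPair (A : Matrix (Fin (n + 1)) (Fin (n + 1)) ℤ) (i : Fin (n + 1)) :
    (Fin (n + 1) → ℤ) →ₗ[ℤ] ℤ :=
  ∑ j, A j i • LinearMap.proj j

theorem corootPair_apply (i : Fin (n + 1)) (β : Fin (n + 1) → ℤ) :
    corootPair A i β = ∑ j, A j i * β j := by
  simp [corootPair]

@[simp] theorem corootPair_sroot (i j : Fin (n + 1)) : corootPair A i (sroot j) = A j i := by
  simp [corootPair_apply, sroot, Pi.single_apply]

/-- The simple reflection on root vectors. -/
def rootRefl (A : Matrix (Fin (n + 1)) (Fin (n + 1)) ℤ) (i : Fin (n + 1)) :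
    Module.End ℤ (Fin (n + 1) → ℤ) :=
  LinearMap.id - (corootPair A i).smulRight (sroot i)

theorem rootRefl_apply (i : Fin (n + 1)) (β : Fin (n + 1) → ℤ) :
    rootRefl A i β = β - corootPair A i β • sroot i := by
  simp [rootRefl]

theorem rootRefl_add (hA : IsCartan A) (i j : Fin (n + 1)) (β : Fin (n + 1) → ℤ) (x y : ℤ) :
    rootRefl A i (β + x • sroot i + y • sroot j) =
      β + (-x - corootPair A i β - y * A j i) • sroot i + y • sroot j := by
  simp only [rootRefl_apply, map_add, map_smul, corootPair_sroot, hA.diag]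
  module

theorem rootRefl_add' (hA : IsCartan A) (i j : Fin (n + 1)) (β : Fin (n + 1) → ℤ) (x y : ℤ) :
    rootRefl A j (β + x • sroot i + y • sroot j) =
      β + x • sroot i + (-y - corootPair A j β - x * A i j) • sroot j := by
  simp only [rootRefl_apply, map_add, map_smul, corootPair_sroot, hA.diag]
  module

theorem rootRefl_isLiftable (hA : IsCartan A) : (coxeter A).IsLiftable (rootRefl A) := by
  intro i j
  refine LinearMap.ext fun β => ?_
  -- The two reflections preserve the coset of β modulo the span of α_i and α_j and act on its
  -- coordinates by affine maps. The relation of each finite rank two type thus becomes an explicit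
  -- identity in two coordinates; for type Ã_1 the order 0 makes it empty.
  have hβ : β = β + (0 : ℤ) • sroot i + (0 : ℤ) • sroot j := by simp
  by_cases hij : i = j
  · subst hij
    have h1 : coxeter A i i = 1 := (coxeter A).diagonal i
    rw [h1, pow_one]
    simp only [Module.End.mul_apply, Module.End.one_apply, rootRefl_apply, map_sub, map_smul,
      corootPair_sroot, hA.diag]
    module
  · have hp := hA.off i j hij
    rw [coxeter_apply_of_ne A hij]
    simp only [List.mem_cons, Prod.mk.injEq, List.not_mem_nil, or_false] at hp
    rcases hp with h | h | h | h | h | h | h <;> obtain ⟨h1, h2⟩ := h <;>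
      (rw [h1, h2]; norm_num [bondOrder])
    all_goals
      refine (congrArg _ hβ).trans ?_
      simp only [pow_succ, pow_zero, one_mul, Module.End.mul_apply, rootRefl_add hA,
        rootRefl_add' hA, h1, h2]
      ring_nf

/-- The Weyl group acting on root vectors. -/
def rootRep (hA : IsCartan A) : (coxeter A).Group →* Module.End ℤ (Fin (n + 1) → ℤ) :=
  (system A).lift ⟨rootRefl A, rootRefl_isLiftable hA⟩

@[simp] theorem rootRep_simple (hA : IsCartan A) (i : Fin (n + 1)) :
    rootRep hA ((system A).simple i) = rootRefl A i := by
  exact (system A).lift_apply_simple (rootRefl_isLiftable hA) i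

theorem rootRep_mul_apply (hA : IsCartan A) (v w : (coxeter A).Group) (β : Fin (n + 1) → ℤ) :
    rootRep hA (v * w) β = rootRep hA v (rootRep hA w β) := by
  rw [map_mul]; rfl

theorem rootRep_inv_apply (hA : IsCartan A) (w : (coxeter A).Group) (β : Fin (n + 1) → ℤ) :
    rootRep hA w⁻¹ (rootRep hA w β) = β := by
  rw [← rootRep_mul_apply]; simp

theorem rootRep_apply_inv (hA : IsCartan A) (w : (coxeter A).Group) (β : Fin (n + 1) → ℤ) :
    rootRep hA w (rootRep hA w⁻¹ β) = β := by
  rw [← rootRep_mul_apply]; simp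

theorem rootRefl_sroot (hA : IsCartan A) (i : Fin (n + 1)) :
    rootRefl A i (sroot i) = -sroot i := by
  rw [rootRefl_apply, corootPair_sroot, hA.diag]; module

theorem rootRep_ne_zero (hA : IsCartan A) (w : (coxeter A).Group) (i : Fin (n + 1)) :
    rootRep hA w (sroot i) ≠ 0 := by
  intro h
  have := rootRep_inv_apply hA w (sroot i)
  rw [h, map_zero] at this
  simpa [sroot] using congrFun this i

/-! ### Positive and negative roots -/

open CoxeterSystem in
/-- The coefficients of `⋯ s_t s_i s_t α_i` (`k` letters). -/
def dihedralCoeff (a b : ℤ) : ℕ → ℤ × ℤ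
  | 0 => (1, 0)
  | k + 1 => if Even k then
      ((dihedralCoeff a b k).1, -(dihedralCoeff a b k).2 - (dihedralCoeff a b k).1 * a)
    else (-(dihedralCoeff a b k).1 - (dihedralCoeff a b k).2 * b, (dihedralCoeff a b k).2)

open CoxeterSystem in
theorem rootRep_alternatingWord (hA : IsCartan A) (i t : Fin (n + 1)) (k : ℕ) :
    rootRep hA ((system A).wordProd (alternatingWord i t k)) (sroot i) =
      (dihedralCoeff (A i t) (A t i) k).1 • sroot i +
      (dihedralCoeff (A i t) (A t i) k).2 • sroot t := by
  induction k with
  | zero => simp [alternatingWord, dihedralCoeff]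
  | succ k ih =>
    rw [alternatingWord_succ', wordProd_cons, rootRep_mul_apply, ih, dihedralCoeff, rootRep_simple]
    split_ifs with h
    · have := rootRefl_add' hA i t 0 (dihedralCoeff (A i t) (A t i) k).1
        (dihedralCoeff (A i t) (A t i) k).2
      simpa using this
    · have := rootRefl_add hA i t 0 (dihedralCoeff (A i t) (A t i) k).1
        (dihedralCoeff (A i t) (A t i) k).2
      simpa using this

theorem dihedralCoeff_affine (k : ℕ) :
    dihedralCoeff (-2) (-2) k = if Even k then ((k : ℤ) + 1, (k : ℤ)) else ((k : ℤ), (k : ℤ) + 1) := by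
  induction k with
  | zero => simp [dihedralCoeff]
  | succ k ih =>
    rw [dihedralCoeff, ih]
    by_cases h : Even k
    · simp [h, Nat.even_add_one]; ring
    · simp [h, Nat.even_add_one]; ring

/-- Fewer than m_{it} alternating letters, the first applied being t, cannot make α_i negative
inside the dihedral group. This is a finite check for finite order; for type Ã_1, where k is
unbounded, the closed form `dihedralCoeff_affine` decides. -/
theorem dihedralCoeff_nonneg (hA : IsCartan A) {i t : Fin (n + 1)} (hit : i ≠ t) {k : ℕ}
    (hk : coxeter A i t ≠ 0 → k < coxeter A i t) :
    0 ≤ (dihedralCoeff (A i t) (A t i) k).1 ∧ 0 ≤ (dihedralCoeff (A i t) (A t i) k).2 := by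
  have hp := hA.off i t hit
  rw [coxeter_apply_of_ne A hit] at hk
  simp only [List.mem_cons, Prod.mk.injEq, List.not_mem_nil, or_false] at hp
  rcases hp with h | h | h | h | h | h | h <;> obtain ⟨h1, h2⟩ := h <;> rw [h1, h2] at hk ⊢
  on_goal 7 =>
    rw [dihedralCoeff_affine]
    split_ifs <;> constructor <;> simp <;> positivity
  all_goals
    norm_num [bondOrder] at hk
    interval_cases k <;> simp (decide := true)

-- The leftmost letter of the alternating factor can be absorbed into v: this raises the length of v
-- by at most one, and subadditivity gives the other inequality.
open CoxeterSystem in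
theorem length_wordProd_alternatingWord_step {v w : (coxeter A).Group} {i t : Fin (n + 1)} {k : ℕ}
    (hw : w = v * (system A).wordProd (alternatingWord i t (k + 1)))
    (hl : (system A).length w = (system A).length v + (k + 1)) :
    ∃ v', w = v' * (system A).wordProd (alternatingWord i t k) ∧
      (system A).length w = (system A).length v' + k := by
  rw [alternatingWord_succ', wordProd_cons, ← mul_assoc] at hw
  refine ⟨_, hw, le_antisymm ?_ ?_⟩
  · conv_lhs => rw [hw]
    refine ((system A).length_mul_le _ _).trans (Nat.add_le_add_left ?_ _)
    exact ((system A).length_wordProd_le _).trans (by simp)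
  · have := (system A).length_mul_simple v (if Even k then t else i)
    omega

open CoxeterSystem in
/-- If `ℓ(w s_i) > ℓ(w)` then `w α_i` is a positive root. -/
theorem rootRep_nonneg (hA : IsCartan A) (w : (coxeter A).Group) (i : Fin (n + 1))
    (hi : ¬ (system A).IsRightDescent w i) : 0 ≤ rootRep hA w (sroot i) := by
  induction hN : (system A).length w using Nat.strong_induction_on generalizing w i with
  | _ N ih =>
  subst hN
  by_cases hw : w = 1
  · subst hw
    intro k
    simp only [map_one, Module.End.one_apply, sroot, Pi.zero_apply, Pi.single_apply]
    split_ifs <;> simp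
  obtain ⟨t, ht⟩ := (system A).exists_rightDescent_of_ne_one hw
  have hit : i ≠ t := by rintro rfl; exact hi ht
  -- Length-additive factorizations of w with an alternating right factor of k letters ending in the
  -- right descent t. For maximal k the left factor v is shorter than w and ascends at both i and t,
  -- so induction applies to v α_i and v α_t, and w α_i is a nonnegative combination of them.
  let P : ℕ → Prop := fun k => ∃ v, w = v * (system A).wordProd (alternatingWord i t k) ∧
      (system A).length w = (system A).length v + k
  have hP1 : P 1 := by
    refine ⟨w * (system A).simple t, ?_, ?_⟩
    · exact (simple_mul_simple_cancel_right (system A) t).symm.trans (by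
        simp only [alternatingWord, List.concat_nil, wordProd_singleton])
    · exact ((system A).isRightDescent_iff.1 ht).symm
  have hPle : ∀ k, P k → k ≤ (system A).length w := by
    rintro k ⟨v, -, h⟩; omega
  have hdown : ∀ k, P (k + 1) → P k := by
    rintro k ⟨v, h1, h2⟩
    exact length_wordProd_alternatingWord_step h1 h2
  have hdown' : ∀ k d, P (k + d) → P k := by
    intro k d
    induction d with
    | zero => exact id
    | succ d ihd => exact fun h => ihd (hdown _ h)
  classical
  obtain ⟨k, hk, hmax⟩ : ∃ k, P k ∧ ¬ P (k + 1) := by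
    by_contra! hcon
    have : ∀ k, P (k + 1) := by
      intro k
      induction k with
      | zero => exact hP1
      | succ k ihk => exact hcon _ ihk
    have := hPle _ (this ((system A).length w))
    omega
  have hk1 : 1 ≤ k := by
    rcases Nat.eq_zero_or_pos k with h | h
    · subst h; exact absurd hP1 hmax
    · exact h
  -- A factor with m_{it} letters would be a braid word; rewritten to end in i, it would make i a
  -- right descent of w.
  have hkM : coxeter A i t ≠ 0 → k < coxeter A i t := by
    intro hM
    by_contra! hle
    obtain ⟨m, hm⟩ : ∃ m, coxeter A i t = m + 1 := Nat.exists_eq_succ_of_ne_zero hM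
    have hPM : P (coxeter A i t) := hdown' _ (k - coxeter A i t) (by
      rwa [Nat.add_sub_cancel' hle])
    obtain ⟨v, h1, h2⟩ := hPM
    apply hi
    have hbr := (system A).wordProd_braidWord_eq i t
    unfold braidWord at hbr
    rw [(coxeter A).symmetric t i, hm, alternatingWord_succ t i, wordProd_concat] at hbr
    rw [hm, hbr, ← mul_assoc] at h1
    have h3 : w * (system A).simple i = v * (system A).wordProd (alternatingWord i t m) := by
      rw [h1, simple_mul_simple_cancel_right]
    have h4 := (system A).length_mul_le v ((system A).wordProd (alternatingWord i t m))
    have h5 := (system A).length_wordProd_le (alternatingWord i t m)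
    rw [length_alternatingWord] at h5
    unfold IsRightDescent
    rw [h3]
    omega
  obtain ⟨v, hv, hlv⟩ := hk
  -- The letter that would continue the alternating word to the left contradicts maximality of k;
  -- the other one would cancel its first letter and contradict additivity of lengths.
  have hnot : ∀ r, r = i ∨ r = t → ¬ (system A).IsRightDescent v r := by
    have hr : ∀ r, r = (if Even k then t else i) → ¬ (system A).IsRightDescent v r := by
      rintro r rfl hd
      apply hmax
      refine ⟨v * (system A).simple (if Even k then t else i), ?_, ?_⟩
      · rw [alternatingWord_succ', wordProd_cons, mul_assoc, simple_mul_simple_cancel_left]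
        exact hv
      · have := (system A).isRightDescent_iff.1 hd
        omega
    have hr' : ∀ r, r = (if Even (k - 1) then t else i) → ¬ (system A).IsRightDescent v r := by
      rintro r rfl hd
      obtain ⟨m, rfl⟩ : ∃ m, k = m + 1 := ⟨k - 1, by omega⟩
      rw [alternatingWord_succ', wordProd_cons, ← mul_assoc] at hv
      simp only [Nat.add_sub_cancel] at hd
      have h4 := (system A).length_mul_le (v * (system A).simple (if Even m then t else i))
        ((system A).wordProd (alternatingWord i t m))
      have h5 := (system A).length_wordProd_le (alternatingWord i t m)
      rw [length_alternatingWord] at h5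
      rw [← hv] at h4
      have := (system A).isRightDescent_iff.1 hd
      omega
    obtain ⟨m, rfl⟩ : ∃ m, k = m + 1 := ⟨k - 1, by omega⟩
    simp only [Nat.add_sub_cancel, Nat.even_add_one] at hr hr'
    rintro r (rfl | rfl)
    · by_cases he : Even m
      · exact hr _ (by simp [he])
      · exact hr' _ (by simp [he])
    · by_cases he : Even m
      · exact hr' _ (by simp [he])
      · exact hr _ (by simp [he])
  have hvi := ih _ (by omega) v i (hnot i (Or.inl rfl)) rfl
  have hvt := ih _ (by omega) v t (hnot t (Or.inr rfl)) rfl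
  obtain ⟨hc, hd⟩ := dihedralCoeff_nonneg hA hit hkM
  rw [hv, rootRep_mul_apply, rootRep_alternatingWord, map_add, map_smul, map_smul]
  exact add_nonneg (smul_nonneg hc hvi) (smul_nonneg hd hvt)

theorem rootRep_nonpos (hA : IsCartan A) (w : (coxeter A).Group) (i : Fin (n + 1))
    (hi : (system A).IsRightDescent w i) : rootRep hA w (sroot i) ≤ 0 := by
  have h := rootRep_nonneg hA (w * (system A).simple i) i
    ((system A).isRightDescent_iff_not_isRightDescent_mul.1 hi)
  rw [rootRep_mul_apply, rootRep_simple, rootRefl_sroot hA, map_neg] at h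
  simpa using h

/-- The height of a root vector. -/
def height : (Fin (n + 1) → ℤ) →ₗ[ℤ] ℤ := ∑ j, LinearMap.proj j

theorem height_apply (β : Fin (n + 1) → ℤ) : height β = ∑ j, β j := by simp [height]

theorem height_pos {β : Fin (n + 1) → ℤ} (h : 0 ≤ β) (h0 : β ≠ 0) : 0 < height β := by
  rw [height_apply]
  obtain ⟨i, hi⟩ := Function.ne_iff.1 h0
  exact Finset.sum_pos' (fun i _ => h i) ⟨i, Finset.mem_univ _, lt_of_le_of_ne (h i) (Ne.symm hi)⟩

theorem rootRep_nonneg_of_height (hA : IsCartan A) {w : (coxeter A).Group} {i : Fin (n + 1)}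
    (h : 0 < height (rootRep hA w (sroot i))) : 0 ≤ rootRep hA w (sroot i) := by
  by_contra hn
  have h1 : (system A).IsRightDescent w i := by
    by_contra h2; exact hn (rootRep_nonneg hA w i h2)
  have h3 := rootRep_nonpos hA w i h1
  have := height_pos (neg_nonneg.2 h3) (neg_ne_zero.2 (rootRep_ne_zero hA w i))
  rw [map_neg] at this
  omega

/-- A root is nonzero with all coefficients of one sign, so the sign of one integer, its height,
decides descents. -/
theorem height_pos_iff (hA : IsCartan A) (w : (coxeter A).Group) (i : Fin (n + 1)) :
    0 < height (rootRep hA w (sroot i)) ↔ ¬ (system A).IsRightDescent w i := by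
  constructor
  · intro h hd
    have h3 := rootRep_nonpos hA w i hd
    have := height_pos (neg_nonneg.2 h3) (neg_ne_zero.2 (rootRep_ne_zero hA w i))
    rw [map_neg] at this
    omega
  · intro h
    exact height_pos (rootRep_nonneg hA w i h) (rootRep_ne_zero hA w i)

theorem height_neg_iff (hA : IsCartan A) (w : (coxeter A).Group) (i : Fin (n + 1)) :
    height (rootRep hA w (sroot i)) < 0 ↔ (system A).IsRightDescent w i := by
  constructor
  · intro h
    by_contra hd
    have := (height_pos_iff hA w i).2 hd
    omega
  · intro h
    have h3 := rootRep_nonpos hA w i h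
    have := height_pos (neg_nonneg.2 h3) (neg_ne_zero.2 (rootRep_ne_zero hA w i))
    rw [map_neg] at this
    omega

/-- A positive root made negative by `s_i` is a positive multiple of `α_i`. -/
theorem eq_smul_sroot (hA : IsCartan A) {w : (coxeter A).Group} {i j : Fin (n + 1)}
    (h : 0 < height (rootRep hA w (sroot j)))
    (h' : height (rootRep hA ((system A).simple i * w) (sroot j)) < 0) :
    ∃ c : ℤ, 0 < c ∧ rootRep hA w (sroot j) = c • sroot i := by
  have h1 := rootRep_nonneg_of_height hA h
  have h2 := rootRep_nonpos hA _ j ((height_neg_iff hA _ _).1 h')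
  rw [rootRep_mul_apply, rootRep_simple, rootRefl_apply] at h2
  -- The reflection s_i changes only the coordinate i, so every other coordinate is both nonnegative
  -- and nonpositive.
  have h3 : rootRep hA w (sroot j) = rootRep hA w (sroot j) i • sroot i := by
    ext k
    by_cases hk : k = i
    · subst hk; simp [sroot]
    · have h4 := h2 k
      have h5 := h1 k
      simp [sroot, hk] at h4 h5 ⊢
      omega
  refine ⟨_, ?_, h3⟩
  rw [h3] at h
  simpa [height_apply, sroot, Pi.single_apply] using h

end AffineFC

/-! ### Words fired from a state, and their full commutativity. -/

namespace AffineFC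

variable {n : ℕ} {A : Matrix (Fin (n + 1)) (Fin (n + 1)) ℤ}

/-! ### The dual representation -/

/-- The value of the functional with values `f i` on simple roots at a root vector. -/
def pair (f : Fin (n + 1) → ℝ) : (Fin (n + 1) → ℤ) →ₗ[ℤ] ℝ where
  toFun β := ∑ k, f k * β k
  map_add' β γ := by simp [mul_add, Finset.sum_add_distrib]
  map_smul' c β := by
    simp only [Pi.smul_apply, smul_eq_mul, Int.cast_mul, RingHom.id_apply, zsmul_eq_mul,
      Finset.mul_sum]
    exact Finset.sum_congr rfl fun _ _ => by ring

theorem pair_apply (f : Fin (n + 1) → ℝ) (β : Fin (n + 1) → ℤ) : pair f β = ∑ k, f k * β k := rfl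

@[simp] theorem pair_sroot (f : Fin (n + 1) → ℝ) (i : Fin (n + 1)) : pair f (sroot i) = f i := by
  simp [pair_apply, sroot, Pi.single_apply]

theorem pair_add_left (f g : Fin (n + 1) → ℝ) (β : Fin (n + 1) → ℤ) :
    pair (f + g) β = pair f β + pair g β := by
  simp [pair_apply, add_mul, Finset.sum_add_distrib]

theorem pair_smul_left (c : ℝ) (f : Fin (n + 1) → ℝ) (β : Fin (n + 1) → ℤ) :
    pair (c • f) β = c * pair f β := by
  simp [pair_apply, Finset.mul_sum, mul_assoc]

/-- The Weyl group acting linearly on functionals. -/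
def lin (hA : IsCartan A) (w : (coxeter A).Group) :
    (Fin (n + 1) → ℝ) →ₗ[ℝ] (Fin (n + 1) → ℝ) where
  toFun f i := pair f (rootRep hA w⁻¹ (sroot i))
  map_add' f g := by ext i; simp [pair_add_left]
  map_smul' c f := by ext i; simp [pair_smul_left]

theorem lin_apply (hA : IsCartan A) (w : (coxeter A).Group) (f : Fin (n + 1) → ℝ)
    (i : Fin (n + 1)) : lin hA w f i = pair f (rootRep hA w⁻¹ (sroot i)) := rfl

theorem sum_smul_sroot (β : Fin (n + 1) → ℤ) : β = ∑ i, β i • sroot i := by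
  ext k
  simp [sroot, Finset.sum_apply, Pi.single_apply]

theorem pair_lin (hA : IsCartan A) (w : (coxeter A).Group) (f : Fin (n + 1) → ℝ)
    (β : Fin (n + 1) → ℤ) : pair (lin hA w f) β = pair f (rootRep hA w⁻¹ β) := by
  conv_rhs => rw [sum_smul_sroot β]
  simp only [map_sum]
  rw [pair_apply]
  exact Finset.sum_congr rfl fun i _ => by
    rw [lin_apply, map_smul, map_smul, zsmul_eq_mul, mul_comm]

theorem lin_mul_apply (hA : IsCartan A) (v w : (coxeter A).Group) (f : Fin (n + 1) → ℝ) :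
    lin hA (v * w) f = lin hA v (lin hA w f) := by
  ext i
  rw [lin_apply hA v, pair_lin, lin_apply, mul_inv_rev, rootRep_mul_apply]

theorem lin_one_apply (hA : IsCartan A) (f : Fin (n + 1) → ℝ) : lin hA 1 f = f := by
  ext i; simp [lin_apply]

theorem lin_inv_apply (hA : IsCartan A) (w : (coxeter A).Group) (f : Fin (n + 1) → ℝ) :
    lin hA w⁻¹ (lin hA w f) = f := by
  rw [← lin_mul_apply, inv_mul_cancel, lin_one_apply]

theorem lin_apply_inv (hA : IsCartan A) (w : (coxeter A).Group) (f : Fin (n + 1) → ℝ) :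
    lin hA w (lin hA w⁻¹ f) = f := by
  rw [← lin_mul_apply, mul_inv_cancel, lin_one_apply]

/-- The linear action of `s_i`. -/
def step (A : Matrix (Fin (n + 1)) (Fin (n + 1)) ℤ) (i : Fin (n + 1)) (f : Fin (n + 1) → ℝ) :
    Fin (n + 1) → ℝ :=
  f - f i • coroot A i

theorem step_apply (i j : Fin (n + 1)) (f : Fin (n + 1) → ℝ) :
    step A i f j = f j - f i * A j i := rfl

theorem lin_simple (hA : IsCartan A) (i : Fin (n + 1)) (f : Fin (n + 1) → ℝ) :
    lin hA ((system A).simple i) f = step A i f := by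
  ext j
  rw [lin_apply, CoxeterSystem.inv_simple, rootRep_simple, rootRefl_apply, corootPair_sroot,
    map_sub, map_smul, pair_sroot, pair_sroot, step_apply, zsmul_eq_mul, mul_comm]

theorem step_self (hA : IsCartan A) (i : Fin (n + 1)) (f : Fin (n + 1) → ℝ) :
    step A i f i = -f i := by
  rw [step_apply, hA.diag]; push_cast; ring

theorem step_step (hA : IsCartan A) (i : Fin (n + 1)) (f : Fin (n + 1) → ℝ) :
    step A i (step A i f) = f := by
  rw [← lin_simple hA, ← lin_simple hA, ← lin_mul_apply, CoxeterSystem.simple_mul_simple_self,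
    lin_one_apply]

theorem step_smul (i : Fin (n + 1)) (c : ℝ) (f : Fin (n + 1) → ℝ) :
    step A i (c • f) = c • step A i f := by
  ext j; simp [step_apply]; ring

/-- The linear action of the inverse of a word. -/
def run (A : Matrix (Fin (n + 1)) (Fin (n + 1)) ℤ) (f : Fin (n + 1) → ℝ)
    (l : List (Fin (n + 1))) : Fin (n + 1) → ℝ :=
  l.foldl (fun f i => step A i f) f

@[simp] theorem run_nil (f : Fin (n + 1) → ℝ) : run A f [] = f := rfl

@[simp] theorem run_cons (f : Fin (n + 1) → ℝ) (i : Fin (n + 1)) (l : List (Fin (n + 1))) :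
    run A f (i :: l) = run A (step A i f) l := rfl

theorem run_append (f : Fin (n + 1) → ℝ) (l l' : List (Fin (n + 1))) :
    run A f (l ++ l') = run A (run A f l) l' := by
  simp [run]

theorem run_smul (c : ℝ) (f : Fin (n + 1) → ℝ) (l : List (Fin (n + 1))) :
    run A (c • f) l = c • run A f l := by
  induction l generalizing f with
  | nil => rfl
  | cons i l ih => rw [run_cons, run_cons, step_smul, ih]

theorem run_eq_lin (hA : IsCartan A) (f : Fin (n + 1) → ℝ) (l : List (Fin (n + 1))) :
    run A f l = lin hA ((system A).wordProd l)⁻¹ f := by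
  induction l generalizing f with
  | nil => simp [lin_one_apply]
  | cons i l ih =>
    rw [run_cons, ih, CoxeterSystem.wordProd_cons, mul_inv_rev, lin_mul_apply,
      CoxeterSystem.inv_simple, lin_simple]

theorem pair_run (hA : IsCartan A) (f : Fin (n + 1) → ℝ) (l : List (Fin (n + 1)))
    (β : Fin (n + 1) → ℤ) :
    pair (run A f l) β = pair f (rootRep hA ((system A).wordProd l) β) := by
  rw [run_eq_lin hA, pair_lin, inv_inv]

theorem pair_step (hA : IsCartan A) (f : Fin (n + 1) → ℝ) (i : Fin (n + 1))
    (β : Fin (n + 1) → ℤ) : pair (step A i f) (rootRefl A i β) = pair f β := by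
  rw [← lin_simple hA, pair_lin, CoxeterSystem.inv_simple, ← rootRep_simple hA,
    ← rootRep_mul_apply, CoxeterSystem.simple_mul_simple_self, map_one, Module.End.one_apply]

/-! ### Negative words -/

/-- Every letter of the word is read off at a state where it has a negative value. -/
def NegWord (A : Matrix (Fin (n + 1)) (Fin (n + 1)) ℤ) :
    (Fin (n + 1) → ℝ) → List (Fin (n + 1)) → Prop
  | _, [] => True
  | f, i :: l => f i < 0 ∧ NegWord A (step A i f) l

@[simp] theorem negWord_nil (f : Fin (n + 1) → ℝ) : NegWord A f [] := trivial

@[simp] theorem negWord_cons (f : Fin (n + 1) → ℝ) (i : Fin (n + 1)) (l : List (Fin (n + 1))) :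
    NegWord A f (i :: l) ↔ f i < 0 ∧ NegWord A (step A i f) l := Iff.rfl

theorem negWord_append (f : Fin (n + 1) → ℝ) (l l' : List (Fin (n + 1))) :
    NegWord A f (l ++ l') ↔ NegWord A f l ∧ NegWord A (run A f l) l' := by
  induction l generalizing f with
  | nil => simp
  | cons i l ih => simp [ih, and_assoc]

theorem negWord_smul {c : ℝ} (hc : 0 < c) (f : Fin (n + 1) → ℝ) (l : List (Fin (n + 1))) :
    NegWord A (c • f) l ↔ NegWord A f l := by
  induction l generalizing f with
  | nil => simp
  | cons i l ih =>
    rw [negWord_cons, negWord_cons, step_smul, ih, Pi.smul_apply, smul_eq_mul]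
    constructor <;> rintro ⟨h1, h2⟩ <;> refine ⟨?_, h2⟩ <;> nlinarith

theorem negWord_of_forall {f : Fin (n + 1) → ℝ} {l : List (Fin (n + 1))}
    (h : ∀ l₁ a l₂, l = l₁ ++ a :: l₂ → run A f l₁ a < 0) : NegWord A f l := by
  induction l generalizing f with
  | nil => trivial
  | cons i l ih =>
    refine ⟨h [] i l rfl, ih fun l₁ a l₂ hl => ?_⟩
    exact h (i :: l₁) a l₂ (by rw [hl]; rfl)

theorem height_ne_zero (hA : IsCartan A) (w : (coxeter A).Group) (i : Fin (n + 1)) :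
    height (rootRep hA w (sroot i)) ≠ 0 := by
  by_cases h : (system A).IsRightDescent w i
  · exact ((height_neg_iff hA w i).2 h).ne
  · exact ((height_pos_iff hA w i).2 h).ne'

/-- When the letters of l are applied from the right, a letter i could turn the root negative only
if the root is then a positive multiple of α_i. At that stage the state has the value -f i > 0 at i,
which contradicts the negative value of the root. -/
theorem height_pos_of_negWord (hA : IsCartan A) {f : Fin (n + 1) → ℝ} {l : List (Fin (n + 1))}
    (hl : NegWord A f l) {v : (coxeter A).Group} {a : Fin (n + 1)}
    (hv : 0 < height (rootRep hA v (sroot a)))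
    (hf : pair (run A f l) (rootRep hA v (sroot a)) < 0) :
    0 < height (rootRep hA ((system A).wordProd l * v) (sroot a)) := by
  induction l generalizing f with
  | nil => simpa using hv
  | cons i l ih =>
    obtain ⟨hi, hl⟩ := hl
    have h1 := ih hl hf
    rw [CoxeterSystem.wordProd_cons, mul_assoc]
    by_contra hcon
    have h2 := lt_of_le_of_ne (not_lt.1 hcon) (height_ne_zero hA _ a)
    obtain ⟨c, hc, hce⟩ := eq_smul_sroot hA h1 h2
    rw [run_cons, pair_run hA, ← rootRep_mul_apply, hce, map_smul, pair_sroot, step_self hA,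
      zsmul_eq_mul] at hf
    have : (0 : ℝ) < c := by exact_mod_cast hc
    nlinarith

theorem isReduced_of_negWord (hA : IsCartan A) {f : Fin (n + 1) → ℝ} {l : List (Fin (n + 1))}
    (hl : NegWord A f l) : (system A).IsReduced l := by
  induction l using List.reverseRecOn with
  | nil => simp [CoxeterSystem.IsReduced]
  | append_singleton l a ih =>
    rw [negWord_append] at hl
    have h1 := height_pos_of_negWord hA hl.1 (v := 1) (a := a) (by simp [height_apply, sroot])
      (by simpa using hl.2.1)
    rw [mul_one, height_pos_iff, CoxeterSystem.not_isRightDescent_iff] at h1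
    rw [CoxeterSystem.IsReduced, CoxeterSystem.wordProd_append, CoxeterSystem.wordProd_singleton,
      h1, (ih hl.1).eq]
    simp

/-- The converse: the root changes sign at some letter i, where it is a positive multiple of α_i,
and this letter is fired at a negative value. Since pairings are invariant, the value on the
original root is negative too. -/
theorem pair_neg_of_height_neg (hA : IsCartan A) {f : Fin (n + 1) → ℝ} {l : List (Fin (n + 1))}
    (hl : NegWord A f l) {v : (coxeter A).Group} {a : Fin (n + 1)}
    (hv : 0 < height (rootRep hA v (sroot a)))
    (hf : height (rootRep hA (((system A).wordProd l)⁻¹ * v) (sroot a)) < 0) :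
    pair f (rootRep hA v (sroot a)) < 0 := by
  induction l generalizing f v with
  | nil => simp at hf; omega
  | cons i l ih =>
    obtain ⟨hi, hl⟩ := hl
    rw [CoxeterSystem.wordProd_cons, mul_inv_rev, CoxeterSystem.inv_simple, mul_assoc] at hf
    by_cases h : 0 < height (rootRep hA ((system A).simple i * v) (sroot a))
    · have h1 := ih hl h hf
      rwa [rootRep_mul_apply, rootRep_simple, pair_step hA] at h1
    · have h2 := lt_of_le_of_ne (not_lt.1 h) (height_ne_zero hA _ a)
      obtain ⟨c, hc, hce⟩ := eq_smul_sroot hA hv h2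
      rw [hce, map_smul, pair_sroot, zsmul_eq_mul]
      have : (0 : ℝ) < c := by exact_mod_cast hc
      nlinarith

theorem height_pos_of_isReduced (hA : IsCartan A) {l : List (Fin (n + 1))} {a : Fin (n + 1)}
    (h : (system A).IsReduced (l ++ [a])) :
    0 < height (rootRep hA ((system A).wordProd l) (sroot a)) := by
  rw [height_pos_iff, CoxeterSystem.not_isRightDescent_iff]
  have h1 : (system A).IsReduced l := by simpa using h.take l.length
  rw [h1.eq, ← CoxeterSystem.wordProd_singleton, ← CoxeterSystem.wordProd_append, h.eq]
  simp

theorem height_neg_of_isReduced (hA : IsCartan A) {l : List (Fin (n + 1))} {a : Fin (n + 1)}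
    (h : (system A).IsReduced (a :: l)) :
    height (rootRep hA ((system A).wordProd (a :: l))⁻¹ (sroot a)) < 0 := by
  rw [height_neg_iff, CoxeterSystem.isRightDescent_inv_iff, CoxeterSystem.IsLeftDescent,
    h.eq, CoxeterSystem.wordProd_cons, CoxeterSystem.simple_mul_simple_cancel_left]
  have := (system A).length_wordProd_le l
  simp
  omega

/-- All reduced words of an element given by a negative word are negative. -/
theorem negWord_of_wordProd_eq (hA : IsCartan A) {f : Fin (n + 1) → ℝ}
    {l l' : List (Fin (n + 1))} (hl : NegWord A f l) (hl' : (system A).IsReduced l')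
    (h : (system A).wordProd l' = (system A).wordProd l) : NegWord A f l' := by
  refine negWord_of_forall fun l₁ a l₂ hl₁ => ?_
  subst hl₁
  -- The value at which a letter of l' is fired equals the value of f on the corresponding
  -- inversion. This inversion depends only on the product, so it is also made negative by the
  -- inverse of the product of l.
  rw [← pair_sroot (run A f l₁) a, pair_run hA]
  refine pair_neg_of_height_neg hA hl ?_ ?_
  · refine height_pos_of_isReduced hA ?_
    have := hl'.take (l₁.length + 1)
    rwa [List.take_length_add_append, List.take_succ_cons, List.take_zero] at this
  · have h1 : (system A).IsReduced (a :: l₂) := by simpa using hl'.drop l₁.length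
    rw [← h, CoxeterSystem.wordProd_append, mul_inv_rev, inv_mul_cancel_right]
    exact height_neg_of_isReduced hA h1

/-- No state in the orbit of `f` is negative at two adjacent nodes. -/
def Good (hA : IsCartan A) (f : Fin (n + 1) → ℝ) : Prop :=
  ∀ w a b, a ≠ b → A a b ≠ 0 → ¬ (lin hA w f a < 0 ∧ lin hA w f b < 0)

theorem Good.lin {hA : IsCartan A} {f : Fin (n + 1) → ℝ} (h : Good hA f)
    (w : (coxeter A).Group) : Good hA (lin hA w f) := by
  intro v a b hab hAab
  rw [← lin_mul_apply]
  exact h _ a b hab hAab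

theorem Good.step {hA : IsCartan A} {f : Fin (n + 1) → ℝ} (h : Good hA f) (i : Fin (n + 1)) :
    Good hA (step A i f) := by
  rw [← lin_simple hA]; exact h.lin _

theorem Good.run {hA : IsCartan A} {f : Fin (n + 1) → ℝ} (h : Good hA f)
    (l : List (Fin (n + 1))) : Good hA (run A f l) := by
  rw [run_eq_lin hA]; exact h.lin _

theorem Good.not {hA : IsCartan A} {f : Fin (n + 1) → ℝ} (h : Good hA f) {a b : Fin (n + 1)}
    (hab : a ≠ b) (hAab : A a b ≠ 0) (ha : f a < 0) (hb : f b < 0) : False := by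
  have := h 1 a b hab hAab
  rw [lin_one_apply] at this
  exact this ⟨ha, hb⟩

theorem cartan_ne_zero_of_coxeter {a b : Fin (n + 1)} (h : 3 ≤ coxeter A a b) :
    a ≠ b ∧ A a b ≠ 0 := by
  have hab : a ≠ b := by
    rintro rfl
    have h1 : coxeter A a a = 1 := (coxeter A).diagonal a
    omega
  refine ⟨hab, fun h0 => ?_⟩
  rw [coxeter_apply_of_ne A hab, h0] at h
  norm_num [bondOrder] at h

-- The first letter of the braid word gives one of the two values directly. The root read off at the
-- last letter is the other simple root of the pair, so its value is the second one.
open CoxeterSystem in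
theorem neg_of_negWord_braidWord (hA : IsCartan A) {f : Fin (n + 1) → ℝ} {a b : Fin (n + 1)}
    (h : 3 ≤ coxeter A a b) (hf : NegWord A f (braidWord (coxeter A) a b)) :
    f a < 0 ∧ f b < 0 := by
  obtain ⟨hab, h0⟩ := cartan_ne_zero_of_coxeter h
  obtain ⟨m, hm⟩ : ∃ m, coxeter A a b = m + 1 := ⟨coxeter A a b - 1, by omega⟩
  have h1 := hf
  have h2 := hf
  unfold braidWord at h1 h2
  rw [hm, alternatingWord_succ, List.concat_eq_append, negWord_append] at h1
  rw [hm, alternatingWord_succ'] at h2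
  have h3 := h1.2.1
  have h4 := h2.1
  rw [← pair_sroot (run A f _) b, pair_run hA, rootRep_alternatingWord hA, map_add, map_smul, map_smul,
    pair_sroot, pair_sroot] at h3
  have hp := hA.off a b hab
  rw [coxeter_apply_of_ne A hab] at hm h
  simp only [List.mem_cons, Prod.mk.injEq, List.not_mem_nil, or_false] at hp
  rcases hp with h | h | h | h | h | h | h <;> obtain ⟨e1, e2⟩ := h <;> rw [e1, e2] at hm h3 <;>
    norm_num [bondOrder] at hm <;> replace hm := Nat.eq_sub_of_add_eq hm.symm <;>
    norm_num at hm <;> subst hm <;>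
    simp [dihedralCoeff, Nat.even_add_one] at h3 h4
  all_goals first | exact ⟨h3, h4⟩ | exact ⟨h4, h3⟩

/-- Every reduced word of the element is again fired from f, and a braid word inside it would start
at a state of the orbit that is negative at two adjacent nodes. -/
theorem isFC_of_negWord (hA : IsCartan A) {f : Fin (n + 1) → ℝ} (hf : Good hA f)
    {l : List (Fin (n + 1))} (hl : NegWord A f l) : IsFC A ((system A).wordProd l) := by
  rintro ω hω hωl a b hab ⟨l₁, l₂, rfl⟩
  have h1 := negWord_of_wordProd_eq hA hl hω hωl
  rw [negWord_append, negWord_append] at h1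
  obtain ⟨ha, hb⟩ := neg_of_negWord_braidWord hA hab h1.1.2
  obtain ⟨hne, h0⟩ := cartan_ne_zero_of_coxeter hab
  exact (hf.run l₁).not hne h0 ha hb

/-! ### Infinite negative words -/

@[simp] theorem prefixWord_zero (i : ℕ → Fin (n + 1)) : prefixWord i 0 = [] := rfl

theorem prefixWord_succ (i : ℕ → Fin (n + 1)) (k : ℕ) :
    prefixWord i (k + 1) = prefixWord i k ++ [i k] := by
  simp [prefixWord, List.range_succ]

theorem prefixWord_succ' (i : ℕ → Fin (n + 1)) (k : ℕ) :
    prefixWord i (k + 1) = i 0 :: prefixWord (fun m => i (m + 1)) k := by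
  simp [prefixWord, List.range_succ_eq_map]

theorem prefixWord_add (i : ℕ → Fin (n + 1)) (k l : ℕ) :
    prefixWord i (k + l) = prefixWord i k ++ prefixWord (fun m => i (k + m)) l := by
  induction l with
  | zero => simp
  | succ l ih => rw [← add_assoc, prefixWord_succ, ih, prefixWord_succ, List.append_assoc]

@[simp] theorem length_prefixWord (i : ℕ → Fin (n + 1)) (k : ℕ) : (prefixWord i k).length = k := by
  simp [prefixWord]

/-- Infinite negative words. -/
def InfNeg (A : Matrix (Fin (n + 1)) (Fin (n + 1)) ℤ) (f : Fin (n + 1) → ℝ)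
    (i : ℕ → Fin (n + 1)) : Prop :=
  ∀ k, NegWord A f (prefixWord i k)

theorem infNeg_iff {f : Fin (n + 1) → ℝ} {i : ℕ → Fin (n + 1)} :
    InfNeg A f i ↔ ∀ k, run A f (prefixWord i k) (i k) < 0 := by
  constructor
  · intro h k
    have := h (k + 1)
    rw [prefixWord_succ, negWord_append] at this
    exact this.2.1
  · intro h k
    induction k with
    | zero => trivial
    | succ k ih =>
      rw [prefixWord_succ, negWord_append]
      exact ⟨ih, h k, trivial⟩

theorem infNeg_cons {f : Fin (n + 1) → ℝ} {i : ℕ → Fin (n + 1)} :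
    InfNeg A f i ↔ f (i 0) < 0 ∧ InfNeg A (step A (i 0) f) (fun m => i (m + 1)) := by
  constructor
  · intro h
    refine ⟨(h 1).1, fun k => ?_⟩
    have := h (k + 1)
    rw [prefixWord_succ'] at this
    exact this.2
  · rintro ⟨h0, h⟩ k
    cases k with
    | zero => trivial
    | succ k => rw [prefixWord_succ']; exact ⟨h0, h k⟩

theorem InfNeg.tail {f : Fin (n + 1) → ℝ} {i : ℕ → Fin (n + 1)} (h : InfNeg A f i) (k : ℕ) :
    InfNeg A (run A f (prefixWord i k)) (fun m => i (k + m)) := by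
  intro l
  have := h (k + l)
  rw [prefixWord_add, negWord_append] at this
  exact this.2

theorem InfNeg.isInfReduced (hA : IsCartan A) {f : Fin (n + 1) → ℝ} {i : ℕ → Fin (n + 1)}
    (h : InfNeg A f i) : IsInfReduced A i :=
  fun k => isReduced_of_negWord hA (h k)

theorem InfNeg.isInfFC {hA : IsCartan A} {f : Fin (n + 1) → ℝ} (hf : Good hA f)
    {i : ℕ → Fin (n + 1)} (h : InfNeg A f i) : IsInfFC A i :=
  ⟨h.isInfReduced hA, fun k => isFC_of_negWord hA hf (h k)⟩

/-- An infinite reduced word with the inversion set of a negative word is negative. -/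
theorem InfNeg.of_inv_subset (hA : IsCartan A) {f : Fin (n + 1) → ℝ} {i j : ℕ → Fin (n + 1)}
    (hj : InfNeg A f j) (hi : IsInfReduced A i) (h : Inv A i ⊆ Inv A j) : InfNeg A f i := by
  rw [infNeg_iff]
  intro k
  obtain ⟨l, hl⟩ := h ⟨k, rfl⟩
  set v := (system A).wordProd (prefixWord i k)
  set w := (system A).wordProd (prefixWord j l)
  set β := rootRep hA v (sroot (i k)) with hβ
  set γ := rootRep hA w (sroot (j l)) with hγ
  have hβ0 : 0 < height β := height_pos_of_isReduced hA (by rw [← prefixWord_succ]; exact hi _)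
  have hγ0 : 0 < height γ := height_pos_of_isReduced hA (by
    rw [← prefixWord_succ]; exact hj.isInfReduced hA _)
  have hγf : pair f γ < 0 := by
    rw [hγ, ← pair_run, pair_sroot]; exact infNeg_iff.1 hj l
  -- Equality of reflections makes the two roots proportional: the common reflection sends β to -β
  -- and differs from the identity by multiples of γ, so 2β = cγ. Positivity of both roots gives c >
  -- 0, and the sign of f passes from γ to β.
  have h1 : rootRep hA (v * (system A).simple (i k) * v⁻¹) β = -β := by
    rw [rootRep_mul_apply, hβ, rootRep_inv_apply, rootRep_mul_apply, rootRep_simple,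
      rootRefl_sroot hA, map_neg]
  rw [hl, rootRep_mul_apply, rootRep_mul_apply, rootRep_simple, rootRefl_apply, map_sub,
    rootRep_apply_inv, map_smul, ← hγ] at h1
  set c := corootPair A (j l) (rootRep hA w⁻¹ β)
  have h2 : (2 : ℤ) • β = c • γ := by
    have : β = -(β - c • γ) := by rw [h1, neg_neg]
    rw [two_smul]
    nth_rw 2 [this]
    abel
  have hc : 0 < c := by
    have := congrArg height h2
    rw [map_smul, map_smul, smul_eq_mul, smul_eq_mul] at this
    by_contra hcon
    nlinarith
  have h3 := congrArg (pair f) h2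
  rw [map_smul, map_smul, zsmul_eq_mul, zsmul_eq_mul] at h3
  have hc' : (0 : ℝ) < c := by exact_mod_cast hc
  rw [← pair_sroot (run A f _) (i k), pair_run hA, ← hβ]
  push_cast at h3
  nlinarith

end AffineFC

/-! ### Level zero states: finite orbits, recurrence of letters, uniqueness of the limit element. -/

namespace AffineFC

variable {n : ℕ} {A : Matrix (Fin (n + 1)) (Fin (n + 1)) ℤ}

/-! ### Affine Cartan matrices -/

/-- Affine Cartan matrices with marks `δ` and symmetrizer `ε`, with a numbering of the nodes in
which the finite part is connected. -/
structure IsAffine (A : Matrix (Fin (n + 1)) (Fin (n + 1)) ℤ) (δ ε : Fin (n + 1) → ℤ) : Prop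
    extends IsCartan A where
  δ_pos : ∀ i, 0 < δ i
  δ_zero : δ 0 = 1
  δ_null : ∀ i, ∑ j, A j i * δ j = 0
  ε_pos : ∀ i, 0 < ε i
  symm : ∀ i j, ε i * A j i = ε j * A i j
  -- The quotients are the comarks; their integrality puts α_0^∨ into the coroot lattice.
  dvd : ∀ i, ε 0 ∣ ε i * δ i
  -- An infinite bond occurs only when there are no further nodes, as in Ã_1.
  infinite : ∀ i j, i ≠ j → A i j * A j i = 4 → ∀ k, k = i ∨ k = j
  nbr_zero : ∃ j, j ≠ 0 ∧ A j 0 ≠ 0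
  nbr : ∀ i : Fin (n + 1), 2 ≤ (i : ℕ) → ∃ j, j ≠ 0 ∧ j < i ∧ A j i ≠ 0

theorem IsCartan.nonpos (hA : IsCartan A) {i j : Fin (n + 1)} (h : i ≠ j) : A i j ≤ 0 := by
  have hp := hA.off i j h
  simp only [List.mem_cons, Prod.mk.injEq, List.not_mem_nil, or_false] at hp
  omega

theorem IsCartan.zero_iff (hA : IsCartan A) {i j : Fin (n + 1)} : A i j = 0 ↔ A j i = 0 := by
  by_cases h : i = j
  · rw [h]
  have hp := hA.off i j h
  simp only [List.mem_cons, Prod.mk.injEq, List.not_mem_nil, or_false] at hp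
  omega

variable {δ ε : Fin (n + 1) → ℤ}

theorem IsAffine.one_le (hA : IsAffine A δ ε) : 1 ≤ n := by
  obtain ⟨j, hj, -⟩ := hA.nbr_zero
  by_contra h
  obtain rfl : n = 0 := by omega
  exact hj (Fin.ext (by omega))

/-- The finite diagram is connected. -/
theorem IsAffine.reflTransGen_ne_zero (hA : IsAffine A δ ε) {i j : Fin (n + 1)} (hi : i ≠ 0)
    (hj : j ≠ 0) :
    Relation.ReflTransGen (fun a b => (a ≠ 0 ∧ b ≠ 0) ∧ A a b ≠ 0) i j := by
  have hsymm : Std.Symm (fun a b : Fin (n + 1) => (a ≠ 0 ∧ b ≠ 0) ∧ A a b ≠ 0) :=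
    ⟨fun a b h => ⟨h.1.symm, fun h0 => h.2 (hA.zero_iff.1 h0)⟩⟩
  have key : ∀ m : ℕ, ∀ i j : Fin (n + 1), i ≠ 0 → j ≠ 0 → (i : ℕ) = 1 → (j : ℕ) = m →
      Relation.ReflTransGen (fun a b => (a ≠ 0 ∧ b ≠ 0) ∧ A a b ≠ 0) i j := by
    intro m
    induction m using Nat.strong_induction_on with
    | _ m ih =>
    intro i j hi hj hi1 hjm
    by_cases h2 : 2 ≤ m
    · obtain ⟨k, hk0, hkj, hkA⟩ := hA.nbr j (by omega)
      exact (ih k (by rw [← hjm]; exact hkj) i k hi hk0 hi1 rfl).tail ⟨⟨hk0, hj⟩, hkA⟩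
    · have : (j : ℕ) ≠ 0 := fun h => hj (Fin.ext h)
      have : i = j := Fin.ext (by omega)
      rw [this]
  obtain ⟨o, ho⟩ : ∃ o : Fin (n + 1), (o : ℕ) = 1 := ⟨⟨1, by have := hA.one_le; omega⟩, rfl⟩
  have ho0 : o ≠ 0 := by rintro rfl; simp at ho
  exact (Relation.ReflTransGen.stdSymm.symm _ _ (key _ o i ho0 hi ho rfl)).trans
    (key _ o j ho0 hj ho rfl)

theorem IsAffine.reflTransGen (hA : IsAffine A δ ε) (i j : Fin (n + 1)) :
    Relation.ReflTransGen (fun a b => A a b ≠ 0) i j := by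
  have key : ∀ i : Fin (n + 1), ∃ k, k ≠ 0 ∧ A i k ≠ 0 := by
    intro i
    by_cases hi : i = 0
    · obtain ⟨k, hk, hk'⟩ := hA.nbr_zero
      exact ⟨k, hk, by rw [hi]; exact fun h => hk' (hA.zero_iff.1 h)⟩
    · exact ⟨i, hi, by rw [hA.diag]; norm_num⟩
  obtain ⟨k, hk, hik⟩ := key i
  obtain ⟨l, hl, hjl⟩ := key j
  refine .head hik (.tail (b := l) ?_ (fun h => hjl (hA.zero_iff.1 h)))
  clear hjl
  induction hA.reflTransGen_ne_zero hk hl with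
  | refl => exact .refl
  | tail _ h ih => exact (ih h.1.1).tail h.2

/-! ### Finiteness of level zero orbits -/

/-- Functionals vanishing on the null root. -/
def LevelZero (δ : Fin (n + 1) → ℤ) (f : Fin (n + 1) → ℝ) : Prop := pair f δ = 0

theorem IsAffine.rootRefl_δ (hA : IsAffine A δ ε) (i : Fin (n + 1)) : rootRefl A i δ = δ := by
  rw [rootRefl_apply, corootPair_apply, hA.δ_null, zero_smul, sub_zero]

theorem IsAffine.rootRep_δ (hA : IsAffine A δ ε) (w : (coxeter A).Group) :
    rootRep hA.toIsCartan w δ = δ := by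
  induction w using (system A).simple_induction_left with
  | one => simp
  | mul_simple_left w i ih => rw [rootRep_mul_apply, ih, rootRep_simple, hA.rootRefl_δ]

theorem LevelZero.lin (hA : IsAffine A δ ε) {f : Fin (n + 1) → ℝ} (hf : LevelZero δ f)
    (w : (coxeter A).Group) : LevelZero δ (lin hA.toIsCartan w f) := by
  rw [LevelZero, pair_lin, hA.rootRep_δ]; exact hf

theorem LevelZero.run (hA : IsAffine A δ ε) {f : Fin (n + 1) → ℝ} (hf : LevelZero δ f)
    (l : List (Fin (n + 1))) : LevelZero δ (run A f l) := by
  rw [run_eq_lin hA.toIsCartan]; exact hf.lin hA _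

theorem LevelZero.step (hA : IsAffine A δ ε) {f : Fin (n + 1) → ℝ} (hf : LevelZero δ f)
    (i : Fin (n + 1)) : LevelZero δ (step A i f) := hf.run hA [i]

/-- The invariant quadratic form. -/
def qform (A : Matrix (Fin (n + 1)) (Fin (n + 1)) ℤ) (ε β : Fin (n + 1) → ℤ) : ℤ :=
  ∑ i, ε i * β i * corootPair A i β

theorem IsAffine.qform_rootRefl (hA : IsAffine A δ ε) (i : Fin (n + 1)) (β : Fin (n + 1) → ℤ) :
    qform A ε (rootRefl A i β) = qform A ε β := by
  set c := corootPair A i β with hc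
  have h1 : ∑ k, ε k * β k * A i k = ε i * c := by
    rw [hc, corootPair_apply, Finset.mul_sum]
    refine Finset.sum_congr rfl fun k _ => ?_
    have := hA.symm i k
    linear_combination (-β k) * this
  have h2 : ∀ k, ε k * (rootRefl A i β) k * corootPair A k (rootRefl A i β) =
      ε k * β k * corootPair A k β - c * (ε k * β k * A i k)
      - (if k = i then c * ε i * (corootPair A i β - c * 2) else 0) := by
    intro k
    rw [rootRefl_apply, map_sub, map_smul, corootPair_sroot, ← hc, Pi.sub_apply, Pi.smul_apply,
      smul_eq_mul, smul_eq_mul]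
    by_cases hk : k = i
    · subst hk
      simp only [sroot, Pi.single_eq_same, if_true, hA.diag]
      ring
    · simp only [sroot, Pi.single_eq_of_ne hk, if_neg hk]
      ring
  unfold qform
  rw [Finset.sum_congr rfl fun k _ => h2 k, Finset.sum_sub_distrib, Finset.sum_sub_distrib,
    ← Finset.mul_sum, h1, Finset.sum_ite_eq' Finset.univ i, ← hc]
  simp only [Finset.mem_univ, if_true]
  ring

theorem IsAffine.qform_rootRep (hA : IsAffine A δ ε) (w : (coxeter A).Group)
    (β : Fin (n + 1) → ℤ) : qform A ε (rootRep hA.toIsCartan w β) = qform A ε β := by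
  induction w using (system A).simple_induction_left with
  | one => simp
  | mul_simple_left w i ih => rw [rootRep_mul_apply, rootRep_simple, hA.qform_rootRefl, ih]

theorem IsAffine.qform_sroot (hA : IsAffine A δ ε) (i : Fin (n + 1)) :
    qform A ε (sroot i) = 2 * ε i := by
  unfold qform
  rw [Finset.sum_eq_single i]
  · rw [corootPair_sroot, hA.diag]; simp [sroot]; ring
  · intro k _ hk; simp [sroot, hk]
  · simp

/-- Since δ is a null vector, the form in the variables β_i / δ_i is a weighted graph Laplacian. It
is thus positive semidefinite and controls the differences of these variables along edges. -/
theorem IsAffine.two_mul_qform (hA : IsAffine A δ ε) (β : Fin (n + 1) → ℤ) :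
    2 * (qform A ε β : ℝ) = ∑ i, ∑ j, -((ε i : ℝ) * A j i * δ i * δ j) *
      ((β i : ℝ) / δ i - (β j : ℝ) / δ j) ^ 2 := by
  have hδ : ∀ i, (δ i : ℝ) ≠ 0 := fun i => by exact_mod_cast (hA.δ_pos i).ne'
  have e : ∀ i j, -((ε i : ℝ) * A j i * δ i * δ j) * ((β i : ℝ) / δ i - (β j : ℝ) / δ j) ^ 2 =
      2 * ((ε i : ℝ) * β i * (A j i * β j)) - (ε i : ℝ) * β i ^ 2 / δ i * (A j i * δ j)
      - (ε j : ℝ) * β j ^ 2 / δ j * (A i j * δ i) := by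
    intro i j
    have hs : (ε i : ℝ) * A j i = ε j * A i j := by exact_mod_cast hA.symm i j
    have hi := hδ i
    have hj := hδ j
    rw [show (ε j : ℝ) * β j ^ 2 / δ j * (A i j * δ i) = (ε j * A i j) * (β j ^ 2 / δ j * δ i) by
      ring, ← hs]
    field_simp
    ring
  have hn : ∀ i, ∑ j, (A j i : ℝ) * δ j = 0 := fun i => by exact_mod_cast hA.δ_null i
  simp_rw [e, Finset.sum_sub_distrib]
  rw [Finset.sum_comm (f := fun i j => (ε j : ℝ) * β j ^ 2 / δ j * (A i j * δ i))]
  simp_rw [← Finset.mul_sum, hn]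
  simp [qform, corootPair_apply]

/-- All summands of the Laplacian are nonnegative, and the weight of an edge is a positive integer,
hence at least 1. -/
theorem IsAffine.sq_le_qform (hA : IsAffine A δ ε) (β : Fin (n + 1) → ℤ) {i j : Fin (n + 1)}
    (hij : i ≠ j) (h : A j i ≠ 0) :
    ((β i : ℝ) / δ i - (β j : ℝ) / δ j) ^ 2 ≤ 2 * (qform A ε β : ℝ) := by
  have hw : ∀ i j, 0 ≤ -((ε i : ℝ) * A j i * δ i * δ j) *
      ((β i : ℝ) / δ i - (β j : ℝ) / δ j) ^ 2 := by
    intro i j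
    by_cases hij : i = j
    · subst hij; simp
    · refine mul_nonneg ?_ (sq_nonneg _)
      have h1 : A j i ≤ 0 := hA.nonpos (Ne.symm hij)
      have h2 := hA.ε_pos i
      have h3 := hA.δ_pos i
      have h4 := hA.δ_pos j
      have : 0 ≤ ε i * (-A j i) * δ i * δ j := by
        have : 0 ≤ -A j i := by omega
        positivity
      have h5 : (0 : ℝ) ≤ ((ε i * (-A j i) * δ i * δ j : ℤ) : ℝ) := by exact_mod_cast this
      push_cast at h5
      linarith
  rw [hA.two_mul_qform]
  have h1 : (1 : ℝ) ≤ -((ε i : ℝ) * A j i * δ i * δ j) := by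
    have h1 : 1 ≤ -A j i := by
      have : A j i ≤ 0 := hA.nonpos (Ne.symm hij)
      omega
    have h2 := hA.ε_pos i
    have h3 := hA.δ_pos i
    have h4 := hA.δ_pos j
    have : 0 < ε i * (-A j i) * δ i * δ j := by
      have : 0 < -A j i := by omega
      positivity
    have h5 : (1 : ℝ) ≤ ((ε i * (-A j i) * δ i * δ j : ℤ) : ℝ) := by exact_mod_cast this
    push_cast at h5
    linarith
  calc ((β i : ℝ) / δ i - (β j : ℝ) / δ j) ^ 2
      ≤ -((ε i : ℝ) * A j i * δ i * δ j) * ((β i : ℝ) / δ i - (β j : ℝ) / δ j) ^ 2 :=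
        le_mul_of_one_le_left (sq_nonneg _) h1
    _ ≤ ∑ j, -((ε i : ℝ) * A j i * δ i * δ j) * ((β i : ℝ) / δ i - (β j : ℝ) / δ j) ^ 2 :=
        Finset.single_le_sum (f := fun j => -((ε i : ℝ) * A j i * δ i * δ j) *
          ((β i : ℝ) / δ i - (β j : ℝ) / δ j) ^ 2) (fun k _ => hw i k) (Finset.mem_univ j)
    _ ≤ _ := Finset.single_le_sum (f := fun i => ∑ j, -((ε i : ℝ) * A j i * δ i * δ j) *
          ((β i : ℝ) / δ i - (β j : ℝ) / δ j) ^ 2)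
          (fun k _ => Finset.sum_nonneg fun l _ => hw k l) (Finset.mem_univ i)

/-- Real roots are bounded modulo the null root. -/
theorem IsAffine.exists_bound (hA : IsAffine A δ ε) (i : Fin (n + 1)) :
    ∃ K : ℝ, ∀ w a, |(rootRep hA.toIsCartan w (sroot a) i : ℝ) / δ i -
      (rootRep hA.toIsCartan w (sroot a) 0 : ℝ) / δ 0| ≤ K := by
  obtain ⟨C, hC⟩ : ∃ C : ℝ, ∀ a, 4 * (ε a : ℝ) ≤ C := by
    obtain ⟨C, hC⟩ := (Set.finite_range fun a => 4 * (ε a : ℝ)).bddAbove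
    exact ⟨C, fun a => hC ⟨a, rfl⟩⟩
  -- The form takes the value 2 ε_a on a root conjugate to α_a. Along a path from the node 0, each
  -- edge therefore adds at most √C to the bound.
  induction hA.reflTransGen 0 i with
  | refl => exact ⟨0, fun w a => by simp⟩
  | @tail b c hb hbc ih =>
    obtain ⟨K, hK⟩ := ih
    by_cases hne : b = c
    · subst hne; exact ⟨K, hK⟩
    refine ⟨√C + K, fun w a => ?_⟩
    have h1 := hA.sq_le_qform (rootRep hA.toIsCartan w (sroot a)) (Ne.symm hne) hbc
    rw [hA.qform_rootRep, hA.qform_sroot] at h1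
    have h2 := Real.abs_le_sqrt (h1.trans (by have := hC a; push_cast; linarith))
    have h3 := hK w a
    rw [abs_le] at h2 h3 ⊢
    constructor <;> linarith [h2.1, h2.2, h3.1, h3.2]

/-- Level zero orbits are finite. -/
theorem IsAffine.finite_orbit (hA : IsAffine A δ ε) {f : Fin (n + 1) → ℝ} (hf : LevelZero δ f) :
    (Set.range fun w => lin hA.toIsCartan w f).Finite := by
  choose K hK using hA.exists_bound
  let S : Set (Fin (n + 1) → ℤ) := Set.univ.pi fun i => Set.Icc (-⌈K i * δ i⌉) ⌈K i * δ i⌉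
  have hS : S.Finite := Set.Finite.pi fun i => Set.finite_Icc _ _
  refine (Set.Finite.pi' (t := fun _ : Fin (n + 1) => pair f '' S)
    fun _ => hS.image _).subset ?_
  rintro _ ⟨w, rfl⟩ i
  set β := rootRep hA.toIsCartan w⁻¹ (sroot i) with hβ
  -- Subtracting a multiple of δ does not change the value of a level zero functional; since δ_0 =
  -- 1, the difference lies in a fixed finite box.
  refine ⟨β - β 0 • δ, ?_, ?_⟩
  · intro k _
    have h1 := hK k w⁻¹ i
    rw [← hβ, hA.δ_zero, Int.cast_one, div_one] at h1
    have h2 : (0 : ℝ) < δ k := by exact_mod_cast hA.δ_pos k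
    have h3 : |((β - β 0 • δ) k : ℝ)| ≤ K k * δ k := by
      have : ((β - β 0 • δ) k : ℝ) = ((β k : ℝ) / δ k - β 0) * δ k := by
        simp only [Pi.sub_apply, Pi.smul_apply, smul_eq_mul]
        push_cast
        field_simp
      rw [this, abs_mul, abs_of_pos h2]
      exact mul_le_mul_of_nonneg_right h1 h2.le
    rw [abs_le] at h3
    have h4 := Int.le_ceil (K k * δ k)
    constructor
    · have : (-(⌈K k * δ k⌉ : ℤ) : ℝ) ≤ ((β - β 0 • δ) k : ℝ) := by linarith
      exact_mod_cast this
    · have : ((β - β 0 • δ) k : ℝ) ≤ ⌈K k * δ k⌉ := by linarith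
      exact_mod_cast this
  · have hf' : pair f δ = 0 := hf
    rw [map_sub, map_smul, hf', smul_zero, sub_zero]
    rfl

/-! ### Recurrence -/

theorem run_prefixWord_succ (f : Fin (n + 1) → ℝ) (i : ℕ → Fin (n + 1)) (k : ℕ) :
    run A f (prefixWord i (k + 1)) = step A (i k) (run A f (prefixWord i k)) := by
  rw [prefixWord_succ, run_append]; rfl

/-- If a stopped occurring, the value at a could only decrease, and it would drop strictly at every
later b. Infinitely many such drops are impossible in a finite orbit. -/
theorem InfNeg.recurrent_of_adj (hA : IsAffine A δ ε) {f : Fin (n + 1) → ℝ} (hf : LevelZero δ f)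
    {i : ℕ → Fin (n + 1)} (hi : InfNeg A f i) {a b : Fin (n + 1)} (hab : A a b ≠ 0)
    (hb : ∀ N, ∃ k ≥ N, i k = b) : ∀ N, ∃ k ≥ N, i k = a := by
  by_contra! hcon
  obtain ⟨N, hN⟩ := hcon
  by_cases hne : a = b
  · obtain ⟨k, hk, hkb⟩ := hb N
    exact hN k hk (hkb.trans hne.symm)
  rw [infNeg_iff] at hi
  have hle : ∀ k ≥ N, run A f (prefixWord i (k + 1)) a ≤ run A f (prefixWord i k) a := by
    intro k hk
    rw [run_prefixWord_succ, step_apply]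
    have h1 : (A a (i k) : ℝ) ≤ 0 := by exact_mod_cast hA.nonpos (Ne.symm (hN k hk))
    nlinarith [hi k]
  have hanti : ∀ k ≥ N, ∀ l ≥ k, run A f (prefixWord i l) a ≤ run A f (prefixWord i k) a := by
    intro k hk l hl
    induction l, hl using Nat.le_induction with
    | base => exact le_rfl
    | succ l hl ih => exact (hle l (hk.trans hl)).trans ih
  have hfin : ((fun k => run A f (prefixWord i k) a) '' Set.Ici N).Finite := by
    refine ((hA.finite_orbit hf).image fun g => g a).subset ?_
    rintro _ ⟨k, -, rfl⟩
    exact ⟨_, ⟨_, rfl⟩, congrFun (run_eq_lin hA.toIsCartan f (prefixWord i k)).symm a⟩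
  obtain ⟨_, ⟨k, hk, rfl⟩, hmin⟩ := hfin.exists_minimal ⟨_, N, Set.mem_Ici.2 le_rfl, rfl⟩
  obtain ⟨l, hl, hlb⟩ := hb k
  have hkN : N ≤ k := hk
  have h1 : run A f (prefixWord i (l + 1)) a < run A f (prefixWord i l) a := by
    rw [run_prefixWord_succ, step_apply, hlb]
    have h1 : (A a b : ℝ) < 0 := by
      have : A a b ≤ 0 := hA.nonpos hne
      exact_mod_cast lt_of_le_of_ne this hab
    have := hi l
    rw [hlb] at this
    nlinarith
  have h2 := hanti k hkN l hl
  have h3 := hmin ⟨l + 1, Set.mem_Ici.2 (by omega), rfl⟩ (h1.le.trans h2)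
  simp only at h3
  linarith

/-- Every letter occurs infinitely often in an infinite negative word. -/
theorem InfNeg.recurrent (hA : IsAffine A δ ε) {f : Fin (n + 1) → ℝ} (hf : LevelZero δ f)
    {i : ℕ → Fin (n + 1)} (hi : InfNeg A f i) (a : Fin (n + 1)) : ∀ N, ∃ k ≥ N, i k = a := by
  obtain ⟨b, hb⟩ : ∃ b, ∀ N, ∃ k ≥ N, i k = b := by
    obtain ⟨b, hb⟩ := Finite.exists_infinite_fiber i
    refine ⟨b, fun N => ?_⟩
    rw [Set.infinite_coe_iff] at hb
    obtain ⟨k, hk, hkN⟩ := hb.exists_gt N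
    exact ⟨k, hkN.le, hk⟩
  induction hA.reflTransGen b a with
  | refl => exact hb
  | tail _ hbc ih => exact hi.recurrent_of_adj hA hf (fun h => hbc (hA.zero_iff.1 h)) ih

/-! ### Pulling letters to the front -/

theorem commute_of_eq_zero {a b : Fin (n + 1)} (hab : a ≠ b) (h : A a b = 0) :
    (system A).simple a * (system A).simple b = (system A).simple b * (system A).simple a := by
  have h1 := (system A).wordProd_braidWord_eq a b
  have h2 : coxeter A a b = 2 := by rw [coxeter_apply_of_ne A hab, h]; simp [bondOrder]
  have h3 : coxeter A b a = 2 := by rw [(coxeter A).symmetric]; exact h2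
  unfold CoxeterSystem.braidWord at h1
  rw [h2, h3] at h1
  simpa only [CoxeterSystem.alternatingWord, List.concat_eq_append, List.nil_append,
    List.cons_append, CoxeterSystem.wordProd_cons, CoxeterSystem.wordProd_nil, mul_one] using h1

/-- The infinite word `a i_1 i_2 ⋯`. -/
def consSeq (a : Fin (n + 1)) (i : ℕ → Fin (n + 1)) : ℕ → Fin (n + 1)
  | 0 => a
  | m + 1 => i m

@[simp] theorem consSeq_zero (a : Fin (n + 1)) (i : ℕ → Fin (n + 1)) : consSeq a i 0 = a := rfl

@[simp] theorem consSeq_succ (a : Fin (n + 1)) (i : ℕ → Fin (n + 1)) (m : ℕ) :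
    consSeq a i (m + 1) = i m := rfl

theorem prefixWord_consSeq (a : Fin (n + 1)) (i : ℕ → Fin (n + 1)) (k : ℕ) :
    prefixWord (consSeq a i) (k + 1) = a :: prefixWord i k := by
  rw [prefixWord_succ']; rfl

theorem wordProd_prefixWord_succ' (i : ℕ → Fin (n + 1)) (k : ℕ) :
    (system A).wordProd (prefixWord i (k + 1)) =
      (system A).simple (i 0) * (system A).wordProd (prefixWord (fun m => i (m + 1)) k) := by
  rw [prefixWord_succ', CoxeterSystem.wordProd_cons]

theorem simple_zero_mem_inv (i : ℕ → Fin (n + 1)) : (system A).simple (i 0) ∈ Inv A i :=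
  ⟨0, by simp only [prefixWord_zero, CoxeterSystem.wordProd_nil, one_mul, inv_one, mul_one]⟩

theorem conj_mem_inv {i : ℕ → Fin (n + 1)} {t : (coxeter A).Group}
    (ht : t ∈ Inv A fun m => i (m + 1)) :
    (system A).simple (i 0) * t * (system A).simple (i 0) ∈ Inv A i := by
  obtain ⟨k, rfl⟩ := ht
  refine ⟨k + 1, ?_⟩
  rw [wordProd_prefixWord_succ', mul_inv_rev, CoxeterSystem.inv_simple]
  simp only [mul_assoc]

theorem mem_inv_cases {i : ℕ → Fin (n + 1)} {t : (coxeter A).Group} (ht : t ∈ Inv A i) :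
    t = (system A).simple (i 0) ∨ ∃ t' ∈ Inv A fun m => i (m + 1),
      t = (system A).simple (i 0) * t' * (system A).simple (i 0) := by
  obtain ⟨k, rfl⟩ := ht
  cases k with
  | zero =>
    left
    simp only [prefixWord_zero, CoxeterSystem.wordProd_nil, one_mul, inv_one, mul_one]
  | succ k =>
    refine Or.inr ⟨_, ⟨k, rfl⟩, ?_⟩
    rw [wordProd_prefixWord_succ', mul_inv_rev, CoxeterSystem.inv_simple]
    simp only [mul_assoc]

/-- The letters in front of the first a are fired at negative values while the value at a is
negative. Goodness makes them non-adjacent to a, so they commute with s_a and leave the value at a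
unchanged. The conclusion keeps track of prefix products, for left divisibility, and of inversions.
-/
theorem InfNeg.exists_pull {hA : IsCartan A} {a : Fin (n + 1)} (k : ℕ) :
    ∀ {f : Fin (n + 1) → ℝ} {j : ℕ → Fin (n + 1)}, Good hA f → f a < 0 → InfNeg A f j →
    j k = a → (∀ m < k, j m ≠ a) →
    ∃ j', InfNeg A (step A a f) j' ∧
      (∀ m ≥ k, (system A).wordProd (prefixWord j (m + 1)) =
        (system A).simple a * (system A).wordProd (prefixWord j' m)) ∧
      (system A).simple a ∈ Inv A j ∧
      ∀ t ∈ Inv A j', (system A).simple a * t * (system A).simple a ∈ Inv A j := by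
  induction k with
  | zero =>
    intro f j hf ha hj hk _
    subst hk
    refine ⟨fun m => j (m + 1), (infNeg_cons.1 hj).2, fun m _ => wordProd_prefixWord_succ' j m,
      simple_zero_mem_inv j, fun t ht => conj_mem_inv ht⟩
  | succ k ih =>
    intro f j hf ha hj hk hlt
    obtain ⟨hb, hj'⟩ := infNeg_cons.1 hj
    have hne : j 0 ≠ a := hlt 0 (by omega)
    have h0 : A (j 0) a = 0 := by
      by_contra h; exact hf.not hne h hb ha
    have h0' : A a (j 0) = 0 := hA.zero_iff.1 h0
    have hcomm := commute_of_eq_zero hne h0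
    obtain ⟨j'', h1, h2, h3, h4⟩ := ih (hf.step (j 0)) (by rw [step_apply, h0']; simpa using ha)
      hj' hk (fun m hm => hlt (m + 1) (by omega))
    refine ⟨consSeq (j 0) j'', ?_, ?_, ?_, ?_⟩
    · rw [infNeg_cons]
      refine ⟨?_, ?_⟩
      · rw [consSeq_zero, step_apply, h0]; simpa using hb
      · rw [consSeq_zero, ← lin_simple hA, ← lin_simple hA, ← lin_mul_apply, hcomm, lin_mul_apply,
          lin_simple, lin_simple]
        exact h1
    · intro m hm
      obtain ⟨m, rfl⟩ : ∃ m', m = m' + 1 := ⟨m - 1, by omega⟩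
      rw [wordProd_prefixWord_succ', h2 m (by omega), prefixWord_consSeq,
        CoxeterSystem.wordProd_cons, ← mul_assoc, hcomm, mul_assoc]
    · have := conj_mem_inv h3
      rwa [hcomm, mul_assoc, CoxeterSystem.simple_mul_simple_self, mul_one] at this
    · intro t ht
      rcases mem_inv_cases ht with rfl | ⟨t', ht', rfl⟩
      · rw [consSeq_zero, ← hcomm, mul_assoc, CoxeterSystem.simple_mul_simple_self, mul_one]
        exact simple_zero_mem_inv j
      · have := conj_mem_inv (h4 t' ht')
        rw [consSeq_zero]
        convert this using 1
        calc _ = ((system A).simple a * (system A).simple (j 0)) * t' *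
              ((system A).simple (j 0) * (system A).simple a) := by simp only [mul_assoc]
          _ = ((system A).simple (j 0) * (system A).simple a) * t' *
              ((system A).simple a * (system A).simple (j 0)) := by rw [hcomm]
          _ = _ := by simp only [mul_assoc]

theorem InfNeg.exists_pull' (hA : IsAffine A δ ε) {f : Fin (n + 1) → ℝ}
    (hl : LevelZero δ f) (hf : Good hA.toIsCartan f) {j : ℕ → Fin (n + 1)} (hj : InfNeg A f j)
    {a : Fin (n + 1)} (ha : f a < 0) :
    ∃ j', InfNeg A (step A a f) j' ∧
      (∃ K, ∀ m ≥ K, (system A).wordProd (prefixWord j (m + 1)) =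
        (system A).simple a * (system A).wordProd (prefixWord j' m)) ∧
      (system A).simple a ∈ Inv A j ∧
      ∀ t ∈ Inv A j', (system A).simple a * t * (system A).simple a ∈ Inv A j := by
  classical
  have hex : ∃ k, j k = a := by
    obtain ⟨k, -, hk⟩ := hj.recurrent hA hl a 0
    exact ⟨k, hk⟩
  obtain ⟨j', h1, h2, h3⟩ := InfNeg.exists_pull (Nat.find hex) hf ha hj (Nat.find_spec hex)
    (fun m hm => Nat.find_min hex hm)
  exact ⟨j', h1, ⟨_, h2⟩, h3⟩

/-- The first letter of i is fireable and can be pulled to the front of j; both tails then start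
from the same state, and the position of the inversion in i has dropped by one. -/
theorem InfNeg.inv_subset (hA : IsAffine A δ ε) {f : Fin (n + 1) → ℝ}
    (hl : LevelZero δ f) (hf : Good hA.toIsCartan f) {i j : ℕ → Fin (n + 1)} (hi : InfNeg A f i)
    (hj : InfNeg A f j) : Inv A i ⊆ Inv A j := by
  rintro t ⟨k, rfl⟩
  induction k generalizing f i j with
  | zero =>
    obtain ⟨-, -, -, h, -⟩ := hj.exists_pull' hA hl hf (infNeg_cons.1 hi).1
    simpa only [prefixWord_zero, CoxeterSystem.wordProd_nil, one_mul, inv_one, mul_one] using h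
  | succ k ih =>
    obtain ⟨j', h1, -, -, h2⟩ := hj.exists_pull' hA hl hf (infNeg_cons.1 hi).1
    have := h2 _ (ih (hl.step hA _) (hf.step _) (infNeg_cons.1 hi).2 h1)
    rw [wordProd_prefixWord_succ', mul_inv_rev, CoxeterSystem.inv_simple]
    simpa only [mul_assoc] using this

/-- Two infinite negative words with the same starting state have the same inversion set. -/
theorem InfNeg.inv_eq (hA : IsAffine A δ ε) {f : Fin (n + 1) → ℝ}
    (hl : LevelZero δ f) (hf : Good hA.toIsCartan f) {i j : ℕ → Fin (n + 1)} (hi : InfNeg A f i)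
    (hj : InfNeg A f j) : Inv A i = Inv A j :=
  (hi.inv_subset hA hl hf hj).antisymm (hj.inv_subset hA hl hf hi)

/-- Negative words are left divisors of infinite negative words with the same starting state. -/
theorem InfNeg.exists_div (hA : IsAffine A δ ε) {f : Fin (n + 1) → ℝ}
    (hl : LevelZero δ f) (hf : Good hA.toIsCartan f) {j : ℕ → Fin (n + 1)} (hj : InfNeg A f j)
    {x : List (Fin (n + 1))} (hx : NegWord A f x) :
    ∃ (j' : ℕ → Fin (n + 1)) (K : ℕ), ∀ m ≥ K,
      (system A).wordProd (prefixWord j (m + x.length)) =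
        (system A).wordProd x * (system A).wordProd (prefixWord j' m) := by
  induction x generalizing f j with
  | nil => exact ⟨j, 0, fun m _ => by simp⟩
  | cons a x ih =>
    obtain ⟨j', h1, ⟨K, hK⟩, -⟩ := hj.exists_pull' hA hl hf hx.1
    obtain ⟨j'', K', hK'⟩ := ih (hl.step hA _) (hf.step _) h1 hx.2
    refine ⟨j'', max K K', fun m hm => ?_⟩
    rw [List.length_cons, ← add_assoc, hK _ (by have := le_max_left K K'; omega),
      hK' _ ((le_max_right K K').trans hm), CoxeterSystem.wordProd_cons, mul_assoc]

end AffineFC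

/-! ### Fully commutative infinite words are fired from their limit directions. -/

namespace AffineFC

variable {n : ℕ} {A : Matrix (Fin (n + 1)) (Fin (n + 1)) ℤ} {δ ε : Fin (n + 1) → ℤ}

/-! ### Braids at states with a zero or two negative values -/

/-- Only an infinite bond, encoded by 0, has to be excluded. In that case a and b are all the nodes,
and the level of f would be negative. -/
theorem IsAffine.three_le_coxeter (hA : IsAffine A δ ε) {f : Fin (n + 1) → ℝ}
    (hl : LevelZero δ f) {a b : Fin (n + 1)} (hab : a ≠ b) (h : A a b ≠ 0) (ha : f a ≤ 0)
    (hb : f b < 0) : 3 ≤ coxeter A a b := by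
  rw [coxeter_apply_of_ne A hab]
  have hp := hA.off a b hab
  simp only [List.mem_cons, Prod.mk.injEq, List.not_mem_nil, or_false] at hp
  rcases hp with h' | h' | h' | h' | h' | h' | h' <;> obtain ⟨h1, h2⟩ := h'
  · exact absurd h1 h
  any_goals rw [h1, h2]; norm_num [bondOrder]
  have hall := hA.infinite a b hab (by rw [h1, h2]; norm_num)
  have h3 : pair f δ < 0 := by
    rw [pair_apply]
    have hle : ∀ k, f k * (δ k : ℝ) ≤ 0 := by
      intro k
      have : (0 : ℝ) < δ k := by exact_mod_cast hA.δ_pos k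
      rcases hall k with rfl | rfl <;> nlinarith
    refine lt_of_le_of_ne (Finset.sum_nonpos fun k _ => hle k) fun h0 => ?_
    have := (Finset.sum_eq_zero_iff_of_nonpos fun k _ => hle k).1 h0 b (Finset.mem_univ _)
    have : (0 : ℝ) < δ b := by exact_mod_cast hA.δ_pos b
    nlinarith
  exact absurd hl h3.ne

-- All positive roots of the rank two system other than multiples of α_a are negative on f, and s_a
-- fixes f, so the braid word that begins with a can be fired after its first letter. The parity of
-- m_{ab} decides whether it is the braid word of (a, b) or of (b, a).
open CoxeterSystem in
theorem exists_braidWord_of_zero (hA : IsCartan A) {f : Fin (n + 1) → ℝ} {a b : Fin (n + 1)}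
    (h : 3 ≤ coxeter A a b) (ha : f a = 0) (hb : f b < 0) :
    ∃ c d y, 3 ≤ coxeter A c d ∧ braidWord (coxeter A) c d = a :: y ∧ NegWord A f y := by
  obtain ⟨hab, h0⟩ := cartan_ne_zero_of_coxeter h
  have hsymm : coxeter A b a = coxeter A a b := (coxeter A).symmetric b a
  have hp := hA.off a b hab
  have hM := coxeter_apply_of_ne A hab
  have key : ∀ y, (braidWord (coxeter A) a b = a :: y ∨ braidWord (coxeter A) b a = a :: y) →
      NegWord A f y → ∃ c d y, 3 ≤ coxeter A c d ∧ braidWord (coxeter A) c d = a :: y ∧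
        NegWord A f y := by
    rintro y (hy | hy) hn
    · exact ⟨a, b, y, h, hy, hn⟩
    · exact ⟨b, a, y, by rwa [hsymm], hy, hn⟩
  simp only [List.mem_cons, Prod.mk.injEq, List.not_mem_nil, or_false] at hp
  rcases hp with h' | h' | h' | h' | h' | h' | h' <;> obtain ⟨h1, h2⟩ := h' <;>
    rw [h1, h2] at hM <;> norm_num [bondOrder] at hM
  · omega
  · refine key [b, a] (Or.inr ?_) ?_
    · unfold braidWord; rw [hsymm, hM]; rfl
    · simp only [negWord_cons, step_apply, h1, ha]
      norm_num; grind
  · refine key [b, a, b] (Or.inl ?_) ?_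
    · unfold braidWord; rw [hM]; rfl
    · simp only [negWord_cons, step_apply, h1, h2, ha, hA.diag]
      norm_num; grind
  · refine key [b, a, b] (Or.inl ?_) ?_
    · unfold braidWord; rw [hM]; rfl
    · simp only [negWord_cons, step_apply, h1, h2, ha, hA.diag]
      norm_num; grind
  · refine key [b, a, b, a, b] (Or.inl ?_) ?_
    · unfold braidWord; rw [hM]; rfl
    · simp only [negWord_cons, step_apply, h1, h2, ha, hA.diag]
      norm_num; grind
  · refine key [b, a, b, a, b] (Or.inl ?_) ?_
    · unfold braidWord; rw [hM]; rfl
    · simp only [negWord_cons, step_apply, h1, h2, ha, hA.diag]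
      norm_num; grind
  · omega

-- All positive roots of the rank two system are nonnegative combinations of α_a and α_b, hence
-- negative on f.
open CoxeterSystem in
theorem negWord_braidWord (hA : IsCartan A) {f : Fin (n + 1) → ℝ} {a b : Fin (n + 1)}
    (h : 3 ≤ coxeter A a b) (ha : f a < 0) (hb : f b < 0) :
    NegWord A f (braidWord (coxeter A) a b) := by
  obtain ⟨hab, h0⟩ := cartan_ne_zero_of_coxeter h
  have hp := hA.off a b hab
  have hM := coxeter_apply_of_ne A hab
  simp only [List.mem_cons, Prod.mk.injEq, List.not_mem_nil, or_false] at hp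
  rcases hp with h' | h' | h' | h' | h' | h' | h' <;> obtain ⟨h1, h2⟩ := h' <;>
    rw [h1, h2] at hM <;> norm_num [bondOrder] at hM <;> unfold braidWord <;> rw [hM]
  · omega
  · change NegWord A f [b, a, b]
    simp only [negWord_cons, step_apply, h1, h2, hA.diag]
    norm_num; grind
  · change NegWord A f [a, b, a, b]
    simp only [negWord_cons, step_apply, h1, h2, hA.diag]
    norm_num; grind
  · change NegWord A f [a, b, a, b]
    simp only [negWord_cons, step_apply, h1, h2, hA.diag]
    norm_num; grind
  · change NegWord A f [a, b, a, b, a, b]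
    simp only [negWord_cons, step_apply, h1, h2, hA.diag]
    norm_num; grind
  · change NegWord A f [a, b, a, b, a, b]
    simp only [negWord_cons, step_apply, h1, h2, hA.diag]
    norm_num; grind
  · omega

/-- If `f a = 0` then some negative word `x y` from `f` is such that `x` commutes with `a` and
`a y` is a braid word. -/
theorem InfNeg.exists_braid_of_zero (hA : IsAffine A δ ε) {f : Fin (n + 1) → ℝ}
    (hl : LevelZero δ f) {j : ℕ → Fin (n + 1)} (hj : InfNeg A f j) {a : Fin (n + 1)}
    (ha : f a = 0) :
    ∃ k c d y, (∀ m < k, j m ≠ a ∧ A a (j m) = 0) ∧ run A f (prefixWord j k) a = 0 ∧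
      3 ≤ coxeter A c d ∧ CoxeterSystem.braidWord (coxeter A) c d = a :: y ∧
      NegWord A (run A f (prefixWord j k)) y := by
  classical
  -- The first letter of j that is not orthogonal to a; it exists because a itself recurs. Until
  -- then the value at a stays 0, so this letter is a proper neighbour of a.
  have hex : ∃ k, A a (j k) ≠ 0 := by
    obtain ⟨k, -, hk⟩ := hj.recurrent hA hl a 0
    exact ⟨k, by rw [hk, hA.diag]; norm_num⟩
  have hlt : ∀ m < Nat.find hex, A a (j m) = 0 := fun m hm => not_not.1 (Nat.find_min hex hm)
  have hrun : ∀ m ≤ Nat.find hex, run A f (prefixWord j m) a = 0 := by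
    intro m hm
    induction m with
    | zero => exact ha
    | succ m ih => rw [run_prefixWord_succ, step_apply, hlt m hm, ih (by omega)]; simp
  have hb := infNeg_iff.1 hj (Nat.find hex)
  have h0 := hrun _ le_rfl
  have hab : a ≠ j (Nat.find hex) := by
    intro h
    rw [← h, h0] at hb
    exact lt_irrefl _ hb
  obtain ⟨c, d, y, h1, h2, h3⟩ := exists_braidWord_of_zero hA.toIsCartan
    (hA.three_le_coxeter (hl.run hA _) hab (Nat.find_spec hex) h0.le hb) h0 hb
  refine ⟨_, c, d, y, fun m hm => ⟨?_, hlt m hm⟩, h0, h1, h2, h3⟩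
  intro h
  have := hlt m hm
  rw [h, hA.diag] at this
  norm_num at this

theorem wordProd_commute {a : Fin (n + 1)} {x : List (Fin (n + 1))}
    (h : ∀ c ∈ x, c ≠ a ∧ A a c = 0) :
    (system A).simple a * (system A).wordProd x = (system A).wordProd x * (system A).simple a := by
  induction x with
  | nil => simp only [CoxeterSystem.wordProd_nil, mul_one, one_mul]
  | cons c x ih =>
    rw [CoxeterSystem.wordProd_cons, ← mul_assoc,
      commute_of_eq_zero (h c (by simp)).1.symm (h c (by simp)).2, mul_assoc,
      ih fun d hd => h d (by simp [hd]), mul_assoc]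

theorem rootRep_wordProd_of_zero (hA : IsCartan A) {a : Fin (n + 1)} {x : List (Fin (n + 1))}
    (h : ∀ c ∈ x, A a c = 0) : rootRep hA ((system A).wordProd x) (sroot a) = sroot a := by
  induction x with
  | nil => simp
  | cons c x ih =>
    rw [CoxeterSystem.wordProd_cons, rootRep_mul_apply, ih fun d hd => h d (by simp [hd]),
      rootRep_simple, rootRefl_apply, corootPair_sroot, h c (by simp), zero_smul, sub_zero]

theorem mem_prefixWord {i : ℕ → Fin (n + 1)} {k : ℕ} {c : Fin (n + 1)}
    (h : c ∈ prefixWord i k) : ∃ m < k, i m = c := by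
  simpa [prefixWord] using h

/-! ### Extending fully commutative words to the left -/

theorem IsFC.of_mul {l l' : List (Fin (n + 1))} (hr : (system A).IsReduced (l ++ l'))
    (h : IsFC A ((system A).wordProd (l ++ l'))) : IsFC A ((system A).wordProd l') := by
  have hl' : (system A).IsReduced l' := by simpa using hr.drop l.length
  intro ω hω hωl a b hab hin
  refine h (l ++ ω) ?_ ?_ a b hab (hin.trans (List.suffix_append l ω).isInfix)
  · rw [CoxeterSystem.IsReduced, CoxeterSystem.wordProd_append, hωl,
      ← CoxeterSystem.wordProd_append, hr.eq, List.length_append, List.length_append, ← hω.eq, hωl,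
      hl'.eq]
  · rw [CoxeterSystem.wordProd_append, hωl, CoxeterSystem.wordProd_append]

theorem IsInfFC.tail {a : Fin (n + 1)} {i : ℕ → Fin (n + 1)} (h : IsInfFC A (consSeq a i)) :
    IsInfFC A i := by
  have h1 : ∀ k, (system A).IsReduced ([a] ++ prefixWord i k) := fun k => by
    have := h.1 (k + 1)
    rwa [prefixWord_consSeq] at this
  refine ⟨fun k => by simpa using (h1 k).drop 1, fun k => ?_⟩
  have := h.2 (k + 1)
  rw [prefixWord_consSeq] at this
  exact IsFC.of_mul (h1 k) this

/-- If f a < 0, then a is a left divisor of a prefix of j and the word with a in front is not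
reduced. If f a = 0, then a commutes past some letters and completes a braid word. Prepending a to a
word fired from f thus gives a word fired from s_a f. -/
theorem pos_of_isInfFC_consSeq (hA : IsAffine A δ ε) {f : Fin (n + 1) → ℝ}
    (hl : LevelZero δ f) (hf : Good hA.toIsCartan f) {j : ℕ → Fin (n + 1)} (hj : InfNeg A f j)
    {a : Fin (n + 1)} (h : IsInfFC A (consSeq a j)) : 0 < f a := by
  rcases lt_trichotomy (f a) 0 with ha | ha | ha
  · exfalso
    obtain ⟨j', K, hK⟩ := hj.exists_div hA hl hf (x := [a]) ⟨ha, trivial⟩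
    have h1 := hK K le_rfl
    have h2 := (h.1 (K + 2)).eq
    rw [prefixWord_consSeq, CoxeterSystem.wordProd_cons,
      show K + 1 = K + [a].length from rfl, h1, CoxeterSystem.wordProd_singleton,
      CoxeterSystem.simple_mul_simple_cancel_left] at h2
    have h3 := (system A).length_wordProd_le (prefixWord j' K)
    rw [h2] at h3
    simp at h3
  · exfalso
    obtain ⟨k, c, d, y, h1, h2, h3, h4, h5⟩ := hj.exists_braid_of_zero hA hl ha
    obtain ⟨j', K, hK⟩ := (hj.tail k).exists_div hA (hl.run hA _) (hf.run _) h5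
    have h6 := hK K le_rfl
    have h7 : (system A).wordProd (prefixWord (consSeq a j) (k + (K + y.length) + 1)) =
        (system A).wordProd (prefixWord j k ++ CoxeterSystem.braidWord (coxeter A) c d ++
          prefixWord j' K) := by
      rw [prefixWord_consSeq, CoxeterSystem.wordProd_cons, prefixWord_add,
        CoxeterSystem.wordProd_append, h6, ← mul_assoc, wordProd_commute, h4,
        CoxeterSystem.wordProd_append, CoxeterSystem.wordProd_append,
        CoxeterSystem.wordProd_cons]
      · simp only [mul_assoc]
      · intro c hc
        obtain ⟨m, hm, rfl⟩ := mem_prefixWord hc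
        exact h1 m hm
    refine h.2 (k + (K + y.length) + 1) _ ?_ h7.symm c d h3 ⟨_, _, rfl⟩
    have h8 := (h.1 (k + (K + y.length) + 1)).eq
    rw [CoxeterSystem.IsReduced, ← h7, h8, h4]
    simp
    omega
  · exact ha

/-! ### Limit directions of infinite reduced words -/

/-- The functional with value `1` on all simple roots. -/
def rho : Fin (n + 1) → ℝ := fun _ => 1

theorem pair_rho (β : Fin (n + 1) → ℤ) : pair rho β = height β := by
  simp [pair_apply, rho, height_apply]

/-- The functional ρ is regular: an element fixing ρ preserves the height 1 of every simple root,
whereas a nontrivial element has a descent and sends some simple root to a negative one. -/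
theorem lin_rho_injective (hA : IsCartan A) :
    Function.Injective fun w => lin hA w (rho : Fin (n + 1) → ℝ) := by
  intro v w h
  have h1 : lin hA (w⁻¹ * v) rho = rho := by
    rw [lin_mul_apply, show lin hA v rho = lin hA w rho from h, lin_inv_apply]
  by_contra hne
  have h2 : w⁻¹ * v ≠ 1 := fun h => hne (inv_mul_eq_one.1 h).symm
  have h3 : (w⁻¹ * v)⁻¹ ≠ 1 := inv_ne_one.2 h2
  obtain ⟨i, hi⟩ := (system A).exists_rightDescent_of_ne_one h3
  have h4 := congrFun h1 i
  rw [lin_apply, pair_rho] at h4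
  have h5 := (height_neg_iff hA _ i).2 hi
  have h6 : height (rootRep hA (w⁻¹ * v)⁻¹ (sroot i)) = 1 := by
    have : (rho : Fin (n + 1) → ℝ) i = 1 := rfl
    rw [this] at h4
    exact_mod_cast h4
  omega

/-- `e` is the limit direction of the chambers along a subsequence of the prefixes of `i`. -/
structure IsLimitDirection (hA : IsCartan A) (i : ℕ → Fin (n + 1)) (φ : ℕ → ℕ)
    (e : Fin (n + 1) → ℝ) : Prop where
  tendsto : Filter.Tendsto φ Filter.atTop Filter.atTop
  exists_scale : ∃ c : ℕ → ℝ, (∀ k, 0 < c k) ∧ Filter.Tendsto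
    (fun k => c k • lin hA ((system A).wordProd (prefixWord i (φ k))) rho) Filter.atTop (nhds e)

/-- The vectors w_N ρ are pairwise distinct by `lin_rho_injective` and have integral coordinates, so
only finitely many lie in a bounded set. -/
theorem exists_norm_gt (hA : IsCartan A) {i : ℕ → Fin (n + 1)} (hi : IsInfReduced A i) (k : ℕ) :
    ∃ N ≥ k, (k : ℝ) + 1 < ‖lin hA ((system A).wordProd (prefixWord i N)) rho‖ := by
  by_contra! hcon
  have hinj : Function.Injective
      fun N => lin hA ((system A).wordProd (prefixWord i N)) (rho : Fin (n + 1) → ℝ) := by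
    intro M N h
    have h1 := congrArg (system A).length (lin_rho_injective hA h)
    rwa [(hi M).eq, (hi N).eq, length_prefixWord, length_prefixWord] at h1
  have hfin : (Set.univ.pi fun _ : Fin (n + 1) => ((fun z : ℤ => (z : ℝ)) ''
      Set.Icc (-((k : ℤ) + 1)) ((k : ℤ) + 1))).Finite :=
    Set.Finite.pi fun _ => (Set.finite_Icc _ _).image _
  refine (Set.infinite_of_injective_forall_mem
    (f := fun N => lin hA ((system A).wordProd (prefixWord i (k + N))) (rho : Fin (n + 1) → ℝ))
    (fun M N h => by simpa using hinj h) fun N => ?_) hfin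
  intro a _
  refine ⟨height (rootRep hA ((system A).wordProd (prefixWord i (k + N)))⁻¹ (sroot a)), ?_, ?_⟩
  · have h1 := (norm_le_pi_norm _ a).trans (hcon (k + N) (by omega))
    rw [lin_apply, pair_rho, Real.norm_eq_abs, abs_le] at h1
    constructor
    · have := h1.1
      have h2 : ((-((k : ℤ) + 1) : ℤ) : ℝ) ≤
          height (rootRep hA ((system A).wordProd (prefixWord i (k + N)))⁻¹ (sroot a)) := by
        push_cast; linarith
      exact_mod_cast h2
    · have h2 : (height (rootRep hA ((system A).wordProd (prefixWord i (k + N)))⁻¹ (sroot a)) : ℝ)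
          ≤ (((k : ℤ) + 1 : ℤ) : ℝ) := by
        push_cast; linarith [h1.2]
      exact_mod_cast h2
  · simp only [lin_apply, pair_rho]

/-- Compactness of the unit sphere yields e. Its level is the limit of the constant pairing of ρ
with δ divided by norms that tend to infinity. -/
theorem exists_isLimitDirection (hA : IsAffine A δ ε) {i : ℕ → Fin (n + 1)}
    (hi : IsInfReduced A i) :
    ∃ φ e, IsLimitDirection hA.toIsCartan i φ e ∧ e ≠ 0 ∧ LevelZero δ e := by
  choose N hN hN' using exists_norm_gt hA.toIsCartan hi
  set v : ℕ → Fin (n + 1) → ℝ :=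
    fun k => lin hA.toIsCartan ((system A).wordProd (prefixWord i (N k))) rho with hv
  have hpos : ∀ k, 0 < ‖v k‖ := fun k => lt_trans (by positivity) (hN' k)
  obtain ⟨e, he, ψ, hψ, hlim⟩ := (isCompact_sphere (0 : Fin (n + 1) → ℝ) 1).tendsto_subseq
    (x := fun k => ‖v k‖⁻¹ • v k) (fun k => by
      rw [mem_sphere_zero_iff_norm, norm_smul, norm_inv, norm_norm, inv_mul_cancel₀ (hpos k).ne'])
  have hN1 : Filter.Tendsto N Filter.atTop Filter.atTop :=
    Filter.tendsto_atTop_mono hN Filter.tendsto_id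
  refine ⟨N ∘ ψ, e, ⟨hN1.comp hψ.tendsto_atTop, fun k => ‖v (ψ k)‖⁻¹,
    fun k => inv_pos.2 (hpos _), hlim⟩, ?_, ?_⟩
  · rintro rfl
    simp at he
  · have hcont : Continuous fun f : Fin (n + 1) → ℝ => pair f δ := by
      unfold pair
      simp only [LinearMap.coe_mk, AddHom.coe_mk]
      fun_prop
    have h1 := (hcont.tendsto e).comp hlim
    have h2 : ∀ k, pair (v k) δ = pair rho δ := fun k => by
      rw [hv]; simp only; rw [pair_lin, hA.rootRep_δ]
    have h3 : Filter.Tendsto (fun k => ‖v (ψ k)‖⁻¹ * pair rho δ) Filter.atTop (nhds 0) := by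
      have h4 : Filter.Tendsto (fun k => ‖v (ψ k)‖) Filter.atTop Filter.atTop := by
        refine Filter.tendsto_atTop_mono (fun k => (hN' (ψ k)).le) ?_
        exact Filter.tendsto_atTop_add_const_right _ _
          (tendsto_natCast_atTop_atTop.comp hψ.tendsto_atTop)
      simpa using h4.inv_tendsto_atTop.mul_const (pair rho δ)
    refine tendsto_nhds_unique h1 (h3.congr fun k => ?_)
    simp only [Function.comp_apply, pair_smul_left, h2]

section Limit

variable {hA : IsCartan A} {i : ℕ → Fin (n + 1)} {φ : ℕ → ℕ} {e : Fin (n + 1) → ℝ}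

theorem continuous_pair (β : Fin (n + 1) → ℤ) :
    Continuous fun f : Fin (n + 1) → ℝ => pair f β := by
  unfold pair
  simp only [LinearMap.coe_mk, AddHom.coe_mk]
  fun_prop

/-- Strict negativity is an open condition, so it already holds on the rescaled vectors w_k ρ for
large k; on these it says that the root is an inversion. -/
theorem IsLimitDirection.eventually_height_neg (h : IsLimitDirection hA i φ e)
    {v : (coxeter A).Group} {a : Fin (n + 1)} (hv : pair e (rootRep hA v (sroot a)) < 0) :
    ∀ᶠ k in Filter.atTop,
      height (rootRep hA (((system A).wordProd (prefixWord i (φ k)))⁻¹ * v) (sroot a)) < 0 := by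
  obtain ⟨c, hc, hlim⟩ := h.exists_scale
  filter_upwards [(((continuous_pair _).tendsto e).comp hlim).eventually (gt_mem_nhds hv)]
    with k hk
  rw [Function.comp_apply, pair_smul_left, pair_lin, ← rootRep_mul_apply, pair_rho] at hk
  have : (height (rootRep hA (((system A).wordProd (prefixWord i (φ k)))⁻¹ * v) (sroot a)) : ℝ) < 0 := by
    have := hc k
    by_contra hcon
    nlinarith
  exact_mod_cast this

theorem height_neg_of_lt (hi : IsInfReduced A i) {M N : ℕ} (h : N < M) :
    height (rootRep hA (((system A).wordProd (prefixWord i M))⁻¹ *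
      (system A).wordProd (prefixWord i N)) (sroot (i N))) < 0 := by
  obtain ⟨m, rfl⟩ : ∃ m, M = N + (m + 1) := ⟨M - N - 1, by omega⟩
  have h1 := hi (N + (m + 1))
  rw [prefixWord_add, prefixWord_succ'] at h1 ⊢
  have h2 := h1.drop N
  rw [List.drop_left' (by simp)] at h2
  rw [CoxeterSystem.wordProd_append, mul_inv_rev, inv_mul_cancel_right]
  exact height_neg_of_isReduced hA h2

/-- The root of the letter N is an inversion of all longer prefixes, but only the weak inequality
survives the limit. Strictness requires full commutativity. -/
theorem IsLimitDirection.nonpos (h : IsLimitDirection hA i φ e) (hi : IsInfReduced A i) (N : ℕ) :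
    run A e (prefixWord i N) (i N) ≤ 0 := by
  obtain ⟨c, hc, hlim⟩ := h.exists_scale
  rw [← pair_sroot (run A e _) (i N), pair_run hA]
  refine le_of_tendsto (((continuous_pair _).tendsto e).comp hlim) ?_
  filter_upwards [h.tendsto.eventually_gt_atTop N] with k hk
  rw [Function.comp_apply, pair_smul_left, pair_lin, ← rootRep_mul_apply, pair_rho]
  have h1 := height_neg_of_lt (hA := hA) hi hk
  have h2 : (height (rootRep hA (((system A).wordProd (prefixWord i (φ k)))⁻¹ *
      (system A).wordProd (prefixWord i N)) (sroot (i N))) : ℝ) < 0 := by exact_mod_cast h1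
  have := hc k
  nlinarith

/-- All the roots of the word `x`, read off after `v`, are eventually inversions of the prefixes
of `i`. -/
def EvWord (hA : IsCartan A) (i : ℕ → Fin (n + 1)) (φ : ℕ → ℕ) :
    (coxeter A).Group → List (Fin (n + 1)) → Prop
  | _, [] => True
  | v, a :: x => (∀ᶠ k in Filter.atTop,
      height (rootRep hA (((system A).wordProd (prefixWord i (φ k)))⁻¹ * v) (sroot a)) < 0) ∧
      EvWord hA i φ (v * (system A).simple a) x

theorem evWord_append (v : (coxeter A).Group) (x y : List (Fin (n + 1))) :
    EvWord hA i φ v (x ++ y) ↔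
      EvWord hA i φ v x ∧ EvWord hA i φ (v * (system A).wordProd x) y := by
  induction x generalizing v with
  | nil => simp [EvWord]
  | cons a x ih =>
    simp only [List.cons_append, EvWord, ih, CoxeterSystem.wordProd_cons, and_assoc, mul_assoc]

theorem IsLimitDirection.evWord_of_negWord (h : IsLimitDirection hA i φ e)
    {v : (coxeter A).Group} {x : List (Fin (n + 1))} (hx : NegWord A (lin hA v⁻¹ e) x) :
    EvWord hA i φ v x := by
  induction x generalizing v with
  | nil => trivial
  | cons a x ih =>
    refine ⟨h.eventually_height_neg ?_, ih ?_⟩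
    · have := hx.1
      rwa [lin_apply, inv_inv] at this
    · rw [mul_inv_rev, CoxeterSystem.inv_simple, lin_mul_apply, lin_simple]
      exact hx.2

theorem IsLimitDirection.evWord_prefixWord (h : IsLimitDirection hA i φ e)
    (hi : IsInfReduced A i) (N : ℕ) : EvWord hA i φ 1 (prefixWord i N) := by
  induction N with
  | zero => trivial
  | succ N ih =>
    rw [prefixWord_succ, evWord_append]
    refine ⟨ih, ?_, trivial⟩
    filter_upwards [h.tendsto.eventually_gt_atTop N] with k hk
    rw [one_mul]
    exact height_neg_of_lt hi hk

/-- Each letter of x is eventually a left descent of what remains after removing the previous ones,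
so x is eventually a length-additive left divisor. -/
theorem EvWord.eventually_length {v : (coxeter A).Group} {x : List (Fin (n + 1))}
    (h : EvWord hA i φ v x) :
    ∀ᶠ k in Filter.atTop,
      (system A).length (((system A).wordProd x)⁻¹ * (v⁻¹ *
        (system A).wordProd (prefixWord i (φ k)))) + x.length =
      (system A).length (v⁻¹ * (system A).wordProd (prefixWord i (φ k))) := by
  induction x generalizing v with
  | nil => exact Filter.Eventually.of_forall fun k => by simp
  | cons a x ih =>
    filter_upwards [h.1, ih h.2] with k h1 h2
    rw [height_neg_iff, ← CoxeterSystem.isLeftDescent_inv_iff, mul_inv_rev, inv_inv,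
      CoxeterSystem.isLeftDescent_iff] at h1
    rw [mul_inv_rev, CoxeterSystem.inv_simple, mul_assoc] at h2
    rw [CoxeterSystem.wordProd_cons, mul_inv_rev, CoxeterSystem.inv_simple, mul_assoc,
      List.length_cons]
    omega

/-- Some prefix of i would have a reduced word that begins with the given word and thus contains the
braid word. -/
theorem EvWord.not_braid {x y : List (Fin (n + 1))} {a b : Fin (n + 1)} (hi : IsInfFC A i)
    (hab : 3 ≤ coxeter A a b)
    (h : EvWord hA i φ 1 (x ++ CoxeterSystem.braidWord (coxeter A) a b ++ y)) : False := by
  obtain ⟨k, hk⟩ := h.eventually_length.exists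
  rw [inv_one, one_mul] at hk
  obtain ⟨z, hz, hz'⟩ := (system A).exists_isReduced
    (((system A).wordProd (x ++ CoxeterSystem.braidWord (coxeter A) a b ++ y))⁻¹ *
      (system A).wordProd (prefixWord i (φ k)))
  have h1 : (system A).wordProd (x ++ CoxeterSystem.braidWord (coxeter A) a b ++ y ++ z) =
      (system A).wordProd (prefixWord i (φ k)) := by
    rw [CoxeterSystem.wordProd_append _ _ z, ← hz', mul_inv_cancel_left]
  refine hi.2 (φ k) _ ?_ h1 a b hab ⟨x, y ++ z, by simp only [List.append_assoc]⟩
  rw [CoxeterSystem.IsReduced, h1, ← hk, hz', hz.eq]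
  simp only [List.length_append]
  omega

end Limit

/-! ### Strong connectivity of level zero orbits -/

theorem step_of_zero {f : Fin (n + 1) → ℝ} {a : Fin (n + 1)} (h : f a = 0) : step A a f = f := by
  ext j; rw [step_apply, h]; ring

/-- Every state of a level zero orbit can be reached by a negative word. -/
theorem IsAffine.exists_negWord (hA : IsAffine A δ ε) {f : Fin (n + 1) → ℝ} (hl : LevelZero δ f)
    (w : (coxeter A).Group) : ∃ x, NegWord A f x ∧ run A f x = lin hA.toIsCartan w f := by
  classical
  -- The states reachable from f. The set is finite and closed under firing; the claim is that it is
  -- closed under all reflections.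
  let S : Set (Fin (n + 1) → ℝ) := {g | ∃ x, NegWord A f x ∧ run A f x = g}
  have hS : S.Finite := by
    refine (hA.finite_orbit hl).subset ?_
    rintro g ⟨x, -, rfl⟩
    exact ⟨_, (run_eq_lin hA.toIsCartan f x).symm⟩
  have hSl : ∀ g ∈ S, LevelZero δ g := by
    rintro g ⟨x, -, rfl⟩
    exact hl.run hA x
  have hneg : ∀ g ∈ S, ∀ a, g a < 0 → step A a g ∈ S := by
    rintro g ⟨x, hx, rfl⟩ a ha
    exact ⟨x ++ [a], (negWord_append _ _ _).2 ⟨hx, ha, trivial⟩, by rw [run_append]; rfl⟩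
  let F := hS.toFinset
  have hF : ∀ g, g ∈ F ↔ g ∈ S := fun g => hS.mem_toFinset
  have hinj : ∀ a, Function.Injective (step A a) := fun a =>
    Function.LeftInverse.injective (g := step A a) (step_step hA.toIsCartan a)
  -- The reflection s_a pairs the states that are negative at a with the positive ones whose
  -- reflection stays in F, and these values cancel. What is left comes from the positive states
  -- that s_a takes out of F.
  have hsplit : ∀ a, ∑ g ∈ F, g a = ∑ g ∈ F with 0 < g a ∧ step A a g ∉ F, g a := by
    intro a
    have h1 : ∑ g ∈ F, g a = ∑ g ∈ F with g a < 0, g a + ∑ g ∈ F with ¬ g a < 0, g a :=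
      (Finset.sum_filter_add_sum_filter_not F _ _).symm
    have h2 : ∑ g ∈ F with g a < 0, g a = -∑ g ∈ F with 0 < g a ∧ step A a g ∈ F, g a := by
      rw [← Finset.sum_neg_distrib]
      refine Finset.sum_nbij' (step A a) (step A a) ?_ ?_ ?_ ?_ ?_
      · intro g hg
        rw [Finset.mem_filter] at hg ⊢
        refine ⟨(hF _).2 (hneg g ((hF g).1 hg.1) a hg.2), ?_, ?_⟩
        · rw [step_self hA.toIsCartan]; linarith [hg.2]
        · rw [step_step hA.toIsCartan]; exact hg.1
      · intro g hg
        rw [Finset.mem_filter] at hg ⊢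
        exact ⟨hg.2.2, by rw [step_self hA.toIsCartan]; linarith [hg.2.1]⟩
      · exact fun g _ => step_step hA.toIsCartan a g
      · exact fun g _ => step_step hA.toIsCartan a g
      · exact fun g _ => by rw [step_self hA.toIsCartan, neg_neg]
    have h3 : ∑ g ∈ F with ¬ g a < 0, g a = ∑ g ∈ F with 0 < g a, g a := by
      refine (Finset.sum_subset ?_ ?_).symm
      · intro g hg
        rw [Finset.mem_filter] at hg ⊢
        exact ⟨hg.1, hg.2.le.not_gt⟩
      · intro g hg hg'
        rw [Finset.mem_filter] at hg hg'
        exact le_antisymm (not_lt.1 fun h => hg' ⟨hg.1, h⟩) (not_lt.1 hg.2)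
    have h4 : ∑ g ∈ F with 0 < g a, g a = ∑ g ∈ F with 0 < g a ∧ step A a g ∈ F, g a +
        ∑ g ∈ F with 0 < g a ∧ step A a g ∉ F, g a := by
      rw [← Finset.sum_filter_add_sum_filter_not (F.filter fun g => 0 < g a)
        (fun g => step A a g ∈ F), Finset.filter_filter, Finset.filter_filter]
    rw [h1, h2, h3, h4]; ring
  have hnn : ∀ a, 0 ≤ ∑ g ∈ F, g a := fun a => by
    rw [hsplit]
    exact Finset.sum_nonneg fun g hg => (Finset.mem_filter.1 hg).2.1.le
  -- Every state has level zero, so the nonnegative column sums have weighted sum zero; as the marks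
  -- are positive, all column sums vanish.
  have hzero : ∑ a, (∑ g ∈ F, g a) * (δ a : ℝ) = 0 := by
    simp_rw [Finset.sum_mul]
    rw [Finset.sum_comm]
    exact Finset.sum_eq_zero fun g hg => hSl g ((hF g).1 hg)
  have hδ : ∀ a, (0 : ℝ) < δ a := fun a => by exact_mod_cast hA.δ_pos a
  have hz : ∀ a, ∑ g ∈ F, g a = 0 := by
    intro a
    have := (Finset.sum_eq_zero_iff_of_nonneg fun a _ =>
      mul_nonneg (hnn a) (hδ a).le).1 hzero a (Finset.mem_univ a)
    exact (mul_eq_zero.1 this).resolve_right (hδ a).ne'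
  -- With vanishing column sums no positive state can leave the set.
  have hclosed : ∀ g ∈ S, ∀ a, step A a g ∈ S := by
    intro g hg a
    rcases lt_trichotomy (g a) 0 with h | h | h
    · exact hneg g hg a h
    · rwa [step_of_zero h]
    · by_contra hcon
      have h1 := hz a
      rw [hsplit, Finset.sum_eq_zero_iff_of_nonneg fun g hg => (Finset.mem_filter.1 hg).2.1.le]
        at h1
      have := h1 g (Finset.mem_filter.2 ⟨(hF g).2 hg, h, fun h => hcon ((hF _).1 h)⟩)
      linarith
  change lin hA.toIsCartan w f ∈ S
  induction w using (system A).simple_induction_left with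
  | one => rw [lin_one_apply]; exact ⟨[], trivial, rfl⟩
  | mul_simple_left w a ih => rw [lin_mul_apply, lin_simple]; exact hclosed _ ih a

theorem IsAffine.exists_neg (hA : IsAffine A δ ε) {f : Fin (n + 1) → ℝ} (hl : LevelZero δ f)
    (h0 : f ≠ 0) : ∃ a, f a < 0 := by
  by_contra! hcon
  have hδ : ∀ a, (0 : ℝ) < δ a := fun a => by exact_mod_cast hA.δ_pos a
  apply h0
  ext a
  have h1 : ∑ k, f k * (δ k : ℝ) = 0 := hl
  have := (Finset.sum_eq_zero_iff_of_nonneg fun a _ =>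
      mul_nonneg (hcon a) (hδ a).le).1 h1 a (Finset.mem_univ a)
  exact (mul_eq_zero.1 this).resolve_right (hδ a).ne'

theorem step_ne_zero (hA : IsCartan A) {f : Fin (n + 1) → ℝ} (h : f ≠ 0) (a : Fin (n + 1)) :
    step A a f ≠ 0 := by
  intro h0
  apply h
  rw [← step_step hA a f, h0]
  ext j; simp [step_apply]

/-- A nonzero level zero state is negative somewhere because the marks are positive, and firing
keeps it nonzero and of level zero. -/
theorem IsAffine.exists_infNeg (hA : IsAffine A δ ε) {f : Fin (n + 1) → ℝ} (hl : LevelZero δ f)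
    (h0 : f ≠ 0) : ∃ j, InfNeg A f j := by
  let X := {g : Fin (n + 1) → ℝ // LevelZero δ g ∧ g ≠ 0}
  choose a ha using fun g : X => hA.exists_neg g.2.1 g.2.2
  let next : X → X := fun g => ⟨step A (a g) g.1, g.2.1.step hA _, step_ne_zero hA.toIsCartan g.2.2 _⟩
  let st : ℕ → X := fun k => next^[k] ⟨f, hl, h0⟩
  refine ⟨fun k => a (st k), infNeg_iff.2 fun k => ?_⟩
  have : ∀ k, run A f (prefixWord (fun k => a (st k)) k) = (st k).1 := by
    intro k
    induction k with
    | zero => rfl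
    | succ k ih =>
      rw [run_prefixWord_succ, ih]
      simp only [st, Function.iterate_succ_apply']
      rfl
  rw [this]
  exact ha _

/-! ### Fully commutative infinite words are negative -/

/-- A state in the orbit of e that is negative at two adjacent nodes can be reached by firing, and
the braid word can be fired there. Its roots are strictly negative on e, so a prefix of i would have
a reduced word containing the braid word. -/
theorem IsLimitDirection.good (hA : IsAffine A δ ε) {i : ℕ → Fin (n + 1)} {φ : ℕ → ℕ}
    {e : Fin (n + 1) → ℝ} (h : IsLimitDirection hA.toIsCartan i φ e) (hl : LevelZero δ e)
    (hi : IsInfFC A i) : Good hA.toIsCartan e := by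
  rintro w a b hab hA0 ⟨ha, hb⟩
  have hM := hA.three_le_coxeter (hl.lin hA w) hab hA0 ha.le hb
  obtain ⟨x, hx, hxw⟩ := hA.exists_negWord hl w
  refine EvWord.not_braid (hA := hA.toIsCartan) (i := i) (φ := φ) (x := x) (y := []) hi hM
    (h.evWord_of_negWord ?_)
  rw [inv_one, lin_one_apply, List.append_nil, negWord_append, hxw]
  exact ⟨hx, negWord_braidWord hA.toIsCartan hM ha hb⟩

/-- If the letter N had value 0, an infinite fired word from that state would complete it to a braid
word after letters commuting with it. The root of this letter vanishes on e but is an inversion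
because it belongs to i; the other roots are strictly negative on e. -/
theorem IsLimitDirection.infNeg (hA : IsAffine A δ ε) {i : ℕ → Fin (n + 1)} {φ : ℕ → ℕ}
    {e : Fin (n + 1) → ℝ} (h : IsLimitDirection hA.toIsCartan i φ e) (hl : LevelZero δ e)
    (h0 : e ≠ 0) (hi : IsInfFC A i) : InfNeg A e i := by
  rw [infNeg_iff]
  intro N
  refine lt_of_le_of_ne (h.nonpos hi.1 N) fun hz => ?_
  set f := run A e (prefixWord i N) with hf
  have hfe : f = lin hA.toIsCartan ((system A).wordProd (prefixWord i N))⁻¹ e :=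
    run_eq_lin hA.toIsCartan _ _
  have hf0 : f ≠ 0 := by
    intro hf0
    apply h0
    rw [← lin_apply_inv hA.toIsCartan ((system A).wordProd (prefixWord i N)) e, ← hfe, hf0,
      map_zero]
  obtain ⟨j, hj⟩ := hA.exists_infNeg (hl.run hA _ : LevelZero δ f) hf0
  obtain ⟨k, c, d, y, h1, h2, h3, h4, h5⟩ := hj.exists_braid_of_zero hA (hl.run hA _) hz
  refine EvWord.not_braid (hA := hA.toIsCartan) (i := i) (φ := φ)
    (x := prefixWord i N ++ prefixWord j k) (y := []) hi h3 ?_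
  rw [List.append_nil, evWord_append, evWord_append, one_mul, one_mul, h4]
  refine ⟨⟨h.evWord_prefixWord hi.1 N, h.evWord_of_negWord ?_⟩, ?_, h.evWord_of_negWord ?_⟩
  · rw [← hfe]; exact hj k
  -- The letters of j before position k are orthogonal to i N, so the root read off here is the one
  -- read off at position N in i.
  · have h6 := (h.evWord_prefixWord hi.1 (N + 1))
    rw [prefixWord_succ, evWord_append] at h6
    have h7 := h6.2.1
    rw [one_mul] at h7
    filter_upwards [h7] with m hm
    rw [CoxeterSystem.wordProd_append, ← mul_assoc, rootRep_mul_apply,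
      rootRep_wordProd_of_zero]
    · exact hm
    · intro c hc
      obtain ⟨m, hm, rfl⟩ := mem_prefixWord hc
      exact (h1 m hm).2
  -- The letter with value 0 does not change the state, so the rest of the braid word is fired from
  -- the same state.
  · rw [CoxeterSystem.wordProd_append, mul_inv_rev, mul_inv_rev, CoxeterSystem.inv_simple,
      lin_mul_apply, lin_mul_apply, ← hfe, ← run_eq_lin, lin_simple, step_of_zero h2]
    exact h5

/-- Every fully commutative infinite reduced word is negative for some level zero state. -/
theorem IsInfFC.exists_infNeg (hA : IsAffine A δ ε) {i : ℕ → Fin (n + 1)} (hi : IsInfFC A i) :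
    ∃ e, e ≠ 0 ∧ LevelZero δ e ∧ Good hA.toIsCartan e ∧ InfNeg A e i := by
  obtain ⟨φ, e, h, h0, hl⟩ := exists_isLimitDirection hA hi.1
  exact ⟨e, h0, hl, h.good hA hl hi, h.infNeg hA hl h0 hi⟩

end AffineFC

/-! ### Fundamental coweights, translations and the classification criterion. -/

namespace AffineFC

variable {n : ℕ} {A : Matrix (Fin (n + 1)) (Fin (n + 1)) ℤ} {δ ε : Fin (n + 1) → ℤ}

/-! ### Dominant states -/

/-- The fundamental coweight `ω_j^∨`. -/
def fcw (δ : Fin (n + 1) → ℤ) (j : Fin (n + 1)) : Fin (n + 1) → ℝ :=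
  fun k => if k = 0 then -(δ j : ℝ) else if k = j then 1 else 0

theorem fcw_zero (j : Fin (n + 1)) : fcw δ j 0 = -(δ j : ℝ) := if_pos rfl

theorem fcw_of_ne {j k : Fin (n + 1)} (hk : k ≠ 0) : fcw δ j k = if k = j then 1 else 0 :=
  if_neg hk

theorem IsAffine.levelZero_fcw (hA : IsAffine A δ ε) {j : Fin (n + 1)} (hj : j ≠ 0) :
    LevelZero δ (fcw δ j) := by
  rw [LevelZero, pair_apply, Finset.sum_eq_add (0 : Fin (n + 1)) j hj.symm]
  · rw [fcw_zero, fcw_of_ne hj, hA.δ_zero]; simp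
  · rintro k - ⟨h0, h1⟩
    rw [fcw_of_ne h0, if_neg h1, zero_mul]
  · simp
  · simp

theorem fcw_ne_zero {j : Fin (n + 1)} (hj : j ≠ 0) : fcw δ j ≠ 0 := by
  intro h
  have := congrFun h j
  rw [fcw_of_ne hj] at this
  simp at this

/-- Otherwise nodes different from 0 could be fired forever, giving an infinite fired word without
the letter 0, against `InfNeg.recurrent`. -/
theorem IsAffine.exists_dominant (hA : IsAffine A δ ε) {f : Fin (n + 1) → ℝ}
    (hl : LevelZero δ f) : ∃ x, 0 ∉ x ∧ ∀ a ≠ 0, 0 ≤ run A f x a := by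
  by_contra! hcon
  let X := {g : Fin (n + 1) → ℝ // ∃ x, (0 : Fin (n + 1)) ∉ x ∧ run A f x = g}
  have hX : ∀ g : X, ∃ a, a ≠ 0 ∧ g.1 a < 0 := by
    rintro ⟨g, x, hx, rfl⟩
    exact hcon x hx
  choose a ha using hX
  let next : X → X := fun g => ⟨step A (a g) g.1, by
    obtain ⟨x, hx, hxg⟩ := g.2
    exact ⟨x ++ [a g], by simpa [hx] using (ha g).1.symm, by rw [run_append, hxg]; rfl⟩⟩
  let st : ℕ → X := fun k => next^[k] ⟨f, [], by simp, rfl⟩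
  have hst : ∀ k, run A f (prefixWord (fun k => a (st k)) k) = (st k).1 := by
    intro k
    induction k with
    | zero => rfl
    | succ k ih =>
      rw [run_prefixWord_succ, ih]
      simp only [st, Function.iterate_succ_apply']
      rfl
  have hneg : InfNeg A f (fun k => a (st k)) := by
    rw [infNeg_iff]
    intro k
    rw [hst]
    exact (ha _).2
  obtain ⟨k, -, hk⟩ := hneg.recurrent hA hl 0 0
  exact (ha _).1 hk

/-- The longest element of the dihedral group sends both simple roots to negatives of simple roots.
-/
theorem exists_run_neg (hA : IsCartan A) {f : Fin (n + 1) → ℝ} {a b : Fin (n + 1)}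
    (h : 3 ≤ coxeter A a b) (ha : 0 < f a) (hb : 0 < f b) :
    ∃ x, run A f x a < 0 ∧ run A f x b < 0 := by
  obtain ⟨hab, h0⟩ := cartan_ne_zero_of_coxeter h
  have hp := hA.off a b hab
  have hM := coxeter_apply_of_ne A hab
  simp only [List.mem_cons, Prod.mk.injEq, List.not_mem_nil, or_false] at hp
  rcases hp with h' | h' | h' | h' | h' | h' | h' <;> obtain ⟨h1, h2⟩ := h' <;>
    rw [h1, h2] at hM <;> norm_num [bondOrder] at hM
  · omega
  · refine ⟨[a, b, a], ?_⟩
    simp only [run_cons, run_nil, step_apply, h1, h2, hA.diag]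
    norm_num; constructor <;> linarith
  · refine ⟨[a, b, a, b], ?_⟩
    simp only [run_cons, run_nil, step_apply, h1, h2, hA.diag]
    norm_num; constructor <;> linarith
  · refine ⟨[a, b, a, b], ?_⟩
    simp only [run_cons, run_nil, step_apply, h1, h2, hA.diag]
    norm_num; constructor <;> linarith
  · refine ⟨[a, b, a, b, a, b], ?_⟩
    simp only [run_cons, run_nil, step_apply, h1, h2, hA.diag]
    norm_num; constructor <;> linarith
  · refine ⟨[a, b, a, b, a, b], ?_⟩
    simp only [run_cons, run_nil, step_apply, h1, h2, hA.diag]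
    norm_num; constructor <;> linarith
  · omega

theorem LevelZero.smul {f : Fin (n + 1) → ℝ} (hl : LevelZero δ f) (c : ℝ) :
    LevelZero δ (c • f) := by
  have hl' : pair f δ = 0 := hl
  rw [LevelZero, pair_smul_left, hl', mul_zero]

/-- Goodness is symmetric under a change of sign, since the dihedral longest element makes two
positive adjacent values negative. -/
theorem Good.not_pos (hA : IsAffine A δ ε) {f : Fin (n + 1) → ℝ} (h : Good hA.toIsCartan f)
    (hl : LevelZero δ f) {a b : Fin (n + 1)} (hab : a ≠ b) (hAab : A a b ≠ 0) (ha : 0 < f a)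
    (hb : 0 < f b) : False := by
  have hM := hA.three_le_coxeter (hl.smul (-1)) hab hAab (by simpa using ha.le) (by simpa using hb)
  obtain ⟨x, hx1, hx2⟩ := exists_run_neg hA.toIsCartan hM ha hb
  exact (h.run x).not hab hAab hx1 hx2

theorem Good.smul {hA : IsCartan A} {f : Fin (n + 1) → ℝ} (h : Good hA f) {c : ℝ} (hc : 0 < c) :
    Good hA (c • f) := by
  rintro w a b hab hAab ⟨h1, h2⟩
  rw [map_smul, Pi.smul_apply, smul_eq_mul] at h1 h2
  exact h w a b hab hAab ⟨by by_contra; nlinarith, by by_contra; nlinarith⟩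

theorem Good.of_smul {hA : IsCartan A} {f : Fin (n + 1) → ℝ} {c : ℝ} (hc : 0 < c)
    (h : Good hA (c • f)) : Good hA f := by
  have := h.smul (inv_pos.2 hc)
  rwa [smul_smul, inv_mul_cancel₀ hc.ne', one_smul] at this

/-- The finite Dynkin diagram. -/
def finGraph (hA : IsCartan A) : SimpleGraph (Fin (n + 1)) where
  Adj a b := (a ≠ 0 ∧ b ≠ 0) ∧ a ≠ b ∧ A a b ≠ 0
  symm := ⟨fun _ _ h => ⟨h.1.symm, h.2.1.symm, fun h0 => h.2.2 (hA.zero_iff.1 h0)⟩⟩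
  loopless := ⟨fun _ h => h.2.1 rfl⟩

/-- Reflecting at j makes the next node of the path positive and lowers no value except at j, which
the path does not visit again. The positive value travels along the path until it is adjacent to k.
-/
theorem Good.not_pos_of_path (hA : IsAffine A δ ε) {j k : Fin (n + 1)}
    (p : (finGraph hA.toIsCartan).Walk j k) (hp : p.IsPath) {f : Fin (n + 1) → ℝ}
    (h : Good hA.toIsCartan f) (hl : LevelZero δ f) (hjk : j ≠ k) (hj : 0 < f j) (hk : 0 < f k)
    (hf : ∀ v ∈ p.support, v ≠ 0 → 0 ≤ f v) : False := by
  induction p generalizing f with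
  | nil => exact hjk rfl
  | @cons j b k hadj p ih =>
    rw [SimpleGraph.Walk.cons_isPath_iff] at hp
    by_cases hbk : b = k
    · subst hbk
      exact h.not_pos hA hl hadj.2.1 hadj.2.2 hj hk
    have hmono : ∀ v, v ≠ j → f v ≤ AffineFC.step A j f v := by
      intro v hv
      rw [step_apply]
      have : (A v j : ℝ) ≤ 0 := by exact_mod_cast hA.nonpos hv
      nlinarith
    refine ih hp.1 (h.step j) (hl.step hA j) hbk ?_ ?_ ?_
    · have h1 : (A b j : ℝ) < 0 := by
        have h1 : A b j ≤ 0 := hA.nonpos hadj.2.1.symm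
        have h2 : A b j ≠ 0 := fun h0 => hadj.2.2 (hA.zero_iff.1 h0)
        exact_mod_cast lt_of_le_of_ne h1 h2
      have h2 := hf b (by simp) hadj.1.2
      rw [step_apply]
      nlinarith
    · exact hk.trans_le (hmono k hjk.symm)
    · intro v hv hv0
      exact (hf v (by simp [hv]) hv0).trans (hmono v fun h => hp.2 (h ▸ hv))

/-- Every good level zero state is conjugate to a multiple of a fundamental coweight. -/
theorem Good.exists_fcw (hA : IsAffine A δ ε) {f : Fin (n + 1) → ℝ} (h : Good hA.toIsCartan f)
    (hl : LevelZero δ f) (h0 : f ≠ 0) :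
    ∃ x j, ∃ c : ℝ, j ≠ 0 ∧ 0 < c ∧ AffineFC.run A f x = c • fcw δ j := by
  obtain ⟨x, -, hx⟩ := hA.exists_dominant hl
  set g := AffineFC.run A f x with hg
  have hgl : LevelZero δ g := hl.run hA x
  have hsum : g 0 = -∑ k ∈ Finset.univ.erase 0, g k * (δ k : ℝ) := by
    have h1 : ∑ k, g k * (δ k : ℝ) = 0 := hgl
    rw [← Finset.add_sum_erase _ _ (Finset.mem_univ 0), hA.δ_zero] at h1
    push_cast at h1
    linarith
  obtain ⟨j, hj0, hj⟩ : ∃ j, j ≠ 0 ∧ 0 < g j := by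
    by_contra! hcon
    have h1 : ∀ k, k ≠ 0 → g k = 0 := fun k hk => le_antisymm (hcon k hk) (hx k hk)
    have h2 : g = 0 := by
      ext k
      by_cases hk : k = 0
      · rw [hk, hsum, Finset.sum_eq_zero]
        · simp
        · intro l hl'
          rw [h1 l (Finset.ne_of_mem_erase hl'), zero_mul]
      · exact h1 k hk
    apply h0
    rw [← lin_apply_inv hA.toIsCartan ((system A).wordProd x) f, ← run_eq_lin, ← hg, h2, map_zero]
  have huniq : ∀ k, k ≠ 0 → k ≠ j → g k = 0 := by
    intro k hk0 hkj
    by_contra hne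
    have hk : 0 < g k := lt_of_le_of_ne (hx k hk0) (Ne.symm hne)
    have hreach : (finGraph hA.toIsCartan).Reachable j k := by
      clear hne hk hkj
      induction hA.reflTransGen_ne_zero hj0 hk0 with
      | refl => exact SimpleGraph.Reachable.refl _
      | @tail b c _ hbc ih =>
        by_cases hbc' : b = c
        · subst hbc'; exact ih hbc.1.1
        · exact (ih hbc.1.1).trans
            (SimpleGraph.Adj.reachable ⟨hbc.1, hbc', hbc.2⟩)
    obtain ⟨p, hp⟩ := hreach.exists_isPath
    exact Good.not_pos_of_path hA p hp (h.run x) hgl hkj.symm hj hk fun v _ hv => hx v hv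
  refine ⟨x, j, g j, hj0, hj, ?_⟩
  ext k
  rw [← hg, Pi.smul_apply, smul_eq_mul]
  by_cases hk : k = 0
  · rw [hk, fcw_zero, hsum, Finset.sum_eq_single j]
    · ring
    · intro l hl' hlj
      rw [huniq l (Finset.ne_of_mem_erase hl') hlj, zero_mul]
    · intro hj'
      exact absurd (Finset.mem_erase.2 ⟨hj0, Finset.mem_univ _⟩) hj'
  · rw [fcw_of_ne hk]
    split_ifs with hkj
    · rw [hkj, mul_one]
    · rw [huniq k hk hkj, mul_zero]

/-! ### Periodic words -/

theorem infWord_cons (a : Fin (n + 1)) (w u : List (Fin (n + 1))) :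
    infWord (a :: w) u = consSeq a (infWord w u) := by
  funext k
  cases k with
  | zero => simp [infWord]
  | succ k => simp [infWord]

theorem infWord_nil_add (u : List (Fin (n + 1))) (m : ℕ) :
    infWord [] u (u.length + m) = infWord [] u m := by
  simp [infWord]

theorem prefixWord_infWord_nil (u : List (Fin (n + 1))) :
    prefixWord (infWord [] u) u.length = u := by
  apply List.ext_getElem
  · simp
  · intro k h1 h2
    simp [prefixWord, infWord, Nat.mod_eq_of_lt h2, h2]

theorem infNeg_infWord_nil {u : List (Fin (n + 1))} {d : Fin (n + 1) → ℝ} (hu : u ≠ [])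
    (hd : NegWord A d u) (hr : run A d u = d) : InfNeg A d (infWord [] u) := by
  have key : ∀ m, NegWord A d (prefixWord (infWord [] u) (m * u.length)) ∧
      run A d (prefixWord (infWord [] u) (m * u.length)) = d := by
    intro m
    induction m with
    | zero => simp
    | succ m ih =>
      have h1 : (m + 1) * u.length = u.length + m * u.length := by ring
      have h2 : (fun k => infWord [] u (u.length + k)) = infWord [] u :=
        funext fun k => infWord_nil_add u k
      rw [h1, prefixWord_add, prefixWord_infWord_nil, h2, negWord_append, run_append, hr]
      exact ⟨⟨hd, ih.1⟩, ih.2⟩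
  intro k
  have hlen : 1 ≤ u.length := List.length_pos_iff.2 hu
  obtain ⟨m, hm⟩ := Nat.exists_eq_add_of_le (Nat.le_mul_of_pos_right k hlen)
  have := (key k).1
  rw [hm, prefixWord_add, negWord_append] at this
  exact this.1

theorem infNeg_infWord {w u : List (Fin (n + 1))} {f : Fin (n + 1) → ℝ}
    (hw : NegWord A f w) (h : InfNeg A (run A f w) (infWord [] u)) :
    InfNeg A f (infWord w u) := by
  induction w generalizing f with
  | nil => exact h
  | cons a w ih =>
    rw [infWord_cons, infNeg_cons]
    exact ⟨hw.1, ih hw.2 h⟩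

/-- The letters of w are prepended one at a time. By `pos_of_isInfFC_consSeq` each one is positive
at the current state, hence fireable at the reflected state. -/
theorem infNeg_of_isInfFC_infWord (hA : IsAffine A δ ε) {w u : List (Fin (n + 1))}
    {d : Fin (n + 1) → ℝ} (hl : LevelZero δ d) (hd : Good hA.toIsCartan d)
    (hu : InfNeg A d (infWord [] u)) (h : IsInfFC A (infWord w u)) :
    InfNeg A (lin hA.toIsCartan ((system A).wordProd w) d) (infWord w u) := by
  induction w with
  | nil => rwa [CoxeterSystem.wordProd_nil, lin_one_apply]
  | cons a w ih =>
    rw [infWord_cons] at h ⊢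
    have h1 := ih h.tail
    have h2 := pos_of_isInfFC_consSeq hA (hl.lin hA _) (hd.lin _) h1 h
    rw [infNeg_cons, CoxeterSystem.wordProd_cons, lin_mul_apply, lin_simple, consSeq_zero,
      step_step hA.toIsCartan, step_self hA.toIsCartan]
    exact ⟨by linarith, h1⟩

/-! ### The coroot lattice and the space `V` -/

/-- The comarks are ε_i δ_i / ε_0; the symmetrizer turns the null relation of the roots into one of
the coroots. -/
theorem IsAffine.exists_comarks (hA : IsAffine A δ ε) :
    ∃ m : Fin (n + 1) → ℤ, m 0 = 1 ∧ ∀ j, ∑ i, m i * A j i = 0 := by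
  choose m hm using hA.dvd
  have h0 : ε 0 ≠ 0 := (hA.ε_pos 0).ne'
  refine ⟨m, ?_, fun j => ?_⟩
  · have := hm 0
    rw [hA.δ_zero] at this
    exact (mul_left_cancel₀ h0 this).symm
  · have h1 : ε 0 * ∑ i, m i * A j i = ε j * ∑ i, A i j * δ i := by
      rw [Finset.mul_sum, Finset.mul_sum]
      refine Finset.sum_congr rfl fun i _ => ?_
      linear_combination (-A j i) * hm i + δ i * hA.symm i j
    rw [hA.δ_null, mul_zero] at h1
    exact (mul_eq_zero.1 h1).resolve_left h0

theorem sum_smul_coroot {m : Fin (n + 1) → ℤ} (hm : ∀ j, ∑ i, m i * A j i = 0) :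
    ∑ i, m i • coroot A i = 0 := by
  ext j
  rw [Finset.sum_apply, Pi.zero_apply]
  have h1 : ∀ i, (m i • coroot A i) j = ((m i * A j i : ℤ) : ℝ) := fun i => by
    rw [Pi.smul_apply, coroot, zsmul_eq_mul, Int.cast_mul]
  simp_rw [h1]
  exact_mod_cast hm j

theorem IsAffine.coroot_mem (hA : IsAffine A δ ε) (i : Fin (n + 1)) :
    coroot A i ∈ corootLattice A := by
  have hmem : ∀ i : Fin (n + 1), i ≠ 0 → coroot A i ∈ corootLattice A := fun i hi =>
    AddSubgroup.subset_closure ⟨i, hi, rfl⟩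
  by_cases hi : i = 0
  · obtain ⟨m, hm0, hm⟩ := hA.exists_comarks
    have h1 := sum_smul_coroot hm
    rw [← Finset.add_sum_erase _ _ (Finset.mem_univ 0), hm0, one_smul] at h1
    rw [hi, eq_neg_of_add_eq_zero_left h1]
    exact neg_mem (sum_mem fun k hk => zsmul_mem (hmem k (Finset.ne_of_mem_erase hk)) _)
  · exact hmem i hi

theorem IsAffine.levelZero_coroot (hA : IsAffine A δ ε) (i : Fin (n + 1)) :
    LevelZero δ (coroot A i) := by
  rw [LevelZero, pair_apply]
  change ∑ k, (A k i : ℝ) * (δ k : ℝ) = 0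
  exact_mod_cast hA.δ_null i

theorem IsAffine.levelZero_of_mem (hA : IsAffine A δ ε) {p : Fin (n + 1) → ℝ} (hp : p ∈ V A) :
    LevelZero δ p := by
  induction hp using Submodule.span_induction with
  | mem x hx => obtain ⟨i, rfl⟩ := hx; exact hA.levelZero_coroot i
  | zero => simp [LevelZero, pair_apply]
  | add x y _ _ hx hy =>
    have hx' : pair x δ = 0 := hx
    have hy' : pair y δ = 0 := hy
    rw [LevelZero, pair_add_left, hx', hy', add_zero]
  | smul c x _ hx => exact hx.smul c

/-- A multiple of a level zero functional is a sum of differences of elements of its orbit. -/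
theorem IsAffine.exists_smul_mem (hA : IsAffine A δ ε) {f : Fin (n + 1) → ℝ} (hl : LevelZero δ f)
    (S : AddSubgroup (Fin (n + 1) → ℝ)) (hS : ∀ w, f - lin hA.toIsCartan w f ∈ S) :
    ∃ N : ℕ, 0 < N ∧ (N : ℝ) • f ∈ S := by
  classical
  let F := (hA.finite_orbit hl).toFinset
  have hF : ∀ g, g ∈ F ↔ ∃ w, lin hA.toIsCartan w f = g := fun g => Set.Finite.mem_toFinset _
  have hstep : ∀ a, ∀ g ∈ F, step A a g ∈ F := by
    intro a g hg
    obtain ⟨w, rfl⟩ := (hF g).1 hg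
    exact (hF _).2 ⟨(system A).simple a * w, by rw [lin_mul_apply, lin_simple]⟩
  -- The orbit sum is fixed by every simple reflection, so its value at each node is its own
  -- negative.
  have hsum : ∑ g ∈ F, g = 0 := by
    ext a
    have h1 : ∑ g ∈ F, g a = ∑ g ∈ F, step A a g a :=
      Finset.sum_nbij' (step A a) (step A a) (hstep a) (hstep a)
        (fun g _ => step_step hA.toIsCartan a g) (fun g _ => step_step hA.toIsCartan a g)
        (fun g _ => by rw [step_step hA.toIsCartan])
    simp_rw [step_self hA.toIsCartan] at h1
    rw [Finset.sum_neg_distrib] at h1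
    rw [Finset.sum_apply, Pi.zero_apply]
    linarith
  refine ⟨F.card, Finset.card_pos.2 ⟨f, (hF f).2 ⟨1, lin_one_apply _ _⟩⟩, ?_⟩
  have h2 : ∑ g ∈ F, (f - g) = (F.card : ℝ) • f := by
    rw [Finset.sum_sub_distrib, hsum, sub_zero, Finset.sum_const, Nat.cast_smul_eq_nsmul]
  rw [← h2]
  refine sum_mem fun g hg => ?_
  obtain ⟨w, rfl⟩ := (hF g).1 hg
  exact hS w

/-- Each reflection changes a functional by a multiple of a coroot, so all differences within an
orbit lie in `V A`, and with them a positive multiple of p. -/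
theorem IsAffine.mem_V (hA : IsAffine A δ ε) {p : Fin (n + 1) → ℝ} (hl : LevelZero δ p) :
    p ∈ V A := by
  obtain ⟨N, hN, h⟩ := hA.exists_smul_mem hl (V A).toAddSubgroup fun w => by
    induction w using (system A).simple_induction_left with
    | one => rw [lin_one_apply, sub_self]; exact zero_mem _
    | mul_simple_left w a ih =>
      rw [lin_mul_apply, lin_simple, step, ← sub_add]
      exact add_mem ih ((V A).smul_mem _ (Submodule.subset_span ⟨a, rfl⟩))
  have hN' : (N : ℝ) ≠ 0 := by positivity
  have := (V A).smul_mem (N : ℝ)⁻¹ h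
  rwa [smul_smul, inv_mul_cancel₀ hN', one_smul] at this

theorem IsAffine.isFundamentalCoweight_fcw (hA : IsAffine A δ ε) {j : Fin (n + 1)} (hj : j ≠ 0) :
    IsFundamentalCoweight A j (fcw δ j) :=
  ⟨hj, hA.mem_V (hA.levelZero_fcw hj), fun _ hk => fcw_of_ne hk⟩

/-- The values of a coweight on roots are integers, so the differences within its orbit lie in the
coroot lattice. This provides the multiple from which the least one is chosen. -/
theorem IsAffine.exists_smul_fcw_mem (hA : IsAffine A δ ε) {j : Fin (n + 1)} (hj : j ≠ 0) :
    ∃ N : ℕ, 0 < N ∧ (N : ℝ) • fcw δ j ∈ corootLattice A := by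
  refine hA.exists_smul_mem (hA.levelZero_fcw hj) _ fun w => ?_
  suffices h : (∃ z : Fin (n + 1) → ℤ, ∀ k, lin hA.toIsCartan w (fcw δ j) k = z k) ∧
      fcw δ j - lin hA.toIsCartan w (fcw δ j) ∈ corootLattice A from h.2
  induction w using (system A).simple_induction_left with
  | one =>
    rw [lin_one_apply, sub_self]
    refine ⟨⟨fun k => if k = 0 then -δ j else if k = j then 1 else 0, fun k => ?_⟩, zero_mem _⟩
    by_cases h0 : k = 0
    · simp [h0, fcw_zero]
    · simp only [fcw_of_ne h0, if_neg h0, Int.cast_ite, Int.cast_one, Int.cast_zero]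
  | mul_simple_left w a ih =>
    obtain ⟨⟨z, hz⟩, hmem⟩ := ih
    rw [lin_mul_apply, lin_simple]
    refine ⟨⟨fun k => z k - z a * A k a, fun k => ?_⟩, ?_⟩
    · rw [step_apply, hz, hz]; push_cast; ring
    · rw [step, ← sub_add, hz, Int.cast_smul_eq_zsmul]
      exact add_mem hmem (zsmul_mem (hA.coroot_mem a) _)

/-! ### Translations -/

/-- `w` acts as the translation by `l` on the functionals of level one. -/
def IsTranslation (hA : IsCartan A) (δ : Fin (n + 1) → ℤ) (w : (coxeter A).Group)
    (l : Fin (n + 1) → ℝ) : Prop :=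
  ∀ f, pair f δ = 1 → lin hA w f = f + l

/-- The lattice of translations. -/
def translations (hA : IsAffine A δ ε) : AddSubgroup (Fin (n + 1) → ℝ) where
  carrier := {l | LevelZero δ l ∧ ∃ w, IsTranslation hA.toIsCartan δ w l}
  zero_mem' := ⟨by simp [LevelZero, pair_apply], 1, fun f _ => by rw [lin_one_apply, add_zero]⟩
  add_mem' := by
    rintro l l' ⟨hl, w, hw⟩ ⟨hl', w', hw'⟩
    have hl1 : pair l δ = 0 := hl
    have hl2 : pair l' δ = 0 := hl'
    refine ⟨?_, w * w', fun f hf => ?_⟩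
    · rw [LevelZero, pair_add_left, hl1, hl2, add_zero]
    · rw [lin_mul_apply, hw' f hf, hw _ (by rw [pair_add_left, hf, hl2, add_zero])]
      abel
  neg_mem' := by
    rintro l ⟨hl, w, hw⟩
    have hneg : LevelZero δ (-l) := by simpa using hl.smul (-1)
    have hl1 : pair (-l) δ = 0 := hneg
    refine ⟨hl1, w⁻¹, fun f hf => ?_⟩
    have h1 := hw (f + -l) (by rw [pair_add_left, hf, hl1, add_zero])
    rw [neg_add_cancel_right] at h1
    rw [← h1, lin_inv_apply, h1]

theorem lin_mem_translations (hA : IsAffine A δ ε) {l : Fin (n + 1) → ℝ}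
    (h : l ∈ translations hA) (v : (coxeter A).Group) :
    lin hA.toIsCartan v l ∈ translations hA := by
  obtain ⟨hl, w, hw⟩ := h
  refine ⟨hl.lin hA v, v * w * v⁻¹, fun f hf => ?_⟩
  rw [lin_mul_apply, lin_mul_apply, hw _ (by rw [pair_lin, hA.rootRep_δ, hf]), map_add,
    lin_apply_inv]

/-- The lattice of translations is stable under the group, and α_i^∨ differs from its image under
s_k by this multiple of α_k^∨. -/
theorem smul_coroot_mem_translations (hA : IsAffine A δ ε) {i : Fin (n + 1)}
    (h : coroot A i ∈ translations hA) (k : Fin (n + 1)) :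
    A k i • coroot A k ∈ translations hA := by
  have h1 := sub_mem h (lin_mem_translations hA h ((system A).simple k))
  rw [lin_simple, step, sub_sub_cancel, coroot, Int.cast_smul_eq_zsmul] at h1
  exact h1

theorem run_single_zero {y : List (Fin (n + 1))} (hy : 0 ∉ y) :
    run A (Pi.single 0 1) y = Pi.single 0 1 := by
  induction y with
  | nil => rfl
  | cons a y ih =>
    rw [List.mem_cons, not_or] at hy
    rw [run_cons, step_of_zero (Pi.single_eq_of_ne (Ne.symm hy.1) _), ih hy.2]

/-- If the linear part of `s_0` belongs to the finite Weyl group, then `α_0^∨` is a translation. -/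
theorem coroot_zero_mem_translations (hA : IsAffine A δ ε) {y : List (Fin (n + 1))} (hy : 0 ∉ y)
    (h : ∀ f, LevelZero δ f → run A f y = step A 0 f) : coroot A 0 ∈ translations hA := by
  rw [← neg_mem_iff]
  have hneg : LevelZero δ (-coroot A 0) := by simpa using (hA.levelZero_coroot 0).smul (-1)
  refine ⟨hneg,
    (system A).simple 0 * ((system A).wordProd y)⁻¹, fun f hf => ?_⟩
  -- The origin of the level one hyperplane. It is fixed by the finite Weyl group and moved by s_0
  -- to e - α_0^∨, so s_0 times the inverse of its linear part is the translation by -α_0^∨.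
  set e : Fin (n + 1) → ℝ := Pi.single 0 1 with he
  have h1 : LevelZero δ (f - e) := by
    have h2 : pair e δ = 1 := by simp [he, pair_apply, Pi.single_apply, hA.δ_zero]
    have h3 := pair_add_left (f - e) e δ
    rw [sub_add_cancel, hf, h2] at h3
    rw [LevelZero]; linarith
  have h2 := h _ h1
  rw [run_eq_lin hA.toIsCartan, map_sub, ← run_eq_lin hA.toIsCartan e y,
    he, run_single_zero hy, ← he, sub_eq_iff_eq_add] at h2
  rw [lin_mul_apply, h2, map_add, lin_simple, lin_simple, step_step hA.toIsCartan, step,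
    he, Pi.single_eq_same, one_smul]
  abel

theorem corootLattice_le_translations (hA : IsAffine A δ ε)
    (h : ∀ i, coroot A i ∈ translations hA) : corootLattice A ≤ translations hA := by
  refine (AddSubgroup.closure_le _).2 ?_
  rintro _ ⟨i, -, rfl⟩
  exact h i

/-- Adding the origin `Pi.single 0 1` of the level one hyperplane turns the affine action into the
linear action on functionals. -/
theorem act_add_single (A : Matrix (Fin (n + 1)) (Fin (n + 1)) ℤ) (hA : IsCartan A)
    (l : List (Fin (n + 1))) (p : Fin (n + 1) → ℝ) :
    act A l p + Pi.single 0 1 = lin hA ((system A).wordProd l) (p + Pi.single 0 1) := by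
  induction l with
  | nil => rw [CoxeterSystem.wordProd_nil, lin_one_apply]; rfl
  | cons a l ih =>
    rw [CoxeterSystem.wordProd_cons, lin_mul_apply, ← ih, lin_simple]
    change reflect A a (act A l p) + _ = _
    rw [reflect, step, Pi.add_apply, Pi.single_apply]
    abel

theorem act_eq_foldr {v : List (Fin (n + 1))} (hv : 0 ∉ v) (p : Fin (n + 1) → ℝ) :
    act A v p = v.foldr (step A) p := by
  induction v with
  | nil => rfl
  | cons a v ih =>
    rw [List.mem_cons, not_or] at hv
    change reflect A a (act A v p) = step A a _
    rw [ih hv.2, reflect, step, if_neg (Ne.symm hv.1), add_zero]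

theorem run_reverse_eq_foldr (f : Fin (n + 1) → ℝ) (y : List (Fin (n + 1))) :
    run A f y = y.reverse.foldr (step A) f := by
  rw [List.foldr_reverse]; rfl

/-- If the linear part of `s_0` belongs to the finite Weyl group, then the orbits of the finite
Weyl group are those of the affine Weyl group. -/
theorem exists_finite_word (hA : IsAffine A δ ε) {y : List (Fin (n + 1))} (hy : 0 ∉ y)
    (h : ∀ f, LevelZero δ f → run A f y = step A 0 f) {f : Fin (n + 1) → ℝ} (hl : LevelZero δ f)
    (w : (coxeter A).Group) : ∃ v : List (Fin (n + 1)), 0 ∉ v ∧ v.foldr (step A) f = lin hA.toIsCartan w f := by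
  induction w using (system A).simple_induction_left with
  | one => exact ⟨[], by simp, by rw [lin_one_apply]; rfl⟩
  | mul_simple_left w a ih =>
    obtain ⟨v, hv, hvw⟩ := ih
    rw [lin_mul_apply, lin_simple]
    by_cases ha : a = 0
    · refine ⟨y.reverse ++ v, by simp [hy, hv], ?_⟩
      rw [List.foldr_append, hvw, ← run_reverse_eq_foldr, h _ (hl.lin hA w), ha]
    · exact ⟨a :: v, by simp [hv, Ne.symm ha], by rw [List.foldr_cons, hvw]⟩

/-- The reduced words of a translation are closed negative words. -/
theorem IsTranslation.negWord (hA : IsAffine A δ ε) {τ : List (Fin (n + 1))} {c : ℝ} (hc : 0 < c)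
    {e : Fin (n + 1) → ℝ} (hl : LevelZero δ e) (hτ : (system A).IsReduced τ)
    (h : IsTranslation hA.toIsCartan δ ((system A).wordProd τ) (c • e)) :
    NegWord A e τ ∧ run A e τ = e := by
  have hpos : (0 : ℝ) < height δ := by
    have : 0 < height δ := height_pos (fun i => (hA.δ_pos i).le) fun h0 => by
      have := hA.δ_pos 0
      rw [h0] at this
      simp at this
    exact_mod_cast this
  -- A point of level one inside the fundamental chamber: its value on a root has the sign of the
  -- height of that root.
  set f : Fin (n + 1) → ℝ := (height δ : ℝ)⁻¹ • rho with hf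
  have hfl : pair f δ = 1 := by
    rw [hf, pair_smul_left, pair_rho, inv_mul_cancel₀ hpos.ne']
  have hl' : pair e δ = 0 := hl
  have h1 := h f hfl
  constructor
  · refine negWord_of_forall fun l₁ a l₂ hτ' => ?_
    have hr1 : (system A).IsReduced (l₁ ++ [a]) := by
      have := hτ.take (l₁.length + 1)
      rwa [hτ', List.take_length_add_append, List.take_succ_cons, List.take_zero] at this
    have hr2 : (system A).IsReduced (a :: l₂) := by
      have := hτ.drop l₁.length
      rwa [hτ', List.drop_left' rfl] at this
    have h2 := height_pos_of_isReduced hA.toIsCartan hr1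
    have h3 := height_neg_of_isReduced hA.toIsCartan hr2
    set β := rootRep hA.toIsCartan ((system A).wordProd l₁) (sroot a) with hβ
    have h4 : rootRep hA.toIsCartan ((system A).wordProd τ)⁻¹ β =
        rootRep hA.toIsCartan ((system A).wordProd (a :: l₂))⁻¹ (sroot a) := by
      rw [hβ, ← rootRep_mul_apply, hτ', CoxeterSystem.wordProd_append, mul_inv_rev,
        inv_mul_cancel_right]
    -- For an inversion β of the translation the left side is negative and the first summand on the
    -- right is positive, so e is negative on β.
    have h5 := congrArg (fun g => pair g β) h1
    simp only [pair_lin, h4, pair_add_left, hf, pair_smul_left, pair_rho] at h5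
    rw [← pair_sroot (run A e _) a, pair_run hA.toIsCartan, ← hβ]
    have h2' : (0 : ℝ) < height β := by exact_mod_cast h2
    have h3' : (height (rootRep hA.toIsCartan ((system A).wordProd (a :: l₂))⁻¹ (sroot a)) : ℝ)
      < 0 := by exact_mod_cast h3
    have h6 := mul_pos (inv_pos.2 hpos) h2'
    have h7 := mul_neg_of_pos_of_neg (inv_pos.2 hpos) h3'
    by_contra hcon
    have := mul_nonneg hc.le (not_lt.1 hcon)
    linarith
  -- Both f and f + e have level one and are translated by the same vector, so the linear action on
  -- their difference e is trivial.
  · have h2 := h (f + e) (by rw [pair_add_left, hfl, hl', add_zero])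
    rw [map_add, h1] at h2
    have h3 : lin hA.toIsCartan ((system A).wordProd τ) e = e := by
      have : f + c • e + lin hA.toIsCartan ((system A).wordProd τ) e = f + c • e + e := by
        rw [h2]; abel
      exact add_left_cancel this
    rw [run_eq_lin hA.toIsCartan]
    conv_lhs => rw [← h3]
    rw [lin_inv_apply]

/-- With e the state of i, the vector m e lies in the translation lattice. A reduced word τ of this
translation is closed and fired at e, so τ^∞ and i start from the same good state and have the same
inversions. The finite word v exists because affine and finite Weyl group have the same orbits on
level zero. -/
theorem belongsToCoweight (hA : IsAffine A δ ε) {y : List (Fin (n + 1))} (hy : 0 ∉ y)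
    (h : ∀ f, LevelZero δ f → run A f y = step A 0 f)
    (hgen : ∀ i, coroot A i ∈ translations hA) {j : Fin (n + 1)} (hj : j ≠ 0)
    (hgood : Good hA.toIsCartan (fcw δ j)) {w : (coxeter A).Group} {i : ℕ → Fin (n + 1)}
    (hi : InfNeg A (lin hA.toIsCartan w (fcw δ j)) i) : BelongsToCoweight A j i := by
  set e := lin hA.toIsCartan w (fcw δ j) with he
  have hfl : LevelZero δ (fcw δ j) := hA.levelZero_fcw hj
  have hel : LevelZero δ e := hfl.lin hA w
  classical
  have hex := hA.exists_smul_fcw_mem hj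
  obtain ⟨hm0, hm⟩ := Nat.find_spec hex
  set m := Nat.find hex with hmdef
  have hm0' : (0 : ℝ) < m := by exact_mod_cast hm0
  obtain ⟨v, hv, hve⟩ := exists_finite_word hA hy h (hfl.smul m) w
  rw [map_smul, ← he] at hve
  have hT := lin_mem_translations hA (corootLattice_le_translations hA hgen hm) w
  rw [map_smul, ← he] at hT
  obtain ⟨-, t, ht⟩ := hT
  obtain ⟨τ, hτ, rfl⟩ := (system A).exists_isReduced t
  obtain ⟨h1, h2⟩ := IsTranslation.negWord hA hm0' hel hτ ht
  -- Needed for the infinite repetition of τ to be meaningful; an empty word would be a translation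
  -- by zero.
  have hτ0 : τ ≠ [] := by
    rintro rfl
    obtain ⟨f, hf⟩ : ∃ f : Fin (n + 1) → ℝ, pair f δ = 1 :=
      ⟨Pi.single 0 1, by simp [pair_apply, Pi.single_apply, hA.δ_zero]⟩
    have h3 := ht f hf
    rw [CoxeterSystem.wordProd_nil, lin_one_apply, left_eq_add, he, ← map_smul] at h3
    have h4 := lin_inv_apply hA.toIsCartan w ((m : ℝ) • fcw δ j)
    rw [h3, map_zero] at h4
    exact fcw_ne_zero hj ((smul_eq_zero.1 h4.symm).resolve_left hm0'.ne')
  have h3 := infNeg_infWord_nil hτ0 h1 h2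
  refine ⟨fcw δ j, m, v, τ, hA.isFundamentalCoweight_fcw hj,
    ⟨⟨hm0, hm⟩, fun k hk => Nat.find_min' hex hk⟩, hv, ⟨hτ, fun p hp => ?_⟩,
    h3.isInfReduced hA.toIsCartan, hi.inv_eq hA hel (hgood.lin w) h3⟩
  rw [act_eq_foldr hv, hve]
  have h4 := act_add_single A hA.toIsCartan τ p
  have hp' : pair p δ = 0 := hA.levelZero_of_mem hp
  rw [ht _ (by rw [pair_add_left, hp', zero_add]; simp [pair_apply, Pi.single_apply, hA.δ_zero])]
    at h4
  have : act A τ p + Pi.single 0 1 = p + (m : ℝ) • e + Pi.single 0 1 := by rw [h4]; abel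
  exact add_right_cancel this

/-! ### The classification criterion -/

/-- The data needed for a row `(u, j)` of the classification: `u` is a closed negative word at some
state in the orbit of the good fundamental coweight `ω_j^∨`. -/
structure IsRow (hA : IsAffine A δ ε) (u : List (Fin (n + 1))) (j : Fin (n + 1)) : Prop where
  ne_zero : j ≠ 0
  ne_nil : u ≠ []
  good : Good hA.toIsCartan (fcw δ j)
  exists_state : ∃ d y, NegWord A d u ∧ run A d u = d ∧ run A d y = fcw δ j

/-- Uniqueness of the limit element reduces everything to one closed fired word per good coweight.
The data on translations enter only the statement on coweights, hence are required only when there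
are rows. -/
theorem isFullList_of_isRow (hA : IsAffine A δ ε) {rows : List (List ℕ × ℕ)}
    (hT : rows ≠ [] → (∃ y, 0 ∉ y ∧ ∀ f, LevelZero δ f → run A f y = step A 0 f) ∧
      (coroot A 0 ∈ translations hA → ∀ i, coroot A i ∈ translations hA))
    (hrow : ∀ r ∈ rows, IsRow hA (toWord n r.1) (Fin.ofNat (n + 1) r.2))
    (hnot : ∀ j, j ≠ 0 → (∀ r ∈ rows, Fin.ofNat (n + 1) r.2 ≠ j) →
      ¬ Good hA.toIsCartan (fcw δ j)) : IsFullList A rows := by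
  have hw : ∀ r ∈ rows, ∃ d, LevelZero δ d ∧ Good hA.toIsCartan d ∧
      (∃ v, d = lin hA.toIsCartan v (fcw δ (Fin.ofNat (n + 1) r.2))) ∧
      NegWord A d (toWord n r.1) ∧ run A d (toWord n r.1) = d := by
    intro r hr
    obtain ⟨h0, h1, h2, d, y, h3, h4, h5⟩ := hrow r hr
    have h6 : d = lin hA.toIsCartan ((system A).wordProd y) (fcw δ (Fin.ofNat (n + 1) r.2)) := by
      rw [← h5, run_eq_lin hA.toIsCartan, lin_apply_inv]
    exact ⟨d, by rw [h6]; exact (hA.levelZero_fcw h0).lin hA _, by rw [h6]; exact h2.lin _,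
      ⟨_, h6⟩, h3, h4⟩
  refine ⟨fun r hr => ?_, fun i hi => ⟨fun h => ?_, ?_⟩, fun r hr w h => ?_⟩
  · obtain ⟨d, h1, h2, -, h3, h4⟩ := hw r hr
    exact (infNeg_infWord_nil (hrow r hr).ne_nil h3 h4).isInfFC h2
  · obtain ⟨e, he0, hel, heg, hen⟩ := h.exists_infNeg hA
    obtain ⟨x, j, c, hj, hc, hx⟩ := heg.exists_fcw hA hel he0
    have hgood : Good hA.toIsCartan (fcw δ j) := Good.of_smul hc (by rw [← hx]; exact heg.run x)
    obtain ⟨r, hr, hrj⟩ : ∃ r ∈ rows, Fin.ofNat (n + 1) r.2 = j := by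
      by_contra! hcon
      exact hnot j hj hcon hgood
    obtain ⟨d, h1, h2, ⟨v, hv⟩, h3, h4⟩ := hw r hr
    -- Strong connectivity gives a fired word from e to the multiple c d of the start of u;
    -- continued by u^∞ it is an infinite fired word from e, as i is.
    obtain ⟨x', hx', hx''⟩ := hA.exists_negWord hel (v * ((system A).wordProd x)⁻¹)
    have h5 : run A e x' = c • d := by
      rw [hx'', lin_mul_apply, ← run_eq_lin hA.toIsCartan, hx, map_smul, hv, hrj]
    have h6 : InfNeg A e (infWord x' (toWord n r.1)) := by
      refine infNeg_infWord hx' ?_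
      rw [h5]
      refine infNeg_infWord_nil (hrow r hr).ne_nil ((negWord_smul hc _ _).2 h3) ?_
      rw [run_smul, h4]
    exact ⟨r, hr, x', h6.isInfFC heg, hen.inv_eq hA hel heg h6⟩
  · rintro ⟨r, hr, w, h1, h2⟩
    obtain ⟨d, h3, h4, -, h5, h6⟩ := hw r hr
    have h7 := infNeg_of_isInfFC_infWord hA h3 h4
      (infNeg_infWord_nil (hrow r hr).ne_nil h5 h6) h1
    exact (h7.of_inv_subset hA.toIsCartan hi h2.le).isInfFC (h4.lin _)
  · obtain ⟨d, h3, h4, ⟨v, hv⟩, h5, h6⟩ := hw r hr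
    have h7 := infNeg_of_isInfFC_infWord hA h3 h4
      (infNeg_infWord_nil (hrow r hr).ne_nil h5 h6) h
    obtain ⟨⟨y, hy, hy'⟩, hgen⟩ := hT (List.ne_nil_of_mem hr)
    rw [hv, ← lin_mul_apply] at h7
    exact belongsToCoweight hA hy hy' (hgen (coroot_zero_mem_translations hA hy hy'))
      (hrow r hr).ne_zero (hrow r hr).good h7

end AffineFC

/-! ### Reduction of the criterion to computations with integers. -/

namespace AffineFC

variable {n : ℕ} {A : Matrix (Fin (n + 1)) (Fin (n + 1)) ℤ} {δ ε : Fin (n + 1) → ℤ}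

/-! ### Tools for verifying the criterion -/

theorem good_of_invariant (hA : IsCartan A) (S : (Fin (n + 1) → ℝ) → Prop)
    (hstep : ∀ g, S g → ∀ i, S (step A i g))
    (hneg : ∀ g, S g → ∀ a b, a ≠ b → A a b ≠ 0 → ¬ (g a < 0 ∧ g b < 0))
    {f : Fin (n + 1) → ℝ} (hf : S f) : Good hA f := by
  have h : ∀ w, S (lin hA w f) := by
    intro w
    induction w using (system A).simple_induction_left with
    | one => rwa [lin_one_apply]
    | mul_simple_left w a ih => rw [lin_mul_apply, lin_simple]; exact hstep _ ih a
  exact fun w => hneg _ (h w)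

theorem run_add (hA : IsCartan A) (f g : Fin (n + 1) → ℝ) (y : List (Fin (n + 1))) :
    run A (f + g) y = run A f y + run A g y := by
  simp only [run_eq_lin hA, map_add]

theorem step_add (i : Fin (n + 1)) (f g : Fin (n + 1) → ℝ) :
    step A i (f + g) = step A i f + step A i g := by
  rw [step, step, step, Pi.add_apply, add_smul]
  abel

/-- It suffices to compare linear maps on the coroots. -/
theorem run_eq_step_of_coroot (hA : IsAffine A δ ε) {y : List (Fin (n + 1))} {k : Fin (n + 1)}
    (h : ∀ i, run A (coroot A i) y = step A k (coroot A i)) {f : Fin (n + 1) → ℝ}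
    (hf : LevelZero δ f) : run A f y = step A k f := by
  have hf' := hA.mem_V hf
  clear hf
  induction hf' using Submodule.span_induction with
  | mem x hx => obtain ⟨i, rfl⟩ := hx; exact h i
  | zero =>
    have h1 := run_smul (A := A) 0 (0 : Fin (n + 1) → ℝ) y
    have h2 := step_smul (A := A) k 0 (0 : Fin (n + 1) → ℝ)
    rw [zero_smul, zero_smul] at h1 h2
    rw [h1, h2]
  | add x z _ _ hx hz => rw [run_add hA.toIsCartan, hx, hz, step_add]
  | smul c x _ hx => rw [run_smul, hx, step_smul]

/-- Lets membership spread from α_0^∨ along the diagram wherever the Cartan entry is -1. -/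
theorem coroot_mem_translations_of_edge (hA : IsAffine A δ ε) {i k : Fin (n + 1)}
    (h : coroot A i ∈ translations hA) (hk : A k i = -1) : coroot A k ∈ translations hA := by
  have h1 := smul_coroot_mem_translations hA h k
  rw [hk, neg_smul, one_smul] at h1
  exact neg_mem_iff.1 h1

/-! ### Integral states as lists -/

/-- The state with the given list of values. -/
def ofList (l : List ℤ) : Fin (n + 1) → ℝ := fun j => (l.getD j 0 : ℝ)

/-- The action of a generator on a list of values. -/
def listStep (A : Matrix (Fin (n + 1)) (Fin (n + 1)) ℤ) (i : Fin (n + 1)) (l : List ℤ) : List ℤ :=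
  (List.finRange (n + 1)).map fun j : Fin (n + 1) => l.getD j 0 - l.getD i 0 * A j i

theorem ofList_listStep (i : Fin (n + 1)) (l : List ℤ) :
    (ofList (listStep A i l) : Fin (n + 1) → ℝ) = step A i (ofList l) := by
  funext j
  rw [step_apply, ofList, ofList, ofList, listStep, List.getD_eq_getElem _ _ (by simp; omega)]
  simp

/-- The action of a word on a list of values. -/
def listRun (A : Matrix (Fin (n + 1)) (Fin (n + 1)) ℤ) (l : List ℤ) (x : List (Fin (n + 1))) :
    List ℤ :=
  x.foldl (fun l i => listStep A i l) l

theorem ofList_listRun (l : List ℤ) (x : List (Fin (n + 1))) :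
    (ofList (listRun A l x) : Fin (n + 1) → ℝ) = run A (ofList l) x := by
  induction x generalizing l with
  | nil => rfl
  | cons a x ih => rw [run_cons, ← ofList_listStep, ← ih]; rfl

/-- All values at the letters of a word are negative when they are used. -/
def listNeg (A : Matrix (Fin (n + 1)) (Fin (n + 1)) ℤ) : List ℤ → List (Fin (n + 1)) → Bool
  | _, [] => true
  | l, a :: x => decide (l.getD a 0 < 0) && listNeg A (listStep A a l) x

theorem negWord_ofList {l : List ℤ} {x : List (Fin (n + 1))} (h : listNeg A l x = true) :
    NegWord A (ofList l) x := by
  induction x generalizing l with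
  | nil => trivial
  | cons a x ih =>
    rw [listNeg, Bool.and_eq_true, decide_eq_true_eq] at h
    rw [negWord_cons, ← ofList_listStep]
    exact ⟨by rw [ofList]; exact_mod_cast h.1, ih h.2⟩

theorem ofList_eq_fcw {l : List ℤ} {j : Fin (n + 1)}
    (h : ∀ k : Fin (n + 1), l.getD k 0 = if k = 0 then -δ j else if k = j then 1 else 0) :
    ofList l = fcw δ j := by
  funext k
  rw [ofList, h]
  by_cases h0 : k = 0
  · simp [h0, fcw_zero]
  · simp only [fcw_of_ne h0, if_neg h0, Int.cast_ite, Int.cast_one, Int.cast_zero]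

/-- The list of values of `ω_j^∨`. -/
def fcwList (δ : Fin (n + 1) → ℤ) (j : Fin (n + 1)) : List ℤ :=
  (List.finRange (n + 1)).map fun k : Fin (n + 1) => if k = 0 then -δ j else if k = j then 1 else 0

theorem ofList_fcwList (j : Fin (n + 1)) : ofList (fcwList δ j) = fcw δ j :=
  ofList_eq_fcw fun k => by rw [fcwList, List.getD_eq_getElem _ _ (by simp; omega)]; simp

/-- The list of states `L` is closed under the generators, and no state has negative values at two
adjacent nodes. -/
def listGood (A : Matrix (Fin (n + 1)) (Fin (n + 1)) ℤ) (L : List (List ℤ)) : Bool :=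
  L.all fun g => (List.finRange (n + 1)).all fun a => decide (listStep A a g ∈ L) &&
    (List.finRange (n + 1)).all fun b => decide (a = b) || decide (A a b = 0) ||
      decide (0 ≤ g.getD a 0) || decide (0 ≤ g.getD b 0)

theorem good_ofList (hA : IsCartan A) (L : List (List ℤ)) (hL : listGood A L = true)
    {j : Fin (n + 1)} (hj : fcwList δ j ∈ L) : Good hA (fcw δ j) := by
  simp only [listGood, List.all_eq_true, Bool.and_eq_true, Bool.or_eq_true, decide_eq_true_eq] at hL
  refine good_of_invariant hA (fun f => ∃ g ∈ L, ofList g = f) ?_ ?_ ⟨_, hj, ofList_fcwList j⟩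
  · rintro _ ⟨g, hg, rfl⟩ i
    exact ⟨_, (hL g hg i (List.mem_finRange i)).1, ofList_listStep i g⟩
  · rintro _ ⟨g, hg, rfl⟩ a b hab h ⟨h1, h2⟩
    rw [ofList] at h1 h2
    have h1' : g.getD a 0 < 0 := by exact_mod_cast h1
    have h2' : g.getD b 0 < 0 := by exact_mod_cast h2
    have h3 := (hL g hg a (List.mem_finRange a)).2 b (List.mem_finRange b)
    omega

theorem not_good_of_listRun (hA : IsCartan A) {j : Fin (n + 1)} (x : List (Fin (n + 1)))
    {a b : Fin (n + 1)} (hab : a ≠ b) (h : A a b ≠ 0)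
    (hneg : (listRun A (fcwList δ j) x).getD a 0 < 0 ∧ (listRun A (fcwList δ j) x).getD b 0 < 0) :
    ¬ Good hA (fcw δ j) := by
  intro hg
  refine (hg.run x).not hab h ?_ ?_
  all_goals rw [← ofList_fcwList, ← ofList_listRun, ofList]
  · exact_mod_cast hneg.1
  · exact_mod_cast hneg.2

theorem isRow_ofList (hA : IsAffine A δ ε) {u : List (Fin (n + 1))} {j : Fin (n + 1)} (hj : j ≠ 0)
    (hu : u ≠ []) (hgood : Good hA.toIsCartan (fcw δ j)) (d : List ℤ) (y : List (Fin (n + 1)))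
    (h1 : listNeg A d u = true) (h2 : listRun A d u = d) (h3 : listRun A d y = fcwList δ j) :
    IsRow hA u j :=
  ⟨hj, hu, hgood, ofList d, y, negWord_ofList h1, by rw [← ofList_listRun, h2],
    by rw [← ofList_listRun, h3, ofList_fcwList]⟩

theorem run_eq_step_of_list (hA : IsAffine A δ ε) {y : List (Fin (n + 1))}
    (h : ∀ i, listRun A ((List.finRange (n + 1)).map fun j : Fin (n + 1) => A j i) y =
      listStep A 0 ((List.finRange (n + 1)).map fun j : Fin (n + 1) => A j i)) {f : Fin (n + 1) → ℝ}
    (hf : LevelZero δ f) : run A f y = step A 0 f := by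
  refine run_eq_step_of_coroot hA (fun i => ?_) hf
  have h1 : coroot A i = ofList ((List.finRange (n + 1)).map fun j : Fin (n + 1) => A j i) := by
    funext k
    rw [ofList, List.getD_eq_getElem _ _ (by simp; omega)]
    simp [coroot]
  rw [h1, ← ofList_listRun, h i, ofList_listStep]

end AffineFC

namespace AffineFC

/-! ### The exceptional types -/

theorem isAffine_E6 : IsAffine cartanE6 ![1, 1, 2, 3, 2, 1, 2] ![1, 1, 1, 1, 1, 1, 1] where
  diag := by decide +kernel
  off := by decide +kernel
  δ_pos := by decide +kernel
  δ_zero := rfl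
  δ_null := by decide +kernel
  ε_pos := by decide +kernel
  symm := by decide +kernel
  dvd := by decide +kernel
  infinite := by decide +kernel
  nbr_zero := by decide +kernel
  nbr := by decide +kernel

theorem isAffine_E7 : IsAffine cartanE7 ![1, 2, 3, 4, 3, 2, 1, 2] ![1, 1, 1, 1, 1, 1, 1, 1] where
  diag := by decide +kernel
  off := by decide +kernel
  δ_pos := by decide +kernel
  δ_zero := rfl
  δ_null := by decide +kernel
  ε_pos := by decide +kernel
  symm := by decide +kernel
  dvd := by decide +kernel
  infinite := by decide +kernel
  nbr_zero := by decide +kernel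
  nbr := by decide +kernel

theorem isAffine_E8 :
    IsAffine cartanE8 ![1, 2, 3, 4, 5, 6, 4, 2, 3] ![1, 1, 1, 1, 1, 1, 1, 1, 1] where
  diag := by decide +kernel
  off := by decide +kernel
  δ_pos := by decide +kernel
  δ_zero := rfl
  δ_null := by decide +kernel
  ε_pos := by decide +kernel
  symm := by decide +kernel
  dvd := by decide +kernel
  infinite := by decide +kernel
  nbr_zero := by decide +kernel
  nbr := by decide +kernel

theorem isAffine_F4 : IsAffine cartanF4 ![1, 2, 3, 4, 2] ![2, 2, 2, 1, 1] where
  diag := by decide +kernel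
  off := by decide +kernel
  δ_pos := by decide +kernel
  δ_zero := rfl
  δ_null := by decide +kernel
  ε_pos := by decide +kernel
  symm := by decide +kernel
  dvd := by decide +kernel
  infinite := by decide +kernel
  nbr_zero := by decide +kernel
  nbr := by decide +kernel

theorem isAffine_G2 : IsAffine cartanG2 ![1, 2, 3] ![3, 3, 1] where
  diag := by decide +kernel
  off := by decide +kernel
  δ_pos := by decide +kernel
  δ_zero := rfl
  δ_null := by decide +kernel
  ε_pos := by decide +kernel
  symm := by decide +kernel
  dvd := by decide +kernel
  infinite := by decide +kernel
  nbr_zero := by decide +kernel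
  nbr := by decide +kernel

/-- The list is the orbit of 27 states of a minuscule coweight. -/
theorem good_E6_five : Good isAffine_E6.toIsCartan (fcw ![1, 1, 2, 3, 2, 1, 2] 5) := by
  refine good_ofList _
    [[-1, 0, 0, 0, 0, 1, 0], [1, 0, 0, 0, 0, 1, -1], [-1, 0, 0, 0, 1, -1, 0],
     [1, 0, 0, 0, 1, -1, -1], [0, 0, 0, -1, 0, 1, 1], [-1, 0, 0, 1, -1, 0, 0],
     [1, 0, 0, 1, -1, 0, -1], [0, 0, 0, -1, 1, -1, 1], [0, 0, -1, 1, -1, 1, 0],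
     [-1, 0, 1, -1, 0, 0, 1], [1, 0, 1, -1, 0, 0, 0], [0, 0, 0, 0, -1, 0, 1],
     [0, 0, -1, 1, 0, -1, 0], [0, -1, 1, 0, -1, 1, 0], [0, 0, -1, 0, 1, 0, 0],
     [-1, 1, -1, 0, 0, 0, 1], [0, 0, 1, 0, 0, 0, -1], [1, 1, -1, 0, 0, 0, 0],
     [0, -1, 1, 0, 0, -1, 0], [0, 1, 0, 0, -1, 1, 0], [0, -1, 1, -1, 1, 0, 0],
     [-1, -1, 0, 0, 0, 0, 1], [0, 1, -1, 1, 0, 0, -1], [1, -1, 0, 0, 0, 0, 0],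
     [0, 1, 0, 0, 0, -1, 0], [0, 1, 0, -1, 1, 0, 0], [0, -1, 0, 1, 0, 0, -1]]
    ?_ ?_
  all_goals decide +kernel

theorem good_E6_one : Good isAffine_E6.toIsCartan (fcw ![1, 1, 2, 3, 2, 1, 2] 1) := by
  refine good_ofList _
    [[-1, 1, 0, 0, 0, 0, 0], [1, 1, 0, 0, 0, 0, -1], [-1, -1, 1, 0, 0, 0, 0],
     [1, -1, 1, 0, 0, 0, -1], [0, 1, 0, -1, 0, 0, 1], [-1, 0, -1, 1, 0, 0, 0],
     [1, 0, -1, 1, 0, 0, -1], [0, -1, 1, -1, 0, 0, 1], [0, 1, -1, 1, -1, 0, 0],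
     [-1, 0, 0, -1, 1, 0, 1], [1, 0, 0, -1, 1, 0, 0], [0, 0, -1, 0, 0, 0, 1],
     [0, -1, 0, 1, -1, 0, 0], [0, 0, 1, 0, -1, 0, 0], [0, 1, -1, 0, 1, -1, 0],
     [-1, 0, 0, 0, -1, 1, 1], [0, 0, 0, 0, 1, 0, -1], [1, 0, 0, 0, -1, 1, 0],
     [0, -1, 0, 0, 1, -1, 0], [0, 0, 1, -1, 1, -1, 0], [0, 1, -1, 0, 0, 1, 0],
     [-1, 0, 0, 0, 0, -1, 1], [0, 0, 0, 1, -1, 1, -1], [1, 0, 0, 0, 0, -1, 0],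
     [0, -1, 0, 0, 0, 1, 0], [0, 0, 0, 1, 0, -1, -1], [0, 0, 1, -1, 0, 1, 0]]
    ?_ ?_
  all_goals decide +kernel

/-- The list is the orbit of 56 states of the minuscule coweight. -/
theorem good_E7_six : Good isAffine_E7.toIsCartan (fcw ![1, 2, 3, 4, 3, 2, 1, 2] 6) := by
  refine good_ofList _
    [[-1, 0, 0, 0, 0, 0, 1, 0], [1, -1, 0, 0, 0, 0, 1, 0], [-1, 0, 0, 0, 0, 1, -1, 0],
     [0, 1, -1, 0, 0, 0, 1, 0], [1, -1, 0, 0, 0, 1, -1, 0], [-1, 0, 0, 0, 1, -1, 0, 0],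
     [0, 0, 1, -1, 0, 0, 1, 0], [0, 1, -1, 0, 0, 1, -1, 0], [1, -1, 0, 0, 1, -1, 0, 0],
     [-1, 0, 0, 1, -1, 0, 0, 0], [0, 0, 0, 1, -1, 0, 1, -1], [0, 0, 1, -1, 0, 1, -1, 0],
     [0, 1, -1, 0, 1, -1, 0, 0], [1, -1, 0, 1, -1, 0, 0, 0], [-1, 0, 1, -1, 0, 0, 0, 1],
     [0, 0, 0, 0, 1, -1, 1, -1], [0, 0, 0, 1, -1, 1, -1, -1], [0, 0, 0, 0, -1, 0, 1, 1],
     [0, 0, 1, -1, 1, -1, 0, 0], [0, 1, -1, 1, -1, 0, 0, 0], [1, -1, 1, -1, 0, 0, 0, 1],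
     [-1, 1, -1, 0, 0, 0, 0, 1], [-1, 0, 1, 0, 0, 0, 0, -1], [0, 0, 0, 0, 0, 1, 0, -1],
     [0, 0, 0, 0, 1, 0, -1, -1], [0, 0, 0, -1, 1, -1, 1, 1], [0, 0, 0, 1, 0, -1, 0, -1],
     [0, 0, 0, 0, -1, 1, -1, 1], [0, 0, 1, 0, -1, 0, 0, 0], [0, 1, 0, -1, 0, 0, 0, 1],
     [1, 0, -1, 0, 0, 0, 0, 1], [1, -1, 1, 0, 0, 0, 0, -1], [0, -1, 0, 0, 0, 0, 0, 1],
     [-1, 1, -1, 1, 0, 0, 0, -1], [0, 0, 0, -1, 0, 1, 0, 1], [0, 0, 0, -1, 1, 0, -1, 1],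
     [0, 0, -1, 1, 0, -1, 1, 0], [0, 0, 0, 0, 0, -1, 0, 1], [0, 1, 0, 0, 0, 0, 0, -1],
     [1, 0, -1, 1, 0, 0, 0, -1], [0, -1, 0, 1, 0, 0, 0, -1], [-1, 1, 0, -1, 1, 0, 0, 0],
     [0, 0, -1, 1, -1, 1, 0, 0], [0, 0, -1, 1, 0, 0, -1, 0], [0, -1, 1, 0, 0, -1, 1, 0],
     [1, 0, 0, -1, 1, 0, 0, 0], [0, -1, 1, -1, 1, 0, 0, 0], [-1, 1, 0, 0, -1, 1, 0, 0],
     [0, -1, 1, 0, -1, 1, 0, 0], [0, 0, -1, 0, 1, 0, 0, 0], [0, -1, 1, 0, 0, 0, -1, 0],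
     [-1, 1, 0, 0, 0, -1, 1, 0], [1, 0, 0, 0, -1, 1, 0, 0], [-1, 1, 0, 0, 0, 0, -1, 0],
     [1, 0, 0, 0, 0, -1, 1, 0], [1, 0, 0, 0, 0, 0, -1, 0]]
    ?_ ?_
  all_goals decide +kernel

/-- This coweight is not minuscule, yet its six states still avoid two adjacent negative values. -/
theorem good_G2_two : Good isAffine_G2.toIsCartan (fcw ![1, 2, 3] 2) := by
  refine good_ofList _
    [[-3, 0, 1], [3, -3, 1], [-3, 3, -1], [0, 3, -2], [3, 0, -1], [0, -3, 2]]
    ?_ ?_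
  all_goals decide +kernel

theorem isFullList_E6 : IsFullList cartanE6
    [([3, 2, 5, 4, 3, 1, 2, 6, 3, 4, 0, 6], 5), ([3, 2, 0, 6, 3, 1, 2, 4, 3, 5, 4, 6], 1)] := by
  -- The displayed word of 21 letters represents the reflection in the highest root, the linear part
  -- of s_0.
  refine isFullList_of_isRow isAffine_E6 (fun _ => ⟨⟨[6, 3, 4, 5, 2, 3, 4, 1, 2, 3, 6, 3, 4, 5, 2,
    3, 4, 1, 2, 3, 6], by decide, fun f => run_eq_step_of_list isAffine_E6 (by decide +kernel)⟩,
    fun h0 => ?_⟩) ?_ ?_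
  · have h6 := coroot_mem_translations_of_edge isAffine_E6 (k := 6) h0 (by decide +kernel)
    have h3 := coroot_mem_translations_of_edge isAffine_E6 (k := 3) h6 (by decide +kernel)
    have h2 := coroot_mem_translations_of_edge isAffine_E6 (k := 2) h3 (by decide +kernel)
    have h1 := coroot_mem_translations_of_edge isAffine_E6 (k := 1) h2 (by decide +kernel)
    have h4 := coroot_mem_translations_of_edge isAffine_E6 (k := 4) h3 (by decide +kernel)
    have h5 := coroot_mem_translations_of_edge isAffine_E6 (k := 5) h4 (by decide +kernel)
    intro i
    fin_cases i <;> assumption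
  · simp only [List.forall_mem_cons, List.not_mem_nil, IsEmpty.forall_iff, implies_true, and_true]
    exact ⟨isRow_ofList _ (by decide) (by decide) good_E6_five [0, 0, 0, -1, 1, -1, 1] [5, 6, 0]
        (by decide +kernel) (by decide +kernel) (by decide +kernel),
      isRow_ofList _ (by decide) (by decide) good_E6_one [-1, 0, 0, -1, 1, 0, 1] [3, 2, 1]
        (by decide +kernel) (by decide +kernel) (by decide +kernel)⟩
  · intro j hj hjr
    simp only [List.forall_mem_cons, List.not_mem_nil, IsEmpty.forall_iff, implies_true, and_true]
      at hjr
    fin_cases j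
    · exact absurd rfl hj
    · exact absurd rfl hjr.2
    -- For each remaining coweight an explicit word leads to a state that is negative at the two
    -- adjacent nodes a and b.
    · exact not_good_of_listRun _ [0, 2, 3] (a := 6) (b := 3) (by decide) (by decide +kernel)
        (by decide +kernel)
    · exact not_good_of_listRun _ [0, 3] (a := 6) (b := 3) (by decide) (by decide +kernel)
        (by decide +kernel)
    · exact not_good_of_listRun _ [0, 4, 3] (a := 6) (b := 3) (by decide) (by decide +kernel)
        (by decide +kernel)
    · exact absurd rfl hjr.1
    · exact not_good_of_listRun _ [6] (a := 6) (b := 0) (by decide) (by decide +kernel)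
        (by decide +kernel)

theorem isFullList_E7 : IsFullList cartanE7
    [([3, 7, 5, 4, 3, 2, 6, 5, 4, 3, 7, 1, 2, 3, 0, 1, 2, 4], 6)] := by
  refine isFullList_of_isRow isAffine_E7 (fun _ => ⟨⟨[1, 2, 3, 7, 4, 5, 6, 3, 4, 5, 2, 3, 4, 1, 2,
    3, 7, 3, 4, 5, 2, 3, 4, 1, 2, 3, 7, 6, 5, 4, 3, 2, 1], by decide,
    fun f => run_eq_step_of_list isAffine_E7 (by decide +kernel)⟩, fun h0 => ?_⟩) ?_ ?_
  · have h1 := coroot_mem_translations_of_edge isAffine_E7 (k := 1) h0 (by decide +kernel)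
    have h2 := coroot_mem_translations_of_edge isAffine_E7 (k := 2) h1 (by decide +kernel)
    have h3 := coroot_mem_translations_of_edge isAffine_E7 (k := 3) h2 (by decide +kernel)
    have h4 := coroot_mem_translations_of_edge isAffine_E7 (k := 4) h3 (by decide +kernel)
    have h5 := coroot_mem_translations_of_edge isAffine_E7 (k := 5) h4 (by decide +kernel)
    have h6 := coroot_mem_translations_of_edge isAffine_E7 (k := 6) h5 (by decide +kernel)
    have h7 := coroot_mem_translations_of_edge isAffine_E7 (k := 7) h3 (by decide +kernel)
    intro i
    fin_cases i <;> assumption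
  · simp only [List.forall_mem_cons, List.not_mem_nil, IsEmpty.forall_iff, implies_true, and_true]
    exact isRow_ofList _ (by decide) (by decide) good_E7_six [0, 0, 1, -1, 1, -1, 0, 0]
      [2, 1, 0, 5, 6] (by decide +kernel) (by decide +kernel) (by decide +kernel)
  · intro j hj hjr
    simp only [List.forall_mem_cons, List.not_mem_nil, IsEmpty.forall_iff, implies_true, and_true]
      at hjr
    fin_cases j
    · exact absurd rfl hj
    · exact not_good_of_listRun _ [1] (a := 1) (b := 0) (by decide)
        (by decide +kernel) (by decide +kernel)
    · exact not_good_of_listRun _ [0, 2] (a := 2) (b := 1) (by decide)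
        (by decide +kernel) (by decide +kernel)
    · exact not_good_of_listRun _ [0, 1, 3] (a := 3) (b := 2) (by decide)
        (by decide +kernel) (by decide +kernel)
    · exact not_good_of_listRun _ [0, 1, 2, 4] (a := 4) (b := 3) (by decide)
        (by decide +kernel) (by decide +kernel)
    · exact not_good_of_listRun _ [0, 1, 2, 3, 5] (a := 5) (b := 4) (by decide)
        (by decide +kernel) (by decide +kernel)
    · exact absurd rfl hjr
    · exact not_good_of_listRun _ [0, 1, 2, 7] (a := 7) (b := 3) (by decide)
        (by decide +kernel) (by decide +kernel)

/-- All marks of the nodes j ≠ 0 are at least 2. The letters 0, 1, … carry the value -δ_j to a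
neighbour of j; reflecting at j makes j negative and adds only 1 to that neighbour, which stays
negative. -/
theorem isFullList_E8 : IsFullList cartanE8 [] := by
  refine isFullList_of_isRow isAffine_E8 (fun h => absurd rfl h) (by simp) fun j hj _ => ?_
  fin_cases j
  · exact absurd rfl hj
  · exact not_good_of_listRun _ [1] (a := 1) (b := 0) (by decide)
      (by decide +kernel) (by decide +kernel)
  · exact not_good_of_listRun _ [0, 2] (a := 2) (b := 1) (by decide)
      (by decide +kernel) (by decide +kernel)
  · exact not_good_of_listRun _ [0, 1, 3] (a := 3) (b := 2) (by decide)
      (by decide +kernel) (by decide +kernel)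
  · exact not_good_of_listRun _ [0, 1, 2, 4] (a := 4) (b := 3) (by decide)
      (by decide +kernel) (by decide +kernel)
  · exact not_good_of_listRun _ [0, 1, 2, 3, 5] (a := 5) (b := 4) (by decide)
      (by decide +kernel) (by decide +kernel)
  · exact not_good_of_listRun _ [0, 1, 2, 3, 4, 6] (a := 6) (b := 5) (by decide)
      (by decide +kernel) (by decide +kernel)
  · exact not_good_of_listRun _ [0, 1, 2, 3, 4, 5, 7] (a := 7) (b := 6) (by decide)
      (by decide +kernel) (by decide +kernel)
  · exact not_good_of_listRun _ [0, 1, 2, 3, 4, 8] (a := 8) (b := 5) (by decide)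
      (by decide +kernel) (by decide +kernel)

theorem isFullList_F4 : IsFullList cartanF4 [] := by
  refine isFullList_of_isRow isAffine_F4 (fun h => absurd rfl h) (by simp) fun j hj _ => ?_
  fin_cases j
  · exact absurd rfl hj
  · exact not_good_of_listRun _ [1] (a := 1) (b := 0) (by decide)
      (by decide +kernel) (by decide +kernel)
  · exact not_good_of_listRun _ [0, 2] (a := 2) (b := 1) (by decide)
      (by decide +kernel) (by decide +kernel)
  · exact not_good_of_listRun _ [0, 1, 3] (a := 3) (b := 2) (by decide)
      (by decide +kernel) (by decide +kernel)
  · exact not_good_of_listRun _ [0, 1, 2, 4] (a := 4) (b := 3) (by decide)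
      (by decide +kernel) (by decide +kernel)

theorem isFullList_G2 : IsFullList cartanG2 [([0, 1, 2, 1, 2], 2)] := by
  refine isFullList_of_isRow isAffine_G2 (fun _ => ⟨⟨[1, 2, 1, 2, 1], by decide,
    fun f => run_eq_step_of_list isAffine_G2 (by decide +kernel)⟩, fun h0 => ?_⟩) ?_ ?_
  · have h1 := coroot_mem_translations_of_edge isAffine_G2 (k := 1) h0 (by decide +kernel)
    have h2 := coroot_mem_translations_of_edge isAffine_G2 (k := 2) h1 (by decide +kernel)
    intro i
    fin_cases i <;> assumption
  · simp only [List.forall_mem_cons, List.not_mem_nil, IsEmpty.forall_iff, implies_true, and_true]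
    exact isRow_ofList _ (by decide) (by decide) good_G2_two [-3, 0, 1] []
      (by decide +kernel) (by decide +kernel) (by decide +kernel)
  · intro j hj hjr
    simp only [List.forall_mem_cons, List.not_mem_nil, IsEmpty.forall_iff, implies_true, and_true]
      at hjr
    fin_cases j
    · exact absurd rfl hj
    · exact not_good_of_listRun _ [1] (a := 1) (b := 0) (by decide)
        (by decide +kernel) (by decide +kernel)
    · exact absurd rfl hjr

end AffineFC

/-! ### Coordinates and signed permutations for the classical types. -/

namespace AffineFC

variable {n : ℕ} {A : Matrix (Fin (n + 1)) (Fin (n + 1)) ℤ} {δ ε : Fin (n + 1) → ℤ}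

/-! ### Negative words between states -/

/-- `u` is a negative word from the state `f` to the state `g`. -/
def Moves (A : Matrix (Fin (n + 1)) (Fin (n + 1)) ℤ) (f : Fin (n + 1) → ℝ)
    (u : List (Fin (n + 1))) (g : Fin (n + 1) → ℝ) : Prop :=
  NegWord A f u ∧ run A f u = g

theorem Moves.single {f g : Fin (n + 1) → ℝ} {a : Fin (n + 1)} (h : f a < 0)
    (hg : step A a f = g) : Moves A f [a] g :=
  ⟨⟨h, trivial⟩, hg⟩

theorem Moves.append {f g h : Fin (n + 1) → ℝ} {u v : List (Fin (n + 1))} (h1 : Moves A f u g)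
    (h2 : Moves A g v h) : Moves A f (u ++ v) h :=
  ⟨(negWord_append _ _ _).2 ⟨h1.1, by rw [h1.2]; exact h2.1⟩, by rw [run_append, h1.2, h2.2]⟩

theorem Moves.cons {f g h : Fin (n + 1) → ℝ} {a : Fin (n + 1)} {v : List (Fin (n + 1))}
    (h1 : Moves A f [a] g) (h2 : Moves A g v h) : Moves A f (a :: v) h :=
  h1.append h2

theorem Moves.smul {c : ℝ} (hc : 0 < c) {f g : Fin (n + 1) → ℝ} {u : List (Fin (n + 1))}
    (h : Moves A f u g) : Moves A (c • f) u (c • g) :=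
  ⟨(negWord_smul hc _ _).2 h.1, by rw [run_smul, h.2]⟩

/-- The bound with b + 1 admits the empty word, which occurs for small n. -/
theorem Moves.up {g : ℕ → Fin (n + 1) → ℝ} {a b : ℕ} (hab : a ≤ b + 1)
    (h : ∀ k, a ≤ k → k ≤ b → Moves A (g k) [Fin.ofNat (n + 1) k] (g (k + 1))) :
    Moves A (g a) (toWord n (AffineFC.up a b)) (g (b + 1)) := by
  obtain ⟨m, hm⟩ := Nat.exists_eq_add_of_le hab
  rw [AffineFC.up, hm, Nat.add_sub_cancel_left]
  have h' : ∀ k, a ≤ k → k < a + m → Moves A (g k) [Fin.ofNat (n + 1) k] (g (k + 1)) :=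
    fun k h1 h2 => h k h1 (by omega)
  clear h hm hab
  induction m generalizing a with
  | zero => exact ⟨trivial, rfl⟩
  | succ m ih =>
    have h1 := ih (a := a + 1) fun k h1 h2 => h' k (by omega) (by omega)
    rw [show a + 1 + m = a + (m + 1) by omega] at h1
    exact (h' a le_rfl (by omega)).cons h1

theorem Moves.down {g : ℕ → Fin (n + 1) → ℝ} {a b : ℕ} (hab : b ≤ a + 1)
    (h : ∀ k, b ≤ k → k ≤ a → Moves A (g (k + 1)) [Fin.ofNat (n + 1) k] (g k)) :
    Moves A (g (a + 1)) (toWord n (AffineFC.down a b)) (g b) := by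
  obtain ⟨m, hm⟩ := Nat.exists_eq_add_of_le hab
  rw [AffineFC.down, hm, Nat.add_sub_cancel_left]
  have h' : ∀ k, b ≤ k → k < b + m → Moves A (g (k + 1)) [Fin.ofNat (n + 1) k] (g k) :=
    fun k h1 h2 => h k h1 (by omega)
  clear h hm hab
  induction m generalizing b with
  | zero => exact ⟨trivial, rfl⟩
  | succ m ih =>
    have h1 := ih (b := b + 1) fun k h1 h2 => h' k (by omega) (by omega)
    rw [show b + 1 + m = b + (m + 1) by omega] at h1
    rw [List.range'_succ, List.reverse_cons, toWord, List.map_append]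
    exact h1.append (h' b le_rfl (by omega))

/-- The factor c allows the sign vectors of types C and D, which are twice a fundamental coweight.
-/
theorem isRow_of_moves (hA : IsAffine A δ ε) {u : List (Fin (n + 1))} {j : Fin (n + 1)}
    (hj : j ≠ 0) (hu : u ≠ []) {c : ℝ} (hc : 0 < c) {d : Fin (n + 1) → ℝ}
    (hgood : Good hA.toIsCartan (c • fcw δ j)) (h : Moves A d u d) (y : List (Fin (n + 1)))
    (hy : run A d y = c • fcw δ j) : IsRow hA u j := by
  refine ⟨hj, hu, Good.of_smul hc hgood, c⁻¹ • d, y, (h.smul (inv_pos.2 hc)).1,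
    (h.smul (inv_pos.2 hc)).2, ?_⟩
  rw [run_smul, hy, smul_smul, inv_mul_cancel₀ hc.ne', one_smul]

theorem step_mem_translations (hA : IsAffine A δ ε) {f : Fin (n + 1) → ℝ}
    (h : f ∈ translations hA) (k : Fin (n + 1)) : step A k f ∈ translations hA := by
  rw [← lin_simple hA.toIsCartan]
  exact lin_mem_translations hA h _

/-! ### Coordinates for the classical types -/

/-- The transposition of the coordinates `k` and `k + 1`. -/
def swapAt (k : ℕ) (x : ℕ → ℝ) : ℕ → ℝ :=
  fun m => if m = k then x (k + 1) else if m = k + 1 then x k else x m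

/-- The sign change of the coordinate `k`. -/
def flipAt (k : ℕ) (x : ℕ → ℝ) : ℕ → ℝ := fun m => if m = k then -x m else x m

/-- The transposition of the coordinates `a` and `b` together with their sign changes. -/
def negSwap (a b : ℕ) (x : ℕ → ℝ) : ℕ → ℝ :=
  fun m => if m = a then -x b else if m = b then -x a else x m

/-- The vector with coordinate `c` at `k` and zero elsewhere. -/
def unitVec (k : ℕ) (c : ℝ) : ℕ → ℝ := fun m => if m = k then c else 0

/-- The vector with coordinate `-1` at the positions in `P` and `1` elsewhere. -/
def signVec (P : ℕ → Prop) [DecidablePred P] : ℕ → ℝ := fun m => if P m then -1 else 1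

/-- The vector with `j` coordinates `1` followed by zeros. -/
def onesVec (j : ℕ) : ℕ → ℝ := fun m => if m ≤ j then 1 else 0

theorem swapAt_unitVec (k : ℕ) (c : ℝ) : swapAt k (unitVec k c) = unitVec (k + 1) c := by
  funext m
  simp only [swapAt, unitVec]
  split_ifs <;> first | rfl | omega

theorem swapAt_unitVec_succ (k : ℕ) (c : ℝ) : swapAt k (unitVec (k + 1) c) = unitVec k c := by
  funext m
  simp only [swapAt, unitVec]
  split_ifs <;> first | rfl | omega

/-- `f` expresses the states of type `A` by coordinates `x_1, …, x_n` such that `s_k` is the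
transposition of the coordinates `k` and `k + 1`, for `1 ≤ k < n`. -/
structure IsCoord (A : Matrix (Fin (n + 1)) (Fin (n + 1)) ℤ) (f : (ℕ → ℝ) → Fin (n + 1) → ℝ) :
    Prop where
  swap : ∀ k x, 1 ≤ k → k < n → step A (Fin.ofNat (n + 1) k) (f x) = f (swapAt k x)
  diff : ∀ k x, 1 ≤ k → k < n → f x (Fin.ofNat (n + 1) k) = x k - x (k + 1)
  coroot : ∀ i, ∃ x, AffineFC.coroot A i = f x

variable {f : (ℕ → ℝ) → Fin (n + 1) → ℝ}

theorem IsCoord.moves (hf : IsCoord A f) {k : ℕ} (hk : 1 ≤ k) (hkn : k < n) {x y : ℕ → ℝ}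
    (hx : x k < x (k + 1)) (hy : swapAt k x = y) : Moves A (f x) [Fin.ofNat (n + 1) k] (f y) :=
  Moves.single (by rw [hf.diff k x hk hkn]; linarith) (by rw [hf.swap k x hk hkn, hy])

/-- `g` is the action of an element of the finite Weyl group. -/
def Realizable (A : Matrix (Fin (n + 1)) (Fin (n + 1)) ℤ) (f : (ℕ → ℝ) → Fin (n + 1) → ℝ)
    (g : (ℕ → ℝ) → ℕ → ℝ) : Prop :=
  ∃ y : List (Fin (n + 1)), 0 ∉ y ∧ ∀ x, run A (f x) y = f (g x)

theorem ofNat_ne_zero {k : ℕ} (hk : 1 ≤ k) (hkn : k ≤ n) : Fin.ofNat (n + 1) k ≠ 0 := by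
  intro h
  have := congrArg Fin.val h
  rw [Fin.val_ofNat, Nat.mod_eq_of_lt (by omega)] at this
  exact absurd this (by simp; omega)

theorem IsCoord.realizable_swapAt (hf : IsCoord A f) {k : ℕ} (hk : 1 ≤ k) (hkn : k < n) :
    Realizable A f (swapAt k) :=
  ⟨[Fin.ofNat (n + 1) k], by simpa using (ofNat_ne_zero hk hkn.le).symm,
    fun x => hf.swap k x hk hkn⟩

theorem Realizable.comp {g h : (ℕ → ℝ) → ℕ → ℝ} (hg : Realizable A f g) (hh : Realizable A f h) :
    Realizable A f fun x => h (g x) := by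
  obtain ⟨y, hy, hyg⟩ := hg
  obtain ⟨z, hz, hzh⟩ := hh
  exact ⟨y ++ z, by simp [hy, hz], fun x => by rw [run_append, hyg, hzh]⟩

theorem IsCoord.realizable_conj (hf : IsCoord A f) {g h : (ℕ → ℝ) → ℕ → ℝ} {k : ℕ} (hk : 1 ≤ k)
    (hkn : k < n) (hg : Realizable A f g) (hgh : ∀ x, swapAt k (g (swapAt k x)) = h x) :
    Realizable A f h := by
  rw [← funext hgh]
  exact ((hf.realizable_swapAt hk hkn).comp hg).comp (hf.realizable_swapAt hk hkn)

/-- Conjugation by the transposition of k and k + 1 moves the sign change from k + 1 to k. -/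
theorem IsCoord.realizable_flipAt (hf : IsCoord A f) (h : Realizable A f (flipAt n)) {k : ℕ}
    (hk : 1 ≤ k) (hkn : k ≤ n) : Realizable A f (flipAt k) := by
  induction hkn using Nat.decreasingInduction with
  | self => exact h
  | of_succ k hkn ih =>
    refine hf.realizable_conj hk hkn (ih (by omega)) fun x => ?_
    funext m
    simp only [swapAt, flipAt]
    split_ifs <;> first | omega | simp_all

theorem IsCoord.realizable_negSwap (hf : IsCoord A f) (h : Realizable A f (negSwap (n - 1) n))
    {a b : ℕ} (ha : 1 ≤ a) (hab : a < b) (hbn : b ≤ n) : Realizable A f (negSwap a b) := by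
  have h1 : ∀ a, 1 ≤ a → a ≤ n - 1 → Realizable A f (negSwap a n) := by
    intro a ha han
    induction han using Nat.decreasingInduction with
    | self => exact h
    | of_succ k hkn ih =>
      refine hf.realizable_conj ha (by omega) (ih (by omega)) fun x => ?_
      funext m
      simp only [swapAt, negSwap]
      split_ifs <;> first | omega | simp_all
  -- The first index is already in place; now the second one is moved down from n by transpositions
  -- that do not touch a.
  induction hbn using Nat.decreasingInduction with
  | self => exact h1 a ha (by omega)
  | of_succ k hkn ih =>
    refine hf.realizable_conj (by omega) hkn (ih (by omega)) fun x => ?_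
    funext m
    simp only [swapAt, negSwap]
    split_ifs <;> first | omega | simp_all

theorem IsCoord.exists_word (hf : IsCoord A f) (hA : IsAffine A δ ε) {g : (ℕ → ℝ) → ℕ → ℝ}
    (h0 : ∀ x, step A 0 (f x) = f (g x)) (hg : Realizable A f g) :
    ∃ y : List (Fin (n + 1)), 0 ∉ y ∧ ∀ f, LevelZero δ f → run A f y = step A 0 f := by
  obtain ⟨y, hy, hyg⟩ := hg
  refine ⟨y, hy, fun p hp => run_eq_step_of_coroot hA (fun i => ?_) hp⟩
  obtain ⟨x, hx⟩ := hf.coroot i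
  rw [hx, hyg, h0]

/-- The invariant of the good states: up to sign and order, the coordinates are either
`1, 0, …, 0` or `1, …, 1`. -/
def IsMinuscule (n : ℕ) (x : ℕ → ℝ) : Prop :=
  (∀ a, 1 ≤ a → a ≤ n → x a = -1 ∨ x a = 0 ∨ x a = 1) ∧
  ((∀ a b, 1 ≤ a → a ≤ n → 1 ≤ b → b ≤ n → a ≠ b → x a = 0 ∨ x b = 0) ∨
    ∀ a, 1 ≤ a → a ≤ n → x a ≠ 0)

theorem IsMinuscule.signed_perm {x y : ℕ → ℝ} (hx : IsMinuscule n x) (σ : ℕ → ℕ)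
    (hσ : ∀ a, 1 ≤ a → a ≤ n → 1 ≤ σ a ∧ σ a ≤ n) (hinj : ∀ a b, σ a = σ b → a = b)
    (hy : ∀ a, 1 ≤ a → a ≤ n → y a = x (σ a) ∨ y a = -x (σ a)) : IsMinuscule n y := by
  have h0 : ∀ a, 1 ≤ a → a ≤ n → (x (σ a) = 0 ↔ y a = 0) := by
    intro a h1 h2
    rcases hy a h1 h2 with h | h <;> simp [h]
  refine ⟨fun a h1 h2 => ?_, hx.2.imp (fun h a b h1 h2 h3 h4 hab => ?_) fun h a h1 h2 h3 => ?_⟩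
  · obtain ⟨h3, h4⟩ := hσ a h1 h2
    rcases hy a h1 h2 with h | h <;> rcases hx.1 _ h3 h4 with h5 | h5 | h5 <;> simp [h, h5]
  · rw [← h0 a h1 h2, ← h0 b h3 h4]
    exact h _ _ (hσ a h1 h2).1 (hσ a h1 h2).2 (hσ b h3 h4).1 (hσ b h3 h4).2
      fun h5 => hab (hinj a b h5)
  · exact h _ (hσ a h1 h2).1 (hσ a h1 h2).2 ((h0 a h1 h2).2 h3)

theorem IsMinuscule.swapAt {x : ℕ → ℝ} (hx : IsMinuscule n x) {k : ℕ} (hk : 1 ≤ k) (hkn : k < n) :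
    IsMinuscule n (AffineFC.swapAt k x) := by
  refine hx.signed_perm (fun m => if m = k then k + 1 else if m = k + 1 then k else m) ?_ ?_ ?_
  · intro a; split_ifs <;> omega
  · intro a b; split_ifs <;> omega
  · intro a _ _
    left
    simp only [AffineFC.swapAt]
    split_ifs <;> rfl

theorem IsMinuscule.flipAt {x : ℕ → ℝ} (hx : IsMinuscule n x) (k : ℕ) :
    IsMinuscule n (AffineFC.flipAt k x) := by
  refine hx.signed_perm id (fun a h1 h2 => ⟨h1, h2⟩) (fun a b h => h) fun a _ _ => ?_
  simp only [AffineFC.flipAt, id]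
  split_ifs <;> simp

theorem IsMinuscule.negSwap {x : ℕ → ℝ} (hx : IsMinuscule n x) {a b : ℕ} (ha : 1 ≤ a)
    (han : a ≤ n) (hb : 1 ≤ b) (hbn : b ≤ n) : IsMinuscule n (AffineFC.negSwap a b x) := by
  refine hx.signed_perm (fun m => if m = a then b else if m = b then a else m) ?_ ?_ ?_
  · intro a; split_ifs <;> omega
  · intro a b; split_ifs <;> omega
  · intro a _ _
    simp only [AffineFC.negSwap]
    split_ifs <;> simp

theorem IsMinuscule.mem {x : ℕ → ℝ} (hx : IsMinuscule n x) {a : ℕ} (ha : 1 ≤ a) (han : a ≤ n) :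
    -1 ≤ x a ∧ x a ≤ 1 := by
  rcases hx.1 a ha han with h | h | h <;> rw [h] <;> norm_num

/-- All coordinates are at least -1, so one lying above another up to sign is not -1. This settles
the edge at a short end node. -/
theorem IsMinuscule.nonneg_of_lt {x : ℕ → ℝ} (hx : IsMinuscule n x) {a b : ℕ} (ha : 1 ≤ a)
    (han : a ≤ n) (hb : 1 ≤ b) (hbn : b ≤ n) {u : ℝ} (hu : u = x a ∨ u = -x a) (h : u < x b) :
    0 ≤ x b := by
  have h1 := hx.mem ha han
  rcases hx.1 b hb hbn with h2 | h2 | h2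
  · rcases hu with hu | hu <;> linarith
  · exact h2.ge
  · rw [h2]; norm_num

/-- There are no three coordinates in signed increasing order. -/
theorem IsMinuscule.not_chain {x : ℕ → ℝ} (hx : IsMinuscule n x) {a b c : ℕ} (ha : 1 ≤ a)
    (han : a ≤ n) (hb : 1 ≤ b) (hbn : b ≤ n) (hc : 1 ≤ c) (hcn : c ≤ n) (hac : a ≠ c) {u w : ℝ}
    (hu : u = x a ∨ u = -x a) (hw : w = x c ∨ w = -x c) (h1 : u < x b) (h2 : x b < w) : False := by
  have hb0 : x b = 0 := by
    have h3 := hx.mem ha han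
    have h4 := hx.mem hc hcn
    rcases hx.1 b hb hbn with h | h | h
    · rcases hu with hu | hu <;> linarith
    · exact h
    · rcases hw with hw | hw <;> linarith
  rcases hx.2 with h | h
  · rcases h a c ha han hc hcn hac with h | h
    · rcases hu with hu | hu <;> rw [hu, h, hb0] at h1 <;> simp at h1
    · rcases hw with hw | hw <;> rw [hw, h, hb0] at h2 <;> simp at h2
  · exact h b hb hbn hb0

theorem val_ofNat {k : ℕ} (hk : k ≤ n) : (Fin.ofNat (n + 1) k : ℕ) = k := by
  rw [Fin.val_ofNat, Nat.mod_eq_of_lt (by omega)]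

theorem toWord_append (l l' : List ℕ) : toWord n (l ++ l') = toWord n l ++ toWord n l' :=
  List.map_append

theorem sum_eq_zero_of_telescope (g : Fin (n + 1) → ℝ) (T : ℕ → ℝ) (h0 : T 0 = 0)
    (hn : T (n + 1) = 0) (h : ∀ j : Fin (n + 1), g j = T j - T (j + 1)) : ∑ j, g j = 0 := by
  rw [Finset.sum_congr rfl fun j _ => h j,
    Fin.sum_univ_eq_sum_range (fun k => T k - T (k + 1)) (n + 1), Finset.sum_range_sub', h0, hn,
    sub_zero]

/-- The consecutive coordinates 1, 0, -1 give the value 1 at both of the adjacent nodes j - 1 and j,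
which `Good.not_pos` forbids. -/
theorem IsCoord.not_good (hf : IsCoord A f) (hA : IsAffine A δ ε)
    (hlevel : ∀ x, LevelZero δ (f x)) {j : ℕ} (hj : 2 ≤ j) (hjn : j < n)
    (hadj : A (Fin.ofNat (n + 1) (j - 1)) (Fin.ofNat (n + 1) j) ≠ 0) {g : (ℕ → ℝ) → ℕ → ℝ}
    (hg : Realizable A f g) (h1 : g (onesVec j) (j - 1) = 1) (h2 : g (onesVec j) j = 0)
    (h3 : g (onesVec j) (j + 1) = -1) : ¬ Good hA.toIsCartan (f (onesVec j)) := by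
  intro hgood
  obtain ⟨y, -, hy⟩ := hg
  have h4 := hgood.run y
  rw [hy] at h4
  refine h4.not_pos hA (hlevel _) (fun h => ?_) hadj ?_ ?_
  · have := congrArg Fin.val h
    rw [val_ofNat (by omega), val_ofNat hjn.le] at this
    omega
  · rw [hf.diff _ _ (by omega) (by omega), Nat.sub_add_cancel (by omega), h1, h2]
    norm_num
  · rw [hf.diff _ _ (by omega) hjn, h2, h3]
    norm_num

theorem isMinuscule_unitVec (n k : ℕ) : IsMinuscule n (unitVec k 1) := by
  refine ⟨fun a _ _ => ?_, Or.inl fun a b _ _ _ _ hab => ?_⟩ <;> simp only [unitVec]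
  · split_ifs <;> simp
  · split_ifs <;> first | omega | simp

theorem isMinuscule_signVec (n : ℕ) (P : ℕ → Prop) [DecidablePred P] :
    IsMinuscule n (signVec P) := by
  refine ⟨fun a _ _ => ?_, Or.inr fun a _ _ => ?_⟩ <;> simp only [signVec] <;> split_ifs <;> simp

end AffineFC

namespace AffineFC

variable {n : ℕ}

/-! ### Type B -/

/-- The state of type `B̃_n` with coordinates `x`. -/
def coordB (n : ℕ) (x : ℕ → ℝ) (i : Fin (n + 1)) : ℝ :=
  if (i : ℕ) = 0 then -x 1 - x 2 else if (i : ℕ) = n then x n else x i - x (i + 1)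

/-- The marks of `B̃_n`. -/
def marksB (n : ℕ) (i : Fin (n + 1)) : ℤ := if (i : ℕ) ≤ 1 then 1 else 2

/-- The symmetrizer of `B̃_n`. -/
def symmB (n : ℕ) (i : Fin (n + 1)) : ℤ := if (i : ℕ) = n then 1 else 2

/-- The coordinates of the coroots of `B̃_n`. -/
def corootB (n i : ℕ) : ℕ → ℤ := fun m =>
  if i = 0 then (if m = 1 ∨ m = 2 then -1 else 0)
  else if i = n then (if m = n then 2 else 0)
  else if m = i then 1 else if m = i + 1 then -1 else 0

theorem cartanB_apply (i j : Fin (n + 1)) : cartanB n i j = if (i : ℕ) = j then 2 else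
    -((if ((i : ℕ) = 0 ∧ (j : ℕ) = 2) ∨ ((i : ℕ) = 2 ∧ (j : ℕ) = 0) ∨
      (1 ≤ (i : ℕ) ∧ (j : ℕ) = i + 1) ∨ (1 ≤ (j : ℕ) ∧ (i : ℕ) = j + 1) then
      (if (j : ℕ) = n then 2 else 1) else 0 : ℕ) : ℤ) := by
  simp only [cartanB, cartanOf, Matrix.of_apply, Fin.ext_iff]

theorem cartanB_eq (hn : 2 ≤ n) (i j : Fin (n + 1)) :
    (cartanB n j i : ℝ) = coordB n (fun m => (corootB n i m : ℝ)) j := by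
  obtain ⟨i, hi⟩ := i
  obtain ⟨j, hj⟩ := j
  simp only [cartanB_apply, coordB, corootB]
  split_ifs <;> first | omega | (norm_num; done) | simp_all

/-- Only the coordinates 1, …, n enter a state, so y may be arbitrary outside this range. -/
theorem coordB_step (hn : 2 ≤ n) (i : Fin (n + 1)) (x y : ℕ → ℝ)
    (h : ∀ m, 1 ≤ m → m ≤ n → y m = x m - coordB n x i * corootB n i m) :
    step (cartanB n) i (coordB n x) = coordB n y := by
  funext j
  rw [step_apply, cartanB_eq hn]
  simp only [coordB]
  have hj := j.2
  split_ifs <;> (repeat rw [h _ (by omega) (by omega)]) <;> simp only [coordB] <;>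
    split_ifs <;> first | omega | ring

theorem coordB_levelZero (hn : 2 ≤ n) (x : ℕ → ℝ) : LevelZero (marksB n) (coordB n x) := by
  rw [LevelZero, pair_apply]
  -- The first difference is the value at 0; from there on the coordinates appear doubled, matching
  -- the marks 2.
  refine sum_eq_zero_of_telescope _
    (fun k => if k = 0 then 0 else if n < k then 0 else if k = 1 then x 1 + x 2 else 2 * x k)
    (by simp)
    (by simp) fun j => ?_
  obtain ⟨j, hj⟩ := j
  simp only [coordB, marksB]
  split_ifs <;> first | omega | contradiction | (subst_vars; push_cast; ring)

theorem isAffine_B (hn : 2 ≤ n) : IsAffine (cartanB n) (marksB n) (symmB n) where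
  diag i := by simp [cartanB, cartanOf]
  off i j h := by
    obtain ⟨i, hi⟩ := i
    obtain ⟨j, hj⟩ := j
    simp only [cartanB_apply, ne_eq, Fin.mk.injEq] at h ⊢
    split_ifs <;> first | omega | simp
  δ_pos i := by unfold marksB; split_ifs <;> norm_num
  δ_zero := by simp [marksB]
  δ_null i := by
    have h := coordB_levelZero hn fun m => (corootB n i m : ℝ)
    rw [LevelZero, pair_apply] at h
    simp_rw [← cartanB_eq hn] at h
    exact_mod_cast h
  ε_pos i := by unfold symmB; split_ifs <;> norm_num
  symm i j := by
    obtain ⟨i, hi⟩ := i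
    obtain ⟨j, hj⟩ := j
    simp only [cartanB_apply, symmB]
    split_ifs <;> omega
  dvd i := by
    obtain ⟨i, hi⟩ := i
    have h0 : symmB n 0 = 2 := if_neg (by rw [Fin.val_zero]; omega)
    rw [h0]
    simp only [symmB, marksB]
    split_ifs <;> omega
  infinite i j h := by
    obtain ⟨i, hi⟩ := i
    obtain ⟨j, hj⟩ := j
    simp only [cartanB_apply, Fin.mk.injEq, ne_eq] at h ⊢
    split_ifs <;> omega
  nbr_zero := ⟨Fin.ofNat (n + 1) 2, ofNat_ne_zero (by omega) hn, by
    rw [cartanB_apply, val_ofNat hn, Fin.val_zero]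
    split_ifs <;> omega⟩
  nbr i hi := by
    have := i.2
    refine ⟨Fin.ofNat (n + 1) (i - 1), ofNat_ne_zero (by omega) (by omega), ?_, ?_⟩
    · rw [← Fin.val_fin_lt, val_ofNat (by omega)]
      omega
    · rw [cartanB_apply, val_ofNat (by omega)]
      split_ifs <;> omega

theorem isCoord_B (hn : 2 ≤ n) : IsCoord (cartanB n) (coordB n) where
  swap k x hk hkn := by
    refine coordB_step hn _ _ _ fun m _ _ => ?_
    simp only [coordB, corootB, swapAt, val_ofNat hkn.le]
    split_ifs <;> first | omega | (subst_vars; push_cast; ring)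
  diff k x hk hkn := by
    simp only [coordB, val_ofNat hkn.le]
    rw [if_neg (by omega), if_neg (by omega)]
  coroot i := ⟨_, funext fun j => cartanB_eq hn i j⟩

theorem coordB_step_last (hn : 2 ≤ n) (x : ℕ → ℝ) :
    step (cartanB n) (Fin.ofNat (n + 1) n) (coordB n x) = coordB n (flipAt n x) := by
  refine coordB_step hn _ _ _ fun m _ _ => ?_
  simp only [coordB, corootB, flipAt, val_ofNat le_rfl]
  split_ifs <;> first | omega | (subst_vars; push_cast; ring)

theorem coordB_step_zero (hn : 2 ≤ n) (x : ℕ → ℝ) :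
    step (cartanB n) 0 (coordB n x) = coordB n (negSwap 1 2 x) := by
  refine coordB_step hn _ _ _ fun m _ _ => ?_
  simp only [coordB, corootB, negSwap, Fin.val_zero, if_true]
  split_ifs <;> first | omega | (subst_vars; push_cast; ring)

/-- Signed permutations preserve `IsMinuscule`. Negative values at adjacent nodes would be three
coordinates in signed increasing order, excluded by `IsMinuscule.not_chain`, or, at the short node
n, a negative x_n above another coordinate up to sign. -/
theorem good_coordB (hn : 2 ≤ n) {x : ℕ → ℝ} (hx : IsMinuscule n x) :
    Good (isAffine_B hn).toIsCartan (coordB n x) := by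
  refine good_of_invariant _ (fun g => ∃ x, IsMinuscule n x ∧ coordB n x = g) ?_ ?_ ⟨x, hx, rfl⟩
  · rintro _ ⟨x, hx, rfl⟩ i
    have hi : i = Fin.ofNat (n + 1) i := (Fin.ofNat_val_eq_self i).symm
    have hin := i.2
    by_cases h0 : (i : ℕ) = 0
    · rw [hi, h0]
      exact ⟨_, hx.negSwap le_rfl (by omega) (by omega) (by omega), (coordB_step_zero hn x).symm⟩
    · by_cases h1 : (i : ℕ) = n
      · rw [hi, h1]
        exact ⟨_, hx.flipAt n, (coordB_step_last hn x).symm⟩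
      · rw [hi]
        exact ⟨_, hx.swapAt (by omega) (by omega),
          ((isCoord_B hn).swap i x (by omega) (by omega)).symm⟩
  · rintro _ ⟨x, hx, rfl⟩
    have key : ∀ a b : Fin (n + 1), ((a : ℕ) = 0 ∧ (b : ℕ) = 2) ∨ (1 ≤ (a : ℕ) ∧ (b : ℕ) = a + 1) →
        coordB n x a < 0 → coordB n x b < 0 → False := by
      rintro ⟨a, ha⟩ ⟨b, hb⟩ hab h1 h2
      simp only [coordB] at hab h1 h2
      rcases hab with ⟨rfl, rfl⟩ | ⟨ha1, rfl⟩
      · rw [if_pos rfl] at h1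
        rw [if_neg (by omega)] at h2
        -- For n = 2 the neighbour 2 of the node 0 is already the short end node.
        split_ifs at h2 with h3
        · subst h3
          have := hx.nonneg_of_lt (a := 1) (b := 2) (by omega) (by omega) (by omega) le_rfl
            (Or.inr rfl) (by linarith)
          linarith
        · exact hx.not_chain (a := 1) (b := 2) (c := 3) (by omega) (by omega) (by omega) (by omega)
            (by omega) (by omega) (by omega) (Or.inr rfl) (Or.inl rfl) (by linarith) (by linarith)
      · rw [if_neg (by omega), if_neg (by omega)] at h1
        rw [if_neg (by omega)] at h2
        split_ifs at h2 with h3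
        · rw [h3] at h1
          have := hx.nonneg_of_lt (a := a) (b := n) (by omega) (by omega) (by omega) le_rfl
            (Or.inl rfl) (by linarith)
          linarith
        · exact hx.not_chain (a := a) (b := a + 1) (c := a + 1 + 1) (by omega) (by omega) (by omega)
            (by omega) (by omega) (by omega) (by omega) (Or.inl rfl) (Or.inl rfl) (by linarith)
            (by linarith)
    rintro a b hab hAab ⟨h1, h2⟩
    have hadj : ((a : ℕ) = 0 ∧ (b : ℕ) = 2) ∨ ((a : ℕ) = 2 ∧ (b : ℕ) = 0) ∨
        (1 ≤ (a : ℕ) ∧ (b : ℕ) = a + 1) ∨ (1 ≤ (b : ℕ) ∧ (a : ℕ) = b + 1) := by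
      by_contra hcon
      apply hAab
      rw [cartanB_apply, if_neg (fun h => hab (Fin.ext h)), if_neg hcon]
      rfl
    rcases hadj with h | h | h | h
    · exact key a b (Or.inl h) h1 h2
    · exact key b a (Or.inl h.symm) h2 h1
    · exact key a b (Or.inr h) h1 h2
    · exact key b a (Or.inr h) h2 h1

theorem coordB_onesVec {j : ℕ} (hj : 1 ≤ j) (hjn : j ≤ n) :
    coordB n (onesVec j) = fcw (marksB n) (Fin.ofNat (n + 1) j) := by
  funext k
  simp only [coordB, onesVec, fcw, marksB, Fin.ext_iff, val_ofNat hjn, Fin.val_zero]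
  have := k.2
  split_ifs <;> first | omega | norm_num

theorem coordB_congr (hn : 2 ≤ n) {x y : ℕ → ℝ} (h : ∀ m, 1 ≤ m → m ≤ n → x m = y m) :
    coordB n x = coordB n y := by
  funext ⟨k, hk⟩
  simp only [coordB]
  split_ifs <;> (repeat rw [h _ (by omega) (by omega)])

theorem realizable_flipAt_B (hn : 2 ≤ n) {k : ℕ} (hk : 1 ≤ k) (hkn : k ≤ n) :
    Realizable (cartanB n) (coordB n) (flipAt k) :=
  (isCoord_B hn).realizable_flipAt ⟨[Fin.ofNat (n + 1) n], by
    simpa using (ofNat_ne_zero (by omega) le_rfl).symm, coordB_step_last hn⟩ hk hkn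

theorem coroot_mem_translations_B (hn : 2 ≤ n)
    (h0 : coroot (cartanB n) 0 ∈ translations (isAffine_B hn)) (i : Fin (n + 1)) :
    coroot (cartanB n) i ∈ translations (isAffine_B hn) := by
  have h2 : coroot (cartanB n) (Fin.ofNat (n + 1) 2) ∈ translations (isAffine_B hn) := by
    refine coroot_mem_translations_of_edge _ h0 ?_
    rw [cartanB_apply, val_ofNat hn, Fin.val_zero]
    split_ifs <;> omega
  have h1 : coroot (cartanB n) (Fin.ofNat (n + 1) 1) ∈ translations (isAffine_B hn) := by
    -- For n = 2 the Cartan entry needed here is -2 instead of -1; but α_1^∨ = -s_2 α_0^∨.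
    by_cases hn2 : n = 2
    · subst hn2
      rw [← neg_mem_iff]
      convert step_mem_translations _ h0 2 using 1
      ext j
      have h3 : ∀ j, -cartanB 2 j 1 = cartanB 2 j 0 - cartanB 2 2 0 * cartanB 2 j 2 := by
        decide +kernel
      rw [step_apply, Pi.neg_apply]
      change -(cartanB 2 j 1 : ℝ) = cartanB 2 j 0 - cartanB 2 2 0 * cartanB 2 j 2
      exact_mod_cast h3 j
    · refine coroot_mem_translations_of_edge _ h2 ?_
      rw [cartanB_apply, val_ofNat hn, val_ofNat (by omega)]
      split_ifs <;> omega
  have hk : ∀ k, 2 ≤ k → k ≤ n →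
      coroot (cartanB n) (Fin.ofNat (n + 1) k) ∈ translations (isAffine_B hn) := by
    intro k hk
    induction k, hk using Nat.le_induction with
    | base => exact fun _ => h2
    | succ k hk ih =>
      intro hkn
      refine coroot_mem_translations_of_edge _ (ih (by omega)) ?_
      rw [cartanB_apply, val_ofNat hkn, val_ofNat (by omega)]
      split_ifs <;> omega
  have hi : i = Fin.ofNat (n + 1) i := (Fin.ofNat_val_eq_self i).symm
  have hin := i.2
  rcases Nat.lt_or_ge (i : ℕ) 2 with h | h
  · interval_cases h3 : (i : ℕ)
    · rw [hi]; exact h0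
    · rw [hi]; exact h1
  · rw [hi]; exact hk i h (by omega)


/-- Minus signs are particles: the letter k moves one from k to the free position k + 1, and the
letter n removes the one at n, the position n + 1 being out of range. -/
theorem moves_signVec_B (hn : 2 ≤ n) {P Q : ℕ → Prop} [DecidablePred P] [DecidablePred Q] {k : ℕ}
    (hk : 1 ≤ k) (hkn : k ≤ n) (h1 : P k) (h2 : k < n → ¬ P (k + 1))
    (hQ : ∀ m, 1 ≤ m → m ≤ n → (Q m ↔ m ≠ k ∧ (m = k + 1 ∨ P m))) :
    Moves (cartanB n) (coordB n (signVec P)) [Fin.ofNat (n + 1) k] (coordB n (signVec Q)) := by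
  rcases hkn.lt_or_eq with hkn' | rfl
  · refine Moves.single ?_ ?_
    · rw [(isCoord_B hn).diff k _ hk hkn', signVec, signVec, if_pos h1, if_neg (h2 hkn')]
      norm_num
    · rw [(isCoord_B hn).swap k _ hk hkn']
      refine coordB_congr hn fun m hm hmn => ?_
      simp only [swapAt, signVec, hQ m hm hmn]
      split_ifs <;> first | rfl | (exfalso; simp_all)
  · refine Moves.single ?_ ?_
    · simp only [coordB, val_ofNat le_rfl, signVec, if_pos h1, if_neg (show ¬ k = 0 by omega)]
      norm_num
    · rw [coordB_step_last hn]
      refine coordB_congr hn fun m hm hmn => ?_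
      simp only [flipAt, signVec, hQ m hm hmn]
      have : m ≠ k + 1 := by omega
      split_ifs <;> first | rfl | (norm_num; done) | (exfalso; simp_all)

/-- The letter 0 creates particles at the positions 1 and 2. -/
theorem moves_signVec_zero_B (hn : 2 ≤ n) {P Q : ℕ → Prop} [DecidablePred P] [DecidablePred Q]
    (h1 : ¬ P 1) (h2 : ¬ P 2) (hQ : ∀ m, 1 ≤ m → m ≤ n → (Q m ↔ m = 1 ∨ m = 2 ∨ P m)) :
    Moves (cartanB n) (coordB n (signVec P)) [0] (coordB n (signVec Q)) := by
  refine Moves.single ?_ ?_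
  · simp only [coordB, Fin.val_zero, if_true, signVec, if_neg h1, if_neg h2]
    norm_num
  · rw [coordB_step_zero hn]
    refine coordB_congr hn fun m hm hmn => ?_
    simp only [negSwap, signVec, hQ m hm hmn, if_neg h1, if_neg h2]
    split_ifs <;> first | rfl | (exfalso; simp_all)

theorem isRow_one_B (hn : 2 ≤ n) :
    IsRow (isAffine_B hn) (toWord n ([2, 0, 1] ++ up 2 (n - 1) ++ down n 3))
      (Fin.ofNat (n + 1) 1) := by
  have hf := isCoord_B hn
  -- The unit vector travels down to position k; the index n + 1 stands for -e_n, which the letter n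
  -- reflects to e_n. For n = 2 the starting state `h 3` is this -e_n.
  let h : ℕ → Fin (n + 1) → ℝ := fun k =>
    coordB n (if k = n + 1 then unitVec n (-1) else unitVec k 1)
  have hh : ∀ k, 1 ≤ k → k ≤ n → Moves (cartanB n) (h (k + 1)) [Fin.ofNat (n + 1) k] (h k) := by
    intro k hk hkn
    simp only [h]
    rw [if_neg (show ¬ k = n + 1 by omega)]
    split_ifs with h1
    · obtain rfl : k = n := by omega
      refine Moves.single ?_ ?_
      · simp only [coordB, val_ofNat le_rfl, if_neg (show ¬ k = 0 by omega), unitVec]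
        norm_num
      · rw [coordB_step_last hn]
        refine coordB_congr hn fun m hm hmn => ?_
        simp only [flipAt, unitVec]
        split_ifs <;> norm_num
    · exact hf.moves hk (by omega) (by simp [unitVec]) (swapAt_unitVec_succ k 1)
  have h1 : coordB n (unitVec 1 1) = (1 : ℝ) • fcw (marksB n) (Fin.ofNat (n + 1) 1) := by
    rw [one_smul, ← coordB_onesVec le_rfl (by omega)]
    refine coordB_congr hn fun m hm hmn => ?_
    simp only [unitVec, onesVec]
    split_ifs <;> first | rfl | omega
  have hup : ∀ k, 1 ≤ k → k < n → Moves (cartanB n) (coordB n (unitVec k (-1)))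
      [Fin.ofNat (n + 1) k] (coordB n (unitVec (k + 1) (-1))) := fun k hk hkn =>
    hf.moves hk hkn (by simp [unitVec]) (swapAt_unitVec k (-1))
  have h2 : Moves (cartanB n) (h 3) [Fin.ofNat (n + 1) 2] (coordB n (unitVec 2 1)) := by
    have := hh 2 (by omega) hn
    simpa only [h, if_neg (show ¬ 2 = n + 1 by omega)] using this
  have h3 : Moves (cartanB n) (coordB n (unitVec 2 1)) [0] (coordB n (unitVec 1 (-1))) := by
    refine Moves.single ?_ ?_
    · simp [coordB, unitVec]
    · rw [coordB_step_zero hn]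
      refine coordB_congr hn fun m hm hmn => ?_
      simp only [negSwap, unitVec]
      split_ifs <;> first | omega | simp
  have h4 : Moves (cartanB n) (coordB n (unitVec 2 (-1))) (toWord n (up 2 (n - 1)))
      (coordB n (unitVec n (-1))) := by
    have := Moves.up (A := cartanB n) (g := fun k => coordB n (unitVec k (-1))) (a := 2) (b := n - 1)
      (by omega) fun k hk hkn => hup k (by omega) (by omega)
    rwa [Nat.sub_add_cancel (by omega)] at this
  have h5 : Moves (cartanB n) (coordB n (unitVec n (-1))) (toWord n (down n 3)) (h 3) := by
    have := Moves.down (A := cartanB n) (g := h) (a := n) (b := 3) (by omega) fun k hk hkn =>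
      hh k (by omega) hkn
    simpa only [h, if_true] using this
  refine isRow_of_moves (isAffine_B hn) (ofNat_ne_zero le_rfl (by omega)) (by simp [toWord])
    one_pos (d := h 3) ?_ ?_ [Fin.ofNat (n + 1) 2, Fin.ofNat (n + 1) 1] ?_
  · rw [← h1]
    exact good_coordB hn (isMinuscule_unitVec n 1)
  · rw [toWord_append, toWord_append]
    exact ((h2.cons (h3.cons (hup 1 le_rfl (by omega)))).append h4).append h5
  · rw [← h1]
    exact (h2.cons (hf.moves le_rfl (by omega) (by simp [unitVec]) (swapAt_unitVec_succ 1 1))).2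

theorem isRow_last_B (hn : 2 ≤ n) :
    IsRow (isAffine_B hn) (toWord n ([2, 0] ++ up 3 n ++ [2, 1] ++ up 3 n))
      (Fin.ofNat (n + 1) n) := by
  have h1 : coordB n (signVec fun m => m = n + 1) =
      (1 : ℝ) • fcw (marksB n) (Fin.ofNat (n + 1) n) := by
    rw [one_smul, ← coordB_onesVec (by omega) le_rfl]
    refine coordB_congr hn fun m hm hmn => ?_
    simp only [signVec, onesVec]
    split_ifs <;> first | rfl | omega
  refine isRow_of_moves (isAffine_B hn) (ofNat_ne_zero (by omega) le_rfl) (by simp [toWord])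
    one_pos (d := coordB n (signVec fun m => m = 2)) ?_ ?_ (toWord n (up 2 n)) ?_
  · rw [← h1]
    exact good_coordB hn (isMinuscule_signVec n _)
  -- One particle starts at 2. It moves to 3, two new ones are created at 1 and 2, and the one at 3
  -- leaves at the end n; the other two advance by one place and the leading one leaves too, which
  -- restores the initial state.
  · have m1 : Moves (cartanB n) (coordB n (signVec fun m => m = 2)) [Fin.ofNat (n + 1) 2]
        (coordB n (signVec fun m => m = 3)) :=
      moves_signVec_B hn (by omega) hn (by omega) (by omega) (by omega)
    have m2 : Moves (cartanB n) (coordB n (signVec fun m => m = 3)) [0]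
        (coordB n (signVec fun m => m = 1 ∨ m = 2 ∨ m = 3)) :=
      moves_signVec_zero_B hn (by omega) (by omega) (by omega)
    have m3 := Moves.up (A := cartanB n) (a := 3) (b := n)
      (g := fun k => coordB n (signVec fun m => m = 1 ∨ m = 2 ∨ m = k)) (by omega)
      fun k hk hkn => moves_signVec_B hn (by omega) hkn (by omega) (by omega) (by omega)
    have m4 : Moves (cartanB n) (coordB n (signVec fun m => m = 1 ∨ m = 2 ∨ m = n + 1))
        [Fin.ofNat (n + 1) 2] (coordB n (signVec fun m => m = 1 ∨ m = 3 ∨ m = n + 1)) :=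
      moves_signVec_B hn (by omega) hn (by omega) (by omega) (by omega)
    have m5 : Moves (cartanB n) (coordB n (signVec fun m => m = 1 ∨ m = 3 ∨ m = n + 1))
        [Fin.ofNat (n + 1) 1] (coordB n (signVec fun m => m = 2 ∨ m = 3)) :=
      moves_signVec_B hn (by omega) (by omega) (by omega) (by omega) (by omega)
    have m6 := Moves.up (A := cartanB n) (a := 3) (b := n)
      (g := fun k => coordB n (signVec fun m => m = 2 ∨ m = k)) (by omega)
      fun k hk hkn => moves_signVec_B hn (by omega) hkn (by omega) (by omega) (by omega)
    have e : coordB n (signVec fun m => m = 2 ∨ m = n + 1) = coordB n (signVec fun m => m = 2) :=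
      coordB_congr hn fun m hm hmn => by
        simp only [signVec]
        split_ifs <;> first | rfl | omega
    rw [e] at m6
    rw [toWord_append, toWord_append, toWord_append]
    exact (((m1.cons m2).append m3).append (m4.cons m5)).append m6
  · rw [← h1]
    exact (Moves.up (A := cartanB n) (a := 2) (b := n)
      (g := fun k => coordB n (signVec fun m => m = k)) (by omega)
      fun k hk hkn => moves_signVec_B hn (by omega) hkn (by omega) (by omega) (by omega)).2

theorem isFullList_B (hn : 2 ≤ n) : IsFullList (cartanB n)
    [([2, 0, 1] ++ up 2 (n - 1) ++ down n 3, 1),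
      ([2, 0] ++ up 3 n ++ [2, 1] ++ up 3 n, n)] := by
  refine isFullList_of_isRow (isAffine_B hn) (fun _ => ⟨?_, coroot_mem_translations_B hn⟩) ?_ ?_
  · refine (isCoord_B hn).exists_word (isAffine_B hn) (coordB_step_zero hn) ?_
    -- The linear part of s_0 is a transposition with two sign changes, each available in the finite
    -- group.
    convert ((realizable_flipAt_B hn (k := 1) le_rfl (by omega)).comp
      (realizable_flipAt_B hn (k := 2) (by omega) hn)).comp
      ((isCoord_B hn).realizable_swapAt le_rfl (by omega)) using 1
    funext x m
    simp only [negSwap, flipAt, swapAt]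
    split_ifs <;> first | omega | simp_all
  · simp only [List.forall_mem_cons, List.not_mem_nil, IsEmpty.forall_iff, implies_true, and_true]
    exact ⟨isRow_one_B hn, isRow_last_B hn⟩
  · intro j hj hjr
    simp only [List.forall_mem_cons, List.not_mem_nil, IsEmpty.forall_iff, implies_true, and_true,
      ne_eq, Fin.ext_iff, val_ofNat le_rfl, val_ofNat (show 1 ≤ n by omega)] at hjr
    have hj0 : (j : ℕ) ≠ 0 := fun h => hj (Fin.ext h)
    have hjn := j.2
    have hj' : j = Fin.ofNat (n + 1) j := (Fin.ofNat_val_eq_self j).symm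
    rw [hj', ← coordB_onesVec (by omega) (by omega)]
    -- Exchanging the coordinates j and j + 1 and changing the sign of the latter yields 1, 0, -1 at
    -- the positions j - 1, j, j + 1.
    refine (isCoord_B hn).not_good (isAffine_B hn) (coordB_levelZero hn) (by omega) (by omega) ?_
      (((isCoord_B hn).realizable_swapAt (k := j) (by omega) (by omega)).comp
        (realizable_flipAt_B hn (k := j + 1) (by omega) (by omega))) ?_ ?_ ?_
    · rw [cartanB_apply, val_ofNat (by omega), val_ofNat (by omega)]
      split_ifs <;> omega
    all_goals
      simp only [flipAt, swapAt, onesVec]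
      split_ifs <;> first | omega | rfl

end AffineFC

namespace AffineFC

variable {n : ℕ}

/-! ### Type C -/

/-- The state of type `C̃_n` with coordinates `x`. -/
def coordC (n : ℕ) (x : ℕ → ℝ) (i : Fin (n + 1)) : ℝ :=
  if (i : ℕ) = 0 then -2 * x 1 else if (i : ℕ) = n then 2 * x n else x i - x (i + 1)

/-- The marks of `C̃_n`. -/
def marksC (n : ℕ) (i : Fin (n + 1)) : ℤ := if (i : ℕ) = 0 ∨ (i : ℕ) = n then 1 else 2

/-- The symmetrizer of `C̃_n`. -/
def symmC (n : ℕ) (i : Fin (n + 1)) : ℤ := if (i : ℕ) = 0 ∨ (i : ℕ) = n then 2 else 1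

/-- The coordinates of the coroots of `C̃_n`. -/
def corootC (n i : ℕ) : ℕ → ℤ := fun m =>
  if i = 0 then (if m = 1 then -1 else 0)
  else if i = n then (if m = n then 1 else 0)
  else if m = i then 1 else if m = i + 1 then -1 else 0

theorem cartanC_apply (i j : Fin (n + 1)) : cartanC n i j = if (i : ℕ) = j then 2 else
    -((if (j : ℕ) = i + 1 ∨ (i : ℕ) = j + 1 then (if (i : ℕ) = 0 ∨ (i : ℕ) = n then 2 else 1)
      else 0 : ℕ) : ℤ) := by
  simp only [cartanC, cartanOf, Matrix.of_apply, Fin.ext_iff]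

theorem cartanC_eq (hn : 2 ≤ n) (i j : Fin (n + 1)) :
    (cartanC n j i : ℝ) = coordC n (fun m => (corootC n i m : ℝ)) j := by
  obtain ⟨i, hi⟩ := i
  obtain ⟨j, hj⟩ := j
  simp only [cartanC_apply, coordC, corootC]
  split_ifs <;> first | omega | norm_num

theorem coordC_step (hn : 2 ≤ n) (i : Fin (n + 1)) (x y : ℕ → ℝ)
    (h : ∀ m, 1 ≤ m → m ≤ n → y m = x m - coordC n x i * corootC n i m) :
    step (cartanC n) i (coordC n x) = coordC n y := by
  funext j
  rw [step_apply, cartanC_eq hn]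
  simp only [coordC]
  have hj := j.2
  split_ifs <;> (repeat rw [h _ (by omega) (by omega)]) <;> simp only [coordC] <;>
    split_ifs <;> first | omega | ring

theorem coordC_levelZero (hn : 2 ≤ n) (x : ℕ → ℝ) : LevelZero (marksC n) (coordC n x) := by
  rw [LevelZero, pair_apply]
  refine sum_eq_zero_of_telescope _
    (fun k => if k = 0 then 0 else if n < k then 0 else 2 * x k)
    (by simp)
    (by simp) fun j => ?_
  obtain ⟨j, hj⟩ := j
  simp only [coordC, marksC]
  split_ifs <;> first | omega | contradiction | (subst_vars; push_cast; ring)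

theorem isAffine_C (hn : 2 ≤ n) : IsAffine (cartanC n) (marksC n) (symmC n) where
  diag i := by simp [cartanC, cartanOf]
  off i j h := by
    obtain ⟨i, hi⟩ := i
    obtain ⟨j, hj⟩ := j
    simp only [cartanC_apply, ne_eq, Fin.mk.injEq] at h ⊢
    split_ifs <;> first | omega | simp
  δ_pos i := by unfold marksC; split_ifs <;> norm_num
  δ_zero := by simp [marksC]
  δ_null i := by
    have h := coordC_levelZero hn fun m => (corootC n i m : ℝ)
    rw [LevelZero, pair_apply] at h
    simp_rw [← cartanC_eq hn] at h
    exact_mod_cast h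
  ε_pos i := by unfold symmC; split_ifs <;> norm_num
  symm i j := by
    obtain ⟨i, hi⟩ := i
    obtain ⟨j, hj⟩ := j
    simp only [cartanC_apply, symmC]
    split_ifs <;> omega
  dvd i := by
    obtain ⟨i, hi⟩ := i
    have h0 : symmC n 0 = 2 := if_pos (Or.inl rfl)
    rw [h0]
    simp only [symmC, marksC]
    split_ifs <;> omega
  infinite i j h := by
    obtain ⟨i, hi⟩ := i
    obtain ⟨j, hj⟩ := j
    simp only [cartanC_apply, Fin.mk.injEq, ne_eq] at h ⊢
    split_ifs <;> omega
  nbr_zero := ⟨Fin.ofNat (n + 1) 1, ofNat_ne_zero le_rfl (by omega), by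
    rw [cartanC_apply, val_ofNat (by omega), Fin.val_zero]
    split_ifs <;> omega⟩
  nbr i hi := by
    have := i.2
    refine ⟨Fin.ofNat (n + 1) (i - 1), ofNat_ne_zero (by omega) (by omega), ?_, ?_⟩
    · rw [← Fin.val_fin_lt, val_ofNat (by omega)]
      omega
    · rw [cartanC_apply, val_ofNat (by omega)]
      split_ifs <;> omega

theorem isCoord_C (hn : 2 ≤ n) : IsCoord (cartanC n) (coordC n) where
  swap k x hk hkn := by
    refine coordC_step hn _ _ _ fun m _ _ => ?_
    simp only [coordC, corootC, swapAt, val_ofNat hkn.le]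
    split_ifs <;> first | omega | (subst_vars; push_cast; ring)
  diff k x hk hkn := by
    simp only [coordC, val_ofNat hkn.le]
    rw [if_neg (by omega), if_neg (by omega)]
  coroot i := ⟨_, funext fun j => cartanC_eq hn i j⟩

theorem coordC_step_last (hn : 2 ≤ n) (x : ℕ → ℝ) :
    step (cartanC n) (Fin.ofNat (n + 1) n) (coordC n x) = coordC n (flipAt n x) := by
  refine coordC_step hn _ _ _ fun m _ _ => ?_
  simp only [coordC, corootC, flipAt, val_ofNat le_rfl]
  split_ifs <;> first | omega | (subst_vars; push_cast; ring)

theorem coordC_step_zero (hn : 2 ≤ n) (x : ℕ → ℝ) :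
    step (cartanC n) 0 (coordC n x) = coordC n (flipAt 1 x) := by
  refine coordC_step hn _ _ _ fun m _ _ => ?_
  simp only [coordC, corootC, flipAt, Fin.val_zero, if_true]
  split_ifs <;> first | omega | (subst_vars; push_cast; ring)

theorem good_coordC (hn : 2 ≤ n) {x : ℕ → ℝ} (hx : IsMinuscule n x) :
    Good (isAffine_C hn).toIsCartan (coordC n x) := by
  refine good_of_invariant _ (fun g => ∃ x, IsMinuscule n x ∧ coordC n x = g) ?_ ?_ ⟨x, hx, rfl⟩
  · rintro _ ⟨x, hx, rfl⟩ i
    have hi : i = Fin.ofNat (n + 1) i := (Fin.ofNat_val_eq_self i).symm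
    have hin := i.2
    by_cases h0 : (i : ℕ) = 0
    · rw [hi, h0]
      exact ⟨_, hx.flipAt 1, (coordC_step_zero hn x).symm⟩
    · by_cases h1 : (i : ℕ) = n
      · rw [hi, h1]
        exact ⟨_, hx.flipAt n, (coordC_step_last hn x).symm⟩
      · rw [hi]
        exact ⟨_, hx.swapAt (by omega) (by omega),
          ((isCoord_C hn).swap i x (by omega) (by omega)).symm⟩
  · rintro _ ⟨x, hx, rfl⟩
    have key : ∀ a b : Fin (n + 1), (b : ℕ) = a + 1 → coordC n x a < 0 → coordC n x b < 0 →
        False := by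
      rintro ⟨a, ha⟩ ⟨b, hb⟩ hab h1 h2
      simp only [coordC] at hab h1 h2
      subst hab
      rw [if_neg (by omega)] at h2
      by_cases ha0 : a = 0
      · subst ha0
        rw [if_pos rfl] at h1
        rw [if_neg (by omega)] at h2
        have h3 := hx.mem (a := 2) (by omega) (by omega)
        rcases hx.1 1 le_rfl (by omega) with h | h | h <;> norm_num at h1 h2 <;> linarith
      · rw [if_neg (by omega), if_neg (by omega)] at h1
        split_ifs at h2 with h3
        · rw [h3] at h1
          have := hx.nonneg_of_lt (a := a) (b := n) (by omega) (by omega) (by omega) le_rfl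
            (Or.inl rfl) (by linarith)
          linarith
        · exact hx.not_chain (a := a) (b := a + 1) (c := a + 1 + 1) (by omega) (by omega) (by omega)
            (by omega) (by omega) (by omega) (by omega) (Or.inl rfl) (Or.inl rfl) (by linarith)
            (by linarith)
    rintro a b hab hAab ⟨h1, h2⟩
    have hadj : (b : ℕ) = a + 1 ∨ (a : ℕ) = b + 1 := by
      by_contra hcon
      apply hAab
      rw [cartanC_apply, if_neg (fun h => hab (Fin.ext h)), if_neg hcon]
      rfl
    rcases hadj with h | h
    · exact key a b h h1 h2
    · exact key b a h h2 h1

theorem coordC_onesVec {j : ℕ} (hj : 1 ≤ j) (hjn : j < n) :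
    coordC n (onesVec j) = fcw (marksC n) (Fin.ofNat (n + 1) j) := by
  funext k
  simp only [coordC, onesVec, fcw, marksC, Fin.ext_iff, val_ofNat hjn.le, Fin.val_zero]
  have := k.2
  split_ifs <;> first | omega | norm_num

/-- The last coweight has all coordinates 1/2, since the root α_n is long; hence the factor 2. -/
theorem coordC_onesVec_last (hn : 2 ≤ n) :
    coordC n (onesVec n) = (2 : ℝ) • fcw (marksC n) (Fin.ofNat (n + 1) n) := by
  funext k
  simp only [coordC, onesVec, fcw, marksC, Fin.ext_iff, val_ofNat le_rfl, Fin.val_zero,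
    Pi.smul_apply, smul_eq_mul]
  have := k.2
  split_ifs <;> first | omega | (norm_num; done) | simp_all

theorem coordC_congr (hn : 2 ≤ n) {x y : ℕ → ℝ} (h : ∀ m, 1 ≤ m → m ≤ n → x m = y m) :
    coordC n x = coordC n y := by
  funext ⟨k, hk⟩
  simp only [coordC]
  split_ifs <;> (repeat rw [h _ (by omega) (by omega)])

theorem realizable_flipAt_C (hn : 2 ≤ n) {k : ℕ} (hk : 1 ≤ k) (hkn : k ≤ n) :
    Realizable (cartanC n) (coordC n) (flipAt k) :=
  (isCoord_C hn).realizable_flipAt ⟨[Fin.ofNat (n + 1) n], by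
    simpa using (ofNat_ne_zero (by omega) le_rfl).symm, coordC_step_last hn⟩ hk hkn

/-- The Cartan entry at the last edge is -2, so the edge argument stops before n. Instead the
vectors -e_{k+1} are carried along as images of α_0^∨ = -e_1, and α_n^∨ is the reflection of -e_n at
n. -/
theorem coroot_mem_translations_C (hn : 2 ≤ n)
    (h0 : coroot (cartanC n) 0 ∈ translations (isAffine_C hn)) (i : Fin (n + 1)) :
    coroot (cartanC n) i ∈ translations (isAffine_C hn) := by
  have hk : ∀ k, k < n → coroot (cartanC n) (Fin.ofNat (n + 1) k) ∈ translations (isAffine_C hn) ∧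
      coordC n (unitVec (k + 1) (-1)) ∈ translations (isAffine_C hn) := by
    intro k
    induction k with
    | zero =>
      refine fun _ => ⟨h0, ?_⟩
      convert h0 using 1
      funext j
      rw [coroot, cartanC_eq hn]
      refine congrFun (coordC_congr hn fun m hm hmn => ?_) j
      simp only [unitVec, corootC, Fin.val_zero, if_true]
      split_ifs <;> first | omega | simp
    | succ k ih =>
      intro hkn
      obtain ⟨h1, h2⟩ := ih (by omega)
      refine ⟨coroot_mem_translations_of_edge _ h1 ?_, ?_⟩
      · rw [cartanC_apply, val_ofNat (by omega), val_ofNat (by omega)]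
        split_ifs <;> first | omega | rfl | (exfalso; simp_all)
      · rw [← swapAt_unitVec, ← (isCoord_C hn).swap (k + 1) _ (by omega) hkn]
        exact step_mem_translations _ h2 _
  have hi : i = Fin.ofNat (n + 1) i := (Fin.ofNat_val_eq_self i).symm
  have hin := i.2
  rcases Nat.lt_or_ge (i : ℕ) n with h | h
  · rw [hi]; exact (hk i h).1
  · have h1 := step_mem_translations _ (hk (n - 1) (by omega)).2 (Fin.ofNat (n + 1) n)
    rw [Nat.sub_add_cancel (by omega), coordC_step_last hn] at h1
    convert h1 using 1
    funext j
    rw [coroot, cartanC_eq hn]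
    refine congrFun (coordC_congr hn fun m hm hmn => ?_) j
    simp only [unitVec, corootC, flipAt]
    split_ifs <;> first | omega | simp

theorem moves_signVec_C (hn : 2 ≤ n) {P Q : ℕ → Prop} [DecidablePred P] [DecidablePred Q] {k : ℕ}
    (hk : 1 ≤ k) (hkn : k ≤ n) (h1 : P k) (h2 : k < n → ¬ P (k + 1))
    (hQ : ∀ m, 1 ≤ m → m ≤ n → (Q m ↔ m ≠ k ∧ (m = k + 1 ∨ P m))) :
    Moves (cartanC n) (coordC n (signVec P)) [Fin.ofNat (n + 1) k] (coordC n (signVec Q)) := by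
  rcases hkn.lt_or_eq with hkn' | rfl
  · refine Moves.single ?_ ?_
    · rw [(isCoord_C hn).diff k _ hk hkn', signVec, signVec, if_pos h1, if_neg (h2 hkn')]
      norm_num
    · rw [(isCoord_C hn).swap k _ hk hkn']
      refine coordC_congr hn fun m hm hmn => ?_
      simp only [swapAt, signVec, hQ m hm hmn]
      split_ifs <;> first | rfl | (exfalso; simp_all)
  · refine Moves.single ?_ ?_
    · simp only [coordC, val_ofNat le_rfl, signVec, if_pos h1, if_neg (show ¬ k = 0 by omega)]
      norm_num
    · rw [coordC_step_last hn]
      refine coordC_congr hn fun m hm hmn => ?_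
      simp only [flipAt, signVec, hQ m hm hmn]
      have : m ≠ k + 1 := by omega
      split_ifs <;> first | rfl | (norm_num; done) | (exfalso; simp_all)

theorem isRow_one_C (hn : 2 ≤ n) :
    IsRow (isAffine_C hn) (toWord n ([1, 0] ++ up 1 n ++ down (n - 1) 2))
      (Fin.ofNat (n + 1) 1) := by
  have hf := isCoord_C hn
  have h1 : coordC n (unitVec 1 1) = (1 : ℝ) • fcw (marksC n) (Fin.ofNat (n + 1) 1) := by
    rw [one_smul, ← coordC_onesVec le_rfl (by omega)]
    refine coordC_congr hn fun m hm hmn => ?_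
    simp only [unitVec, onesVec]
    split_ifs <;> first | rfl | omega
  have hdown : ∀ k, 1 ≤ k → k < n → Moves (cartanC n) (coordC n (unitVec (k + 1) 1))
      [Fin.ofNat (n + 1) k] (coordC n (unitVec k 1)) := fun k hk hkn =>
    hf.moves hk hkn (by simp [unitVec]) (swapAt_unitVec_succ k 1)
  have h2 := hdown 1 le_rfl (by omega)
  have h3 : Moves (cartanC n) (coordC n (unitVec 1 1)) [0] (coordC n (unitVec 1 (-1))) := by
    refine Moves.single ?_ ?_
    · simp [coordC, unitVec]
    · rw [coordC_step_zero hn]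
      refine coordC_congr hn fun m hm hmn => ?_
      simp only [flipAt, unitVec]
      split_ifs <;> simp
  have h4 : Moves (cartanC n) (coordC n (unitVec 1 (-1))) (toWord n (up 1 n))
      (coordC n (unitVec n 1)) := by
    have := Moves.up (A := cartanC n) (a := 1) (b := n)
      -- The vector -e_k climbs to -e_n, and the letter n reflects it to e_n, the state with index n
      -- + 1.
      (g := fun k => coordC n (if k = n + 1 then unitVec n 1 else unitVec k (-1)))
      (by omega) fun k hk hkn => by
        simp only [if_neg (show ¬ k = n + 1 by omega)]
        split_ifs with h
        · obtain rfl : k = n := by omega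
          refine Moves.single ?_ ?_
          · simp only [coordC, val_ofNat le_rfl, if_neg (show ¬ k = 0 by omega), unitVec]
            norm_num
          · rw [coordC_step_last hn]
            refine coordC_congr hn fun m hm hmn => ?_
            simp only [flipAt, unitVec]
            split_ifs <;> norm_num
        · exact hf.moves hk (by omega) (by simp [unitVec]) (swapAt_unitVec k (-1))
    simpa only [if_true, if_neg (show ¬ 1 = n + 1 by omega)] using this
  have h5 := Moves.down (A := cartanC n) (a := n - 1) (b := 2)
    (g := fun k => coordC n (unitVec k 1)) (by omega) fun k hk hkn =>
      hdown k (by omega) (by omega)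
  simp only [Nat.sub_add_cancel (show 1 ≤ n by omega)] at h5
  refine isRow_of_moves (isAffine_C hn) (ofNat_ne_zero le_rfl (by omega)) (by simp [toWord])
    one_pos (d := coordC n (unitVec 2 1)) ?_ ?_ [Fin.ofNat (n + 1) 1] ?_
  · rw [← h1]
    exact good_coordC hn (isMinuscule_unitVec n 1)
  · rw [toWord_append, toWord_append]
    exact ((h2.cons h3).append h4).append h5
  · rw [← h1]
    exact h2.2

theorem isRow_last_C (hn : 2 ≤ n) :
    IsRow (isAffine_C hn) (toWord n (up 0 n)) (Fin.ofNat (n + 1) n) := by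
  have h1 : coordC n (signVec fun m => m = 0) =
      (2 : ℝ) • fcw (marksC n) (Fin.ofNat (n + 1) n) := by
    rw [← coordC_onesVec_last hn]
    refine coordC_congr hn fun m hm hmn => ?_
    simp only [signVec, onesVec]
    split_ifs <;> first | rfl | omega
  refine isRow_of_moves (isAffine_C hn) (ofNat_ne_zero (by omega) le_rfl)
    (by simp [toWord, up]) two_pos (d := coordC n (signVec fun m => m = 0)) ?_ ?_ [] h1
  · rw [← h1]
    exact good_coordC hn (isMinuscule_signVec n _)
  -- A single minus sign is created at 1 by the letter 0, moves to the right and leaves at n; the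
  -- positions 0 and n + 1 are out of range and both stand for the vector of ones.
  · have m1 := Moves.up (A := cartanC n) (a := 0) (b := n)
      (g := fun k => coordC n (signVec fun m => m = k)) (by omega) fun k _ hkn => by
        by_cases hk : k = 0
        · subst hk
          refine Moves.single ?_ ?_
          · simp [coordC, signVec]
          · refine (coordC_step_zero hn _).trans (coordC_congr hn fun m hm hmn => ?_)
            simp only [flipAt, signVec]
            split_ifs <;> first | omega | rfl
        · exact moves_signVec_C hn (by omega) hkn (by omega) (by omega) (by omega)
    have e : coordC n (signVec fun m => m = n + 1) = coordC n (signVec fun m => m = 0) :=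
      coordC_congr hn fun m hm hmn => by
        simp only [signVec]
        split_ifs <;> first | rfl | omega
    simp only [e] at m1
    exact m1

theorem isFullList_C (hn : 2 ≤ n) : IsFullList (cartanC n)
    [([1, 0] ++ up 1 n ++ down (n - 1) 2, 1), (up 0 n, n)] := by
  refine isFullList_of_isRow (isAffine_C hn) (fun _ => ⟨?_, coroot_mem_translations_C hn⟩) ?_ ?_
  · exact (isCoord_C hn).exists_word (isAffine_C hn) (coordC_step_zero hn)
      (realizable_flipAt_C hn le_rfl (by omega))
  · simp only [List.forall_mem_cons, List.not_mem_nil, IsEmpty.forall_iff, implies_true, and_true]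
    exact ⟨isRow_one_C hn, isRow_last_C hn⟩
  · intro j hj hjr
    simp only [List.forall_mem_cons, List.not_mem_nil, IsEmpty.forall_iff, implies_true, and_true,
      ne_eq, Fin.ext_iff, val_ofNat le_rfl, val_ofNat (show 1 ≤ n by omega)] at hjr
    have hj0 : (j : ℕ) ≠ 0 := fun h => hj (Fin.ext h)
    have hjn := j.2
    have hj' : j = Fin.ofNat (n + 1) j := (Fin.ofNat_val_eq_self j).symm
    rw [hj', ← coordC_onesVec (by omega) (by omega)]
    refine (isCoord_C hn).not_good (isAffine_C hn) (coordC_levelZero hn) (by omega) (by omega) ?_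
      (((isCoord_C hn).realizable_swapAt (k := j) (by omega) (by omega)).comp
        (realizable_flipAt_C hn (k := j + 1) (by omega) (by omega))) ?_ ?_ ?_
    · rw [cartanC_apply, val_ofNat (by omega), val_ofNat (by omega)]
      split_ifs <;> omega
    all_goals
      simp only [flipAt, swapAt, onesVec]
      split_ifs <;> first | omega | rfl

end AffineFC

namespace AffineFC

variable {n : ℕ}

/-! ### Type D -/

/-- The state of type `D̃_n` with coordinates `x`. -/
def coordD (n : ℕ) (x : ℕ → ℝ) (i : Fin (n + 1)) : ℝ :=
  if (i : ℕ) = 0 then -x 1 - x 2 else if (i : ℕ) = n then x (n - 1) + x n else x i - x (i + 1)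

/-- The marks of `D̃_n`. -/
def marksD (n : ℕ) (i : Fin (n + 1)) : ℤ :=
  if (i : ℕ) ≤ 1 ∨ n - 1 ≤ (i : ℕ) then 1 else 2

/-- The coordinates of the coroots of `D̃_n`. -/
def corootD (n i : ℕ) : ℕ → ℤ := fun m =>
  if i = 0 then (if m = 1 ∨ m = 2 then -1 else 0)
  else if i = n then (if m = n - 1 ∨ m = n then 1 else 0)
  else if m = i then 1 else if m = i + 1 then -1 else 0

theorem cartanD_apply (i j : Fin (n + 1)) : cartanD n i j = if (i : ℕ) = j then 2 else
    -((if ((i : ℕ) = 0 ∧ (j : ℕ) = 2) ∨ ((i : ℕ) = 2 ∧ (j : ℕ) = 0) ∨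
      (1 ≤ (i : ℕ) ∧ (j : ℕ) = i + 1 ∧ (j : ℕ) < n) ∨
      (1 ≤ (j : ℕ) ∧ (i : ℕ) = j + 1 ∧ (i : ℕ) < n) ∨
      ((i : ℕ) + 2 = n ∧ (j : ℕ) = n) ∨ ((j : ℕ) + 2 = n ∧ (i : ℕ) = n) then 1 else 0 : ℕ) : ℤ) := by
  simp only [cartanD, cartanOf, Matrix.of_apply, Fin.ext_iff]

theorem cartanD_eq (hn : 4 ≤ n) (i j : Fin (n + 1)) :
    (cartanD n j i : ℝ) = coordD n (fun m => (corootD n i m : ℝ)) j := by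
  obtain ⟨i, hi⟩ := i
  obtain ⟨j, hj⟩ := j
  simp only [cartanD_apply, coordD, corootD]
  split_ifs <;> first | omega | (norm_num; done) | simp_all

theorem coordD_step (hn : 4 ≤ n) (i : Fin (n + 1)) (x y : ℕ → ℝ)
    (h : ∀ m, 1 ≤ m → m ≤ n → y m = x m - coordD n x i * corootD n i m) :
    step (cartanD n) i (coordD n x) = coordD n y := by
  funext j
  rw [step_apply, cartanD_eq hn]
  simp only [coordD]
  have hj := j.2
  split_ifs <;> (repeat rw [h _ (by omega) (by omega)]) <;> simp only [coordD] <;>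
    split_ifs <;> first | omega | ring

theorem coordD_levelZero (hn : 4 ≤ n) (x : ℕ → ℝ) : LevelZero (marksD n) (coordD n x) := by
  rw [LevelZero, pair_apply]
  refine sum_eq_zero_of_telescope _
    (fun k => if k = 0 then 0 else if n < k then 0 else if k = 1 then x 1 + x 2 else
      if k = n then x (n - 1) + x n else 2 * x k) (by simp)
    (by simp) fun j => ?_
  obtain ⟨j, hj⟩ := j
  simp only [coordD, marksD]
  split_ifs <;> first | omega | contradiction | (subst_vars; push_cast; ring)

theorem isAffine_D (hn : 4 ≤ n) : IsAffine (cartanD n) (marksD n) (fun _ => 1) where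
  diag i := by simp [cartanD, cartanOf]
  off i j h := by
    obtain ⟨i, hi⟩ := i
    obtain ⟨j, hj⟩ := j
    simp only [cartanD_apply, ne_eq, Fin.mk.injEq] at h ⊢
    split_ifs <;> first | omega | simp
  δ_pos i := by unfold marksD; split_ifs <;> norm_num
  δ_zero := by simp [marksD]
  δ_null i := by
    have h := coordD_levelZero hn fun m => (corootD n i m : ℝ)
    rw [LevelZero, pair_apply] at h
    simp_rw [← cartanD_eq hn] at h
    exact_mod_cast h
  ε_pos _ := one_pos
  symm i j := by
    simp only [cartanD_apply, one_mul]
    split_ifs <;> omega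
  dvd i := one_dvd _
  infinite i j h := by
    obtain ⟨i, hi⟩ := i
    obtain ⟨j, hj⟩ := j
    simp only [cartanD_apply, Fin.mk.injEq, ne_eq] at h ⊢
    split_ifs <;> omega
  nbr_zero := ⟨Fin.ofNat (n + 1) 2, ofNat_ne_zero (by omega) (by omega), by
    rw [cartanD_apply, val_ofNat (by omega), Fin.val_zero]
    split_ifs <;> omega⟩
  nbr i hi := by
    have := i.2
    refine ⟨Fin.ofNat (n + 1) (if (i : ℕ) = n then n - 2 else i - 1),
      ofNat_ne_zero (by split_ifs <;> omega) (by split_ifs <;> omega), ?_, ?_⟩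
    · rw [← Fin.val_fin_lt, val_ofNat (by split_ifs <;> omega)]
      split_ifs <;> omega
    · rw [cartanD_apply, val_ofNat (by split_ifs <;> omega)]
      split_ifs <;> omega

theorem isCoord_D (hn : 4 ≤ n) : IsCoord (cartanD n) (coordD n) where
  swap k x hk hkn := by
    refine coordD_step hn _ _ _ fun m _ _ => ?_
    simp only [coordD, corootD, swapAt, val_ofNat hkn.le]
    split_ifs <;> first | omega | (subst_vars; push_cast; ring)
  diff k x hk hkn := by
    simp only [coordD, val_ofNat hkn.le]
    rw [if_neg (by omega), if_neg (by omega)]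
  coroot i := ⟨_, funext fun j => cartanD_eq hn i j⟩

theorem coordD_step_last (hn : 4 ≤ n) (x : ℕ → ℝ) :
    step (cartanD n) (Fin.ofNat (n + 1) n) (coordD n x) = coordD n (negSwap (n - 1) n x) := by
  refine coordD_step hn _ _ _ fun m _ _ => ?_
  simp only [coordD, corootD, negSwap, val_ofNat le_rfl]
  split_ifs <;> first | omega | (subst_vars; push_cast; ring)

theorem coordD_step_zero (hn : 4 ≤ n) (x : ℕ → ℝ) :
    step (cartanD n) 0 (coordD n x) = coordD n (negSwap 1 2 x) := by
  refine coordD_step hn _ _ _ fun m _ _ => ?_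
  simp only [coordD, corootD, negSwap, Fin.val_zero, if_true]
  split_ifs <;> first | omega | (subst_vars; push_cast; ring)

theorem good_coordD (hn : 4 ≤ n) {x : ℕ → ℝ} (hx : IsMinuscule n x) :
    Good (isAffine_D hn).toIsCartan (coordD n x) := by
  refine good_of_invariant _ (fun g => ∃ x, IsMinuscule n x ∧ coordD n x = g) ?_ ?_ ⟨x, hx, rfl⟩
  · rintro _ ⟨x, hx, rfl⟩ i
    have hi : i = Fin.ofNat (n + 1) i := (Fin.ofNat_val_eq_self i).symm
    have hin := i.2
    by_cases h0 : (i : ℕ) = 0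
    · rw [hi, h0]
      exact ⟨_, hx.negSwap le_rfl (by omega) (by omega) (by omega), (coordD_step_zero hn x).symm⟩
    · by_cases h1 : (i : ℕ) = n
      · rw [hi, h1]
        exact ⟨_, hx.negSwap (by omega) (by omega) (by omega) le_rfl, (coordD_step_last hn x).symm⟩
      · rw [hi]
        exact ⟨_, hx.swapAt (by omega) (by omega),
          ((isCoord_D hn).swap i x (by omega) (by omega)).symm⟩
  · rintro _ ⟨x, hx, rfl⟩
    have key : ∀ a b : Fin (n + 1), ((a : ℕ) = 0 ∧ (b : ℕ) = 2) ∨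
        (1 ≤ (a : ℕ) ∧ (b : ℕ) = a + 1 ∧ (b : ℕ) < n) ∨ ((a : ℕ) + 2 = n ∧ (b : ℕ) = n) →
        coordD n x a < 0 → coordD n x b < 0 → False := by
      rintro ⟨a, ha⟩ ⟨b, hb⟩ hab h1 h2
      simp only [coordD] at hab h1 h2
      rcases hab with ⟨rfl, rfl⟩ | ⟨ha1, rfl, hbn⟩ | ⟨han, rfl⟩
      · rw [if_pos rfl] at h1
        rw [if_neg (by omega), if_neg (by omega)] at h2
        exact hx.not_chain (a := 1) (b := 2) (c := 3) (by omega) (by omega) (by omega)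
          (by omega) (by omega) (by omega) (by omega) (Or.inr rfl) (Or.inl rfl) (by linarith)
          (by linarith)
      · rw [if_neg (by omega), if_neg (by omega)] at h1 h2
        exact hx.not_chain (a := a) (b := a + 1) (c := a + 1 + 1) (by omega) (by omega) (by omega)
          (by omega) (by omega) (by omega) (by omega) (Or.inl rfl) (Or.inl rfl) (by linarith)
          (by linarith)
      -- The edge between n - 2 and n gives the signed chain x_{n-2} < x_{n-1} < -x_n.
      · rw [if_neg (by omega), if_neg (by omega)] at h1
        rw [if_neg (by omega), if_pos rfl] at h2
        rw [show b - 1 = a + 1 by omega] at h2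
        exact hx.not_chain (a := a) (b := a + 1) (c := b) (by omega) (by omega) (by omega)
          (by omega) (by omega) (by omega) (by omega) (Or.inl rfl) (Or.inr rfl) (by linarith)
          (by linarith)
    rintro a b hab hAab ⟨h1, h2⟩
    have hadj : ((a : ℕ) = 0 ∧ (b : ℕ) = 2) ∨ ((a : ℕ) = 2 ∧ (b : ℕ) = 0) ∨
        (1 ≤ (a : ℕ) ∧ (b : ℕ) = a + 1 ∧ (b : ℕ) < n) ∨
        (1 ≤ (b : ℕ) ∧ (a : ℕ) = b + 1 ∧ (a : ℕ) < n) ∨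
        ((a : ℕ) + 2 = n ∧ (b : ℕ) = n) ∨ ((b : ℕ) + 2 = n ∧ (a : ℕ) = n) := by
      by_contra hcon
      apply hAab
      rw [cartanD_apply, if_neg (fun h => hab (Fin.ext h)), if_neg hcon]
      rfl
    rcases hadj with h | h | h | h | h | h
    · exact key a b (Or.inl h) h1 h2
    · exact key b a (Or.inl h.symm) h2 h1
    · exact key a b (Or.inr (Or.inl h)) h1 h2
    · exact key b a (Or.inr (Or.inl h)) h2 h1
    · exact key a b (Or.inr (Or.inr h)) h1 h2
    · exact key b a (Or.inr (Or.inr h)) h2 h1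

theorem coordD_onesVec {j : ℕ} (hj : 1 ≤ j) (hjn : j + 2 ≤ n) :
    coordD n (onesVec j) = fcw (marksD n) (Fin.ofNat (n + 1) j) := by
  funext k
  simp only [coordD, onesVec, fcw, marksD, Fin.ext_iff, val_ofNat (show j ≤ n by omega),
    Fin.val_zero]
  have := k.2
  split_ifs <;> first | omega | norm_num

theorem coordD_signVec_empty (hn : 4 ≤ n) :
    coordD n (signVec fun _ => False) = (2 : ℝ) • fcw (marksD n) (Fin.ofNat (n + 1) n) := by
  funext k
  simp only [coordD, signVec, fcw, marksD, Fin.ext_iff, val_ofNat le_rfl, Fin.val_zero,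
    Pi.smul_apply, smul_eq_mul]
  have := k.2
  split_ifs <;> first | omega | (norm_num; done) | simp_all

theorem coordD_signVec_last (hn : 4 ≤ n) : coordD n (signVec fun m => m = n) =
    (2 : ℝ) • fcw (marksD n) (Fin.ofNat (n + 1) (n - 1)) := by
  funext k
  simp only [coordD, signVec, fcw, marksD, Fin.ext_iff, val_ofNat (Nat.sub_le n 1), Fin.val_zero,
    Pi.smul_apply, smul_eq_mul]
  have := k.2
  split_ifs <;> first | omega | norm_num

theorem coordD_congr (hn : 4 ≤ n) {x y : ℕ → ℝ} (h : ∀ m, 1 ≤ m → m ≤ n → x m = y m) :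
    coordD n x = coordD n y := by
  funext ⟨k, hk⟩
  simp only [coordD]
  split_ifs <;> (repeat rw [h _ (by omega) (by omega)])

theorem realizable_negSwap_D (hn : 4 ≤ n) {a b : ℕ} (ha : 1 ≤ a) (hab : a < b) (hbn : b ≤ n) :
    Realizable (cartanD n) (coordD n) (negSwap a b) :=
  (isCoord_D hn).realizable_negSwap ⟨[Fin.ofNat (n + 1) n], by
    simpa using (ofNat_ne_zero (by omega) le_rfl).symm, coordD_step_last hn⟩ ha hab hbn

theorem coroot_mem_translations_D (hn : 4 ≤ n)
    (h0 : coroot (cartanD n) 0 ∈ translations (isAffine_D hn)) (i : Fin (n + 1)) :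
    coroot (cartanD n) i ∈ translations (isAffine_D hn) := by
  have h2 : coroot (cartanD n) (Fin.ofNat (n + 1) 2) ∈ translations (isAffine_D hn) := by
    refine coroot_mem_translations_of_edge _ h0 ?_
    rw [cartanD_apply, val_ofNat (by omega), Fin.val_zero]
    split_ifs <;> omega
  have h1 : coroot (cartanD n) (Fin.ofNat (n + 1) 1) ∈ translations (isAffine_D hn) := by
    refine coroot_mem_translations_of_edge _ h2 ?_
    rw [cartanD_apply, val_ofNat (by omega), val_ofNat (by omega)]
    split_ifs <;> omega
  have hk : ∀ k, 2 ≤ k → k < n →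
      coroot (cartanD n) (Fin.ofNat (n + 1) k) ∈ translations (isAffine_D hn) := by
    intro k hk
    induction k, hk using Nat.le_induction with
    | base => exact fun _ => h2
    | succ k hk ih =>
      intro hkn
      refine coroot_mem_translations_of_edge _ (ih (by omega)) ?_
      rw [cartanD_apply, val_ofNat hkn.le, val_ofNat (by omega)]
      split_ifs <;> omega
  have hi : i = Fin.ofNat (n + 1) i := (Fin.ofNat_val_eq_self i).symm
  have hin := i.2
  rcases Nat.lt_or_ge (i : ℕ) 2 with h | h
  · interval_cases h3 : (i : ℕ)
    · rw [hi]; exact h0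
    · rw [hi]; exact h1
  · rcases Nat.lt_or_ge (i : ℕ) n with h' | h'
    · rw [hi]; exact hk i h h'
    · refine coroot_mem_translations_of_edge _ (hk (n - 2) (by omega) (by omega)) ?_
      rw [cartanD_apply, val_ofNat (by omega)]
      split_ifs <;> omega

theorem moves_signVec_D (hn : 4 ≤ n) {P Q : ℕ → Prop} [DecidablePred P] [DecidablePred Q] {k : ℕ}
    (hk : 1 ≤ k) (hkn : k < n) (h1 : P k) (h2 : ¬ P (k + 1))
    (hQ : ∀ m, 1 ≤ m → m ≤ n → (Q m ↔ m ≠ k ∧ (m = k + 1 ∨ P m))) :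
    Moves (cartanD n) (coordD n (signVec P)) [Fin.ofNat (n + 1) k] (coordD n (signVec Q)) := by
  refine Moves.single ?_ ?_
  · rw [(isCoord_D hn).diff k _ hk hkn, signVec, signVec, if_pos h1, if_neg h2]
    norm_num
  · rw [(isCoord_D hn).swap k _ hk hkn]
    refine coordD_congr hn fun m hm hmn => ?_
    simp only [swapAt, signVec, hQ m hm hmn]
    split_ifs <;> first | rfl | (exfalso; simp_all)

/-- The letter n annihilates the two particles at n - 1 and n. -/
theorem moves_signVec_last_D (hn : 4 ≤ n) {P Q : ℕ → Prop} [DecidablePred P] [DecidablePred Q]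
    (h1 : P (n - 1)) (h2 : P n)
    (hQ : ∀ m, 1 ≤ m → m ≤ n → (Q m ↔ m ≠ n - 1 ∧ m ≠ n ∧ P m)) :
    Moves (cartanD n) (coordD n (signVec P)) [Fin.ofNat (n + 1) n] (coordD n (signVec Q)) := by
  refine Moves.single ?_ ?_
  · simp only [coordD, val_ofNat le_rfl, signVec, if_pos h1, if_pos h2,
      if_neg (show ¬ n = 0 by omega), if_true]
    norm_num
  · rw [coordD_step_last hn]
    refine coordD_congr hn fun m hm hmn => ?_
    simp only [negSwap, signVec, hQ m hm hmn, if_pos h1, if_pos h2]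
    split_ifs <;> first | rfl | (norm_num; done) | (exfalso; simp_all)

theorem moves_signVec_zero_D (hn : 4 ≤ n) {P Q : ℕ → Prop} [DecidablePred P] [DecidablePred Q]
    (h1 : ¬ P 1) (h2 : ¬ P 2) (hQ : ∀ m, 1 ≤ m → m ≤ n → (Q m ↔ m = 1 ∨ m = 2 ∨ P m)) :
    Moves (cartanD n) (coordD n (signVec P)) [0] (coordD n (signVec Q)) := by
  refine Moves.single ?_ ?_
  · simp only [coordD, Fin.val_zero, if_true, signVec, if_neg h1, if_neg h2]
    norm_num
  · rw [coordD_step_zero hn]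
    refine coordD_congr hn fun m hm hmn => ?_
    simp only [negSwap, signVec, hQ m hm hmn, if_neg h1, if_neg h2]
    split_ifs <;> first | rfl | (exfalso; simp_all)

theorem isRow_one_D (hn : 4 ≤ n) :
    IsRow (isAffine_D hn) (toWord n ([2, 0, 1] ++ up 2 n ++ down (n - 2) 3))
      (Fin.ofNat (n + 1) 1) := by
  have hf := isCoord_D hn
  have h1 : coordD n (unitVec 1 1) = (1 : ℝ) • fcw (marksD n) (Fin.ofNat (n + 1) 1) := by
    rw [one_smul, ← coordD_onesVec le_rfl (by omega)]
    refine coordD_congr hn fun m hm hmn => ?_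
    simp only [unitVec, onesVec]
    split_ifs <;> first | rfl | omega
  have hdown : ∀ k, 1 ≤ k → k < n → Moves (cartanD n) (coordD n (unitVec (k + 1) 1))
      [Fin.ofNat (n + 1) k] (coordD n (unitVec k 1)) := fun k hk hkn =>
    hf.moves hk hkn (by simp [unitVec]) (swapAt_unitVec_succ k 1)
  have hup : ∀ k, 1 ≤ k → k < n → Moves (cartanD n) (coordD n (unitVec k (-1)))
      [Fin.ofNat (n + 1) k] (coordD n (unitVec (k + 1) (-1))) := fun k hk hkn =>
    hf.moves hk hkn (by simp [unitVec]) (swapAt_unitVec k (-1))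
  have h2 := hdown 2 (by omega) (by omega)
  have h3 : Moves (cartanD n) (coordD n (unitVec 2 1)) [0] (coordD n (unitVec 1 (-1))) := by
    refine Moves.single ?_ ?_
    · simp [coordD, unitVec]
    · rw [coordD_step_zero hn]
      refine coordD_congr hn fun m hm hmn => ?_
      simp only [negSwap, unitVec]
      split_ifs <;> first | omega | simp
  have h4 : Moves (cartanD n) (coordD n (unitVec 2 (-1))) (toWord n (up 2 n))
      (coordD n (unitVec (n - 1) 1)) := by
    have := Moves.up (A := cartanD n) (a := 2) (b := n)
      -- The letter n sends -e_n to e_{n-1}, so the descent that follows begins with n - 2.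
      (g := fun k => coordD n (if k = n + 1 then unitVec (n - 1) 1 else unitVec k (-1)))
      (by omega) fun k hk hkn => by
        simp only [if_neg (show ¬ k = n + 1 by omega)]
        split_ifs with h
        · obtain rfl : k = n := by omega
          refine Moves.single ?_ ?_
          · simp only [coordD, val_ofNat le_rfl, if_neg (show ¬ k = 0 by omega), unitVec, if_true,
              if_neg (show ¬ k - 1 = k by omega)]
            norm_num
          · rw [coordD_step_last hn]
            refine coordD_congr hn fun m hm hmn => ?_
            simp only [negSwap, unitVec]
            split_ifs <;> first | omega | norm_num
        · exact hup k (by omega) (by omega)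
    simpa only [if_true, if_neg (show ¬ 2 = n + 1 by omega)] using this
  have h5 := Moves.down (A := cartanD n) (a := n - 2) (b := 3)
    (g := fun k => coordD n (unitVec k 1)) (by omega) fun k hk hkn =>
      hdown k (by omega) (by omega)
  simp only [show n - 2 + 1 = n - 1 by omega] at h5
  refine isRow_of_moves (isAffine_D hn) (ofNat_ne_zero le_rfl (by omega)) (by simp [toWord])
    one_pos (d := coordD n (unitVec 3 1)) ?_ ?_ [Fin.ofNat (n + 1) 2, Fin.ofNat (n + 1) 1] ?_
  · rw [← h1]
    exact good_coordD hn (isMinuscule_unitVec n 1)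
  · rw [toWord_append, toWord_append]
    exact ((h2.cons (h3.cons (hup 1 le_rfl (by omega)))).append h4).append h5
  · rw [← h1]
    exact (h2.cons (hdown 1 le_rfl (by omega))).2

theorem isRow_pred_D (hn : 4 ≤ n) : IsRow (isAffine_D hn)
    (toWord n ([2, 0] ++ up 3 (n - 1) ++ [2, 1] ++ up 3 (n - 2) ++ [n]))
      (Fin.ofNat (n + 1) (n - 1)) := by
  refine isRow_of_moves (isAffine_D hn) (ofNat_ne_zero (by omega) (by omega)) (by simp [toWord])
    two_pos (d := coordD n (signVec fun m => m = 2)) ?_ ?_ (toWord n (up 2 (n - 1))) ?_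
  · rw [← coordD_signVec_last hn]
    exact good_coordD hn (isMinuscule_signVec n _)
  -- One particle starts at 2; two are created behind it by the letter 0, the leading two travel to
  -- n and n - 1 and annihilate there, and one is left at 2.
  · have m1 : Moves (cartanD n) (coordD n (signVec fun m => m = 2)) [Fin.ofNat (n + 1) 2]
        (coordD n (signVec fun m => m = 3)) :=
      moves_signVec_D hn (by omega) (by omega) (by omega) (by omega) (by omega)
    have m2 : Moves (cartanD n) (coordD n (signVec fun m => m = 3)) [0]
        (coordD n (signVec fun m => m = 1 ∨ m = 2 ∨ m = 3)) :=
      moves_signVec_zero_D hn (by omega) (by omega) (by omega)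
    have m3 := Moves.up (A := cartanD n) (a := 3) (b := n - 1)
      (g := fun k => coordD n (signVec fun m => m = 1 ∨ m = 2 ∨ m = k)) (by omega)
      fun k hk hkn =>
        moves_signVec_D hn (by omega) (by omega) (by omega) (by omega) (by omega)
    rw [Nat.sub_add_cancel (show 1 ≤ n by omega)] at m3
    have m4 : Moves (cartanD n) (coordD n (signVec fun m => m = 1 ∨ m = 2 ∨ m = n))
        [Fin.ofNat (n + 1) 2] (coordD n (signVec fun m => m = 1 ∨ m = 3 ∨ m = n)) :=
      moves_signVec_D hn (by omega) (by omega) (by omega) (by omega) (by omega)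
    have m5 : Moves (cartanD n) (coordD n (signVec fun m => m = 1 ∨ m = 3 ∨ m = n))
        [Fin.ofNat (n + 1) 1] (coordD n (signVec fun m => m = 2 ∨ m = 3 ∨ m = n)) :=
      moves_signVec_D hn (by omega) (by omega) (by omega) (by omega) (by omega)
    have m6 := Moves.up (A := cartanD n) (a := 3) (b := n - 2)
      (g := fun k => coordD n (signVec fun m => m = 2 ∨ m = k ∨ m = n)) (by omega)
      fun k hk hkn =>
        moves_signVec_D hn (by omega) (by omega) (by omega) (by omega) (by omega)
    rw [show n - 2 + 1 = n - 1 by omega] at m6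
    have m7 : Moves (cartanD n) (coordD n (signVec fun m => m = 2 ∨ m = n - 1 ∨ m = n))
        [Fin.ofNat (n + 1) n] (coordD n (signVec fun m => m = 2)) :=
      moves_signVec_last_D hn (by omega) (by omega) (by omega)
    simp only [toWord_append]
    exact ((((m1.cons m2).append m3).append (m4.cons m5)).append m6).append m7
  · rw [← coordD_signVec_last hn]
    have m := Moves.up (A := cartanD n) (a := 2) (b := n - 1)
      (g := fun k => coordD n (signVec fun m => m = k)) (by omega) fun k hk hkn =>
        moves_signVec_D hn (by omega) (by omega) (by omega) (by omega) (by omega)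
    rw [Nat.sub_add_cancel (show 1 ≤ n by omega)] at m
    exact m.2

theorem isRow_last_D (hn : 4 ≤ n) : IsRow (isAffine_D hn)
    (toWord n ([2, 1] ++ up 3 (n - 1) ++ [2, 0] ++ up 3 (n - 2) ++ [n])) (Fin.ofNat (n + 1) n) := by
  refine isRow_of_moves (isAffine_D hn) (ofNat_ne_zero (by omega) (by omega)) (by simp [toWord])
    two_pos (d := coordD n (signVec fun m => m = 1 ∨ m = 2)) ?_ ?_ [0] ?_
  · rw [← coordD_signVec_empty hn]
    exact good_coordD hn (isMinuscule_signVec n _)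
  -- Here two particles start at 1 and 2. The leading one goes to n, the letter 0 creates a new pair
  -- once the other has reached 3, and the two oldest annihilate at n - 1 and n.
  · have m1 : Moves (cartanD n) (coordD n (signVec fun m => m = 1 ∨ m = 2)) [Fin.ofNat (n + 1) 2]
        (coordD n (signVec fun m => m = 1 ∨ m = 3)) :=
      moves_signVec_D hn (by omega) (by omega) (by omega) (by omega) (by omega)
    have m2 : Moves (cartanD n) (coordD n (signVec fun m => m = 1 ∨ m = 3)) [Fin.ofNat (n + 1) 1]
        (coordD n (signVec fun m => m = 2 ∨ m = 3)) :=
      moves_signVec_D hn (by omega) (by omega) (by omega) (by omega) (by omega)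
    have m3 := Moves.up (A := cartanD n) (a := 3) (b := n - 1)
      (g := fun k => coordD n (signVec fun m => m = 2 ∨ m = k)) (by omega)
      fun k hk hkn =>
        moves_signVec_D hn (by omega) (by omega) (by omega) (by omega) (by omega)
    rw [Nat.sub_add_cancel (show 1 ≤ n by omega)] at m3
    have m4 : Moves (cartanD n) (coordD n (signVec fun m => m = 2 ∨ m = n))
        [Fin.ofNat (n + 1) 2] (coordD n (signVec fun m => m = 3 ∨ m = n)) :=
      moves_signVec_D hn (by omega) (by omega) (by omega) (by omega) (by omega)
    have m5 : Moves (cartanD n) (coordD n (signVec fun m => m = 3 ∨ m = n)) [0]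
        (coordD n (signVec fun m => m = 1 ∨ m = 2 ∨ m = 3 ∨ m = n)) :=
      moves_signVec_zero_D hn (by omega) (by omega) (by omega)
    have m6 := Moves.up (A := cartanD n) (a := 3) (b := n - 2)
      (g := fun k => coordD n (signVec fun m => m = 1 ∨ m = 2 ∨ m = k ∨ m = n)) (by omega)
      fun k hk hkn =>
        moves_signVec_D hn (by omega) (by omega) (by omega) (by omega) (by omega)
    rw [show n - 2 + 1 = n - 1 by omega] at m6
    have m7 : Moves (cartanD n) (coordD n (signVec fun m => m = 1 ∨ m = 2 ∨ m = n - 1 ∨ m = n))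
        [Fin.ofNat (n + 1) n] (coordD n (signVec fun m => m = 1 ∨ m = 2)) :=
      moves_signVec_last_D hn (by omega) (by omega) (by omega)
    simp only [toWord_append]
    exact ((((m1.cons m2).append m3).append (m4.cons m5)).append m6).append m7
  · rw [← coordD_signVec_empty hn]
    refine (coordD_step_zero hn _).trans (coordD_congr hn fun m hm hmn => ?_)
    simp only [negSwap, signVec]
    split_ifs <;> first | omega | (norm_num; done) | simp_all

theorem isFullList_D (hn : 4 ≤ n) : IsFullList (cartanD n)
    [([2, 0, 1] ++ up 2 n ++ down (n - 2) 3, 1),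
      ([2, 0] ++ up 3 (n - 1) ++ [2, 1] ++ up 3 (n - 2) ++ [n], n - 1),
      ([2, 1] ++ up 3 (n - 1) ++ [2, 0] ++ up 3 (n - 2) ++ [n], n)] := by
  refine isFullList_of_isRow (isAffine_D hn) (fun _ => ⟨?_, coroot_mem_translations_D hn⟩) ?_ ?_
  · exact (isCoord_D hn).exists_word (isAffine_D hn) (coordD_step_zero hn)
      (realizable_negSwap_D hn le_rfl (by omega) (by omega))
  · simp only [List.forall_mem_cons, List.not_mem_nil, IsEmpty.forall_iff, implies_true, and_true]
    exact ⟨isRow_one_D hn, isRow_pred_D hn, isRow_last_D hn⟩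
  · intro j hj hjr
    simp only [List.forall_mem_cons, List.not_mem_nil, IsEmpty.forall_iff, implies_true, and_true,
      ne_eq, Fin.ext_iff, val_ofNat le_rfl, val_ofNat (show 1 ≤ n by omega),
      val_ofNat (Nat.sub_le n 1)] at hjr
    have hj0 : (j : ℕ) ≠ 0 := fun h => hj (Fin.ext h)
    have hjn := j.2
    have hj' : j = Fin.ofNat (n + 1) j := (Fin.ofNat_val_eq_self j).symm
    rw [hj', ← coordD_onesVec (by omega) (by omega)]
    -- The signed exchange of the coordinates j and j + 1 of the vector of j ones yields 0 at j and
    -- -1 at j + 1.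
    refine (isCoord_D hn).not_good (isAffine_D hn) (coordD_levelZero hn) (by omega) (by omega) ?_
      (realizable_negSwap_D hn (a := j) (b := j + 1) (by omega) (by omega) (by omega)) ?_ ?_ ?_
    · rw [cartanD_apply, val_ofNat (by omega), val_ofNat (by omega)]
      split_ifs <;> omega
    all_goals
      simp only [negSwap, onesVec]
      split_ifs <;> first | omega | simp

end AffineFC

namespace AffineFC

variable {n : ℕ}

/-! ### Type A -/

/-- The state of type `Ã_n` with cyclic coordinates `x`. -/
def coordA (x : Fin (n + 1) → ℝ) (i : Fin (n + 1)) : ℝ := x i - x (i + 1)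

theorem cartanA_apply (i j : Fin (n + 1)) : cartanA n i j =
    if i = j then 2 else -((if j = i + 1 then 1 else 0) + (if i = j + 1 then 1 else 0)) := by
  have h : ∀ i j : Fin (n + 1), (j : ℕ) = (i + 1) % (n + 1) ↔ j = i + 1 := fun i j => by
    rw [Fin.ext_iff, Fin.val_add, Fin.val_one', Nat.add_mod_mod]
  simp only [cartanA, cartanOf, Matrix.of_apply, h]
  push_cast
  rfl

theorem cartanA_symm (i j : Fin (n + 1)) : cartanA n i j = cartanA n j i := by
  rw [cartanA_apply, cartanA_apply, add_comm (if j = i + 1 then (1 : ℤ) else 0)]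
  simp only [eq_comm (a := i) (b := j)]

theorem succ_ne_self (hn : 1 ≤ n) (i : Fin (n + 1)) : i + 1 ≠ i := by
  intro h
  have h1 : (1 : Fin (n + 1)) = 0 := by simpa using h
  have := congrArg Fin.val h1
  rw [Fin.val_one', Fin.val_zero, Nat.mod_eq_of_lt (by omega)] at this
  omega

/-- The transposition of the cyclic coordinates `i` and `i + 1`. -/
def cyclicSwap (i : Fin (n + 1)) (x : Fin (n + 1) → ℝ) : Fin (n + 1) → ℝ :=
  fun m => if m = i then x (i + 1) else if m = i + 1 then x i else x m

theorem coordA_step (hn : 1 ≤ n) (i : Fin (n + 1)) (x : Fin (n + 1) → ℝ) :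
    step (cartanA n) i (coordA x) = coordA (cyclicSwap i x) := by
  funext j
  rw [step_apply, cartanA_apply]
  simp only [coordA, cyclicSwap, add_left_inj]
  by_cases h : j = i
  · subst h
    simp only [if_true, if_neg (succ_ne_self hn j)]
    push_cast
    ring
  · simp only [if_neg h]
    -- Both equations hold exactly for n = 1, where the two neighbours of i coincide.
    by_cases h1 : j = i + 1 <;> by_cases h2 : i = j + 1
    · simp only [if_pos h1, if_pos h2, if_pos h2.symm]
      rw [← h2, ← h1]
      push_cast
      ring
    · simp only [if_pos h1, if_neg h2, if_neg (Ne.symm h2)]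
      rw [← h1]
      push_cast
      ring
    · simp only [if_neg h1, if_pos h2, if_pos h2.symm]
      rw [← h2]
      push_cast
      ring
    · simp only [if_neg h1, if_neg h2, if_neg (Ne.symm h2)]
      push_cast
      ring

theorem coordA_levelZero (x : Fin (n + 1) → ℝ) : LevelZero (fun _ => 1) (coordA x) := by
  rw [LevelZero, pair_apply]
  simp only [coordA, Int.cast_one, mul_one, Finset.sum_sub_distrib]
  rw [sub_eq_zero]
  exact (Equiv.sum_comp (Equiv.addRight (1 : Fin (n + 1))) x).symm

theorem coroot_cartanA (hn : 1 ≤ n) (i : Fin (n + 1)) :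
    coroot (cartanA n) i = coordA fun m => if m = i then 1 else if m = i + 1 then -1 else 0 := by
  funext j
  rw [coroot, cartanA_apply]
  simp only [coordA, add_left_inj]
  by_cases h : j = i
  · subst h
    simp only [if_true, if_neg (succ_ne_self hn j)]
    norm_num
  · simp only [if_neg h]
    by_cases h1 : j = i + 1 <;> by_cases h2 : i = j + 1
    · rw [if_pos h1, if_pos h1, if_pos h2, if_pos h2.symm]; norm_num
    · rw [if_pos h1, if_pos h1, if_neg h2, if_neg (Ne.symm h2)]; norm_num
    · rw [if_neg h1, if_neg h1, if_pos h2, if_pos h2.symm]; norm_num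
    · rw [if_neg h1, if_neg h1, if_neg h2, if_neg (Ne.symm h2)]; norm_num

theorem isAffine_A (hn : 1 ≤ n) : IsAffine (cartanA n) (fun _ => 1) (fun _ => 1) where
  diag i := by rw [cartanA_apply, if_pos rfl]
  off i j h := by
    rw [cartanA_symm j i, cartanA_apply, if_neg h]
    split_ifs <;> simp
  δ_pos _ := one_pos
  δ_zero := rfl
  δ_null i := by
    have h := coordA_levelZero fun m : Fin (n + 1) => if m = i then 1 else if m = i + 1 then -1 else 0
    rw [← coroot_cartanA hn, LevelZero, pair_apply] at h
    simp only [coroot] at h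
    exact_mod_cast h
  ε_pos _ := one_pos
  symm i j := by rw [cartanA_symm]
  dvd i := one_dvd _
  infinite i j h h4 k := by
    rw [cartanA_symm j i, cartanA_apply, if_neg h] at h4
    -- The product is 4 only if both edges are present, so 2 = 0 modulo n + 1 and there are just two
    -- nodes.
    have h1 : j = i + 1 ∧ i = j + 1 := by
      constructor <;> by_contra h5 <;> simp only [if_neg h5] at h4 <;> split_ifs at h4 <;>
        norm_num at h4
    have h2 : ((1 + 1 : Fin (n + 1)) : ℕ) = 0 := by
      have h6 : i + (1 + 1) = i := by rw [← add_assoc, ← h1.1, ← h1.2]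
      rw [add_eq_left.1 h6]
      rfl
    rw [Fin.val_add, Fin.val_one', Nat.mod_eq_of_lt (show 1 < n + 1 by omega)] at h2
    have h3 : n + 1 ≤ 2 := Nat.le_of_dvd (by norm_num) (Nat.dvd_of_mod_eq_zero h2)
    have := i.2
    have := j.2
    have := k.2
    rw [Ne, Fin.ext_iff] at h
    rw [Fin.ext_iff, Fin.ext_iff]
    omega
  nbr_zero := ⟨1, fun h => succ_ne_self hn 0 (by rw [zero_add]; exact h), by
    rw [cartanA_apply, if_neg (fun h => succ_ne_self hn 0 (by rw [zero_add]; exact h))]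
    simp only [zero_add, if_true]
    split_ifs <;> norm_num⟩
  nbr i hi := by
    have hi0 : i ≠ 0 := by
      rintro rfl
      rw [Fin.val_zero] at hi
      omega
    have h1 := Fin.val_sub_one_of_ne_zero hi0
    refine ⟨i - 1, ?_, ?_, ?_⟩
    · intro h
      rw [h, Fin.val_zero] at h1
      omega
    · rw [← Fin.val_fin_lt, h1]
      omega
    · rw [cartanA_apply, if_neg (fun h => by rw [h] at h1; omega)]
      simp only [sub_add_cancel, if_true]
      split_ifs <;> norm_num

/-- Reflections permute the cyclic coordinates, and values 0 and 1 leave no room for three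
consecutive strictly increasing coordinates. -/
theorem good_coordA (hn : 1 ≤ n) {x : Fin (n + 1) → ℝ} (hx : ∀ i, x i = 0 ∨ x i = 1) :
    Good (isAffine_A hn).toIsCartan (coordA x) := by
  refine good_of_invariant _ (fun g => ∃ x, (∀ i, x i = 0 ∨ x i = 1) ∧ coordA x = g) ?_ ?_
    ⟨x, hx, rfl⟩
  · rintro _ ⟨x, hx, rfl⟩ i
    refine ⟨_, fun m => ?_, (coordA_step hn i x).symm⟩
    unfold cyclicSwap
    split_ifs <;> exact hx _
  · rintro _ ⟨x, hx, rfl⟩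
    have key : ∀ a, coordA x a < 0 → coordA x (a + 1) < 0 → False := by
      intro a h1 h2
      simp only [coordA] at h1 h2
      rcases hx a with h3 | h3 <;> rcases hx (a + 1 + 1) with h4 | h4 <;>
        rcases hx (a + 1) with h5 | h5 <;> linarith
    rintro a b hab hAab ⟨h1, h2⟩
    rw [cartanA_apply, if_neg hab] at hAab
    by_cases h3 : b = a + 1
    · exact key a h1 (h3 ▸ h2)
    · by_cases h4 : a = b + 1
      · exact key b h2 (h4 ▸ h1)
      · simp [h3, h4] at hAab

/-- The orientation of the cycle given by a Coxeter word. -/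
def orientation (c : List (Fin (n + 1))) (i : Fin (n + 1)) : ℝ :=
  if c.idxOf (i - 1) < c.idxOf i then 1 else 0

theorem orientation_cases (c : List (Fin (n + 1))) (i : Fin (n + 1)) :
    orientation c i = 0 ∨ orientation c i = 1 := by
  unfold orientation
  split_ifs <;> simp

theorem IsCoxeterWord.mem {c : List (Fin (n + 1))} (hc : IsCoxeterWord c) (i : Fin (n + 1)) :
    i ∈ c :=
  hc.mem_iff.2 (List.mem_finRange i)

/-- The first letter a precedes both neighbours, so the coordinates at a and a + 1 are 0 and 1.
Firing exchanges them, which is the effect of moving a to the end of the word. -/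
theorem IsCoxeterWord.moves_cons (hn : 1 ≤ n) {a : Fin (n + 1)} {l : List (Fin (n + 1))}
    (hc : IsCoxeterWord (a :: l)) : Moves (cartanA n) (coordA (orientation (a :: l))) [a]
      (coordA (orientation (l ++ [a]))) := by
  have hnd : (a :: l).Nodup := hc.nodup_iff.2 (List.nodup_finRange _)
  have hal : a ∉ l := (List.nodup_cons.1 hnd).1
  have hmem : ∀ i, i ≠ a → i ∈ l := fun i hi => (List.mem_cons.1 (hc.mem i)).resolve_left hi
  have h1 : ∀ i, i ≠ a → (a :: l).idxOf i = l.idxOf i + 1 := fun i hi =>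
    List.idxOf_cons_ne _ hi.symm
  have h2 : ∀ i, i ≠ a → (l ++ [a]).idxOf i = l.idxOf i := fun i hi =>
    List.idxOf_append_of_mem (hmem i hi)
  have h3 : (l ++ [a]).idxOf a = l.length := by
    rw [List.idxOf_append_of_notMem hal]; simp
  have h4 : ∀ i, i ≠ a → l.idxOf i < l.length := fun i hi => List.idxOf_lt_length_iff.2 (hmem i hi)
  have ha1 := succ_ne_self hn a
  have ha2 : a - 1 ≠ a := fun h => succ_ne_self hn (a - 1) (by rw [sub_add_cancel]; exact h.symm)
  have e1 : orientation (a :: l) a = 0 := by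
    rw [orientation, List.idxOf_cons_self, if_neg (Nat.not_lt_zero _)]
  have e2 : orientation (a :: l) (a + 1) = 1 := by
    rw [orientation, add_sub_cancel_right, List.idxOf_cons_self, h1 _ ha1,
      if_pos (Nat.succ_pos _)]
  refine Moves.single ?_ ?_
  · rw [coordA, e1, e2]; norm_num
  · rw [coordA_step hn]
    congr 1
    funext m
    rw [cyclicSwap]
    split_ifs with h5 h6
    · rw [e2, h5, orientation, h3, h2 _ ha2, if_pos (h4 _ ha2)]
    · rw [e1, h6, orientation, add_sub_cancel_right, h3, h2 _ ha1, if_neg (h4 _ ha1).not_gt]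
    · have h7 : m - 1 ≠ a := fun h => h6 (by rw [← h, sub_add_cancel])
      rw [orientation, orientation, h1 _ h7, h1 _ h5, h2 _ h7, h2 _ h5]
      simp only [Nat.add_lt_add_iff_right]

theorem IsCoxeterWord.moves_append (hn : 1 ≤ n) {l l' : List (Fin (n + 1))}
    (hc : IsCoxeterWord (l ++ l')) : Moves (cartanA n) (coordA (orientation (l ++ l'))) l
      (coordA (orientation (l' ++ l))) := by
  induction l generalizing l' with
  | nil => rw [List.nil_append, List.append_nil]; exact ⟨trivial, rfl⟩
  | cons a l ih =>
    have h1 : Moves (cartanA n) (coordA (orientation (a :: l ++ l'))) [a]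
        (coordA (orientation (l ++ l' ++ [a]))) := IsCoxeterWord.moves_cons hn hc
    have h2 : IsCoxeterWord (l ++ (l' ++ [a])) :=
      List.Perm.trans (by
        rw [← List.append_assoc]
        exact List.perm_append_singleton a (l ++ l')) hc
    have h3 := ih h2
    rw [List.append_assoc, List.singleton_append] at h3
    rw [List.append_assoc] at h1
    exact h1.cons h3

theorem IsCoxeterWord.ne_nil {c : List (Fin (n + 1))} (hc : IsCoxeterWord c) : c ≠ [] :=
  List.ne_nil_of_mem (hc.mem 0)

theorem IsCoxeterWord.infNeg (hn : 1 ≤ n) {c : List (Fin (n + 1))} (hc : IsCoxeterWord c) :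
    InfNeg (cartanA n) (coordA (orientation c)) (infWord [] c) := by
  have h := IsCoxeterWord.moves_append hn (l := c) (l' := []) (by rwa [List.append_nil])
  rw [List.append_nil, List.nil_append] at h
  exact infNeg_infWord_nil hc.ne_nil h.1 h.2

theorem isInfFC_coxeter_A (hn : 1 ≤ n) {c : List (Fin (n + 1))} (hc : IsCoxeterWord c) :
    IsInfFC (cartanA n) (infWord [] c) :=
  (IsCoxeterWord.infNeg hn hc).isInfFC (good_coordA hn (orientation_cases c))

/-- A list of all nodes in the order of an injective rank function. -/
theorem exists_isCoxeterWord_rank {r : Fin (n + 1) → ℤ} (hr : Function.Injective r) :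
    ∃ c : List (Fin (n + 1)), IsCoxeterWord c ∧
      ∀ a b, c.idxOf a < c.idxOf b ↔ r a < r b := by
  let c := (List.finRange (n + 1)).insertionSort fun a b => r a ≤ r b
  have hc : IsCoxeterWord c := List.perm_insertionSort _ _
  have : Std.Total fun a b => r a ≤ r b := ⟨fun a b => le_total _ _⟩
  have : IsTrans _ fun a b => r a ≤ r b := ⟨fun a b c => le_trans⟩
  have hs : c.Pairwise fun a b => r a ≤ r b := List.pairwise_insertionSort _ _
  have key : ∀ a b, c.idxOf a < c.idxOf b → r a ≤ r b := by
    intro a b h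
    have ha := List.idxOf_lt_length_iff.2 (hc.mem a)
    have hb := List.idxOf_lt_length_iff.2 (hc.mem b)
    have := List.pairwise_iff_getElem.1 hs _ _ ha hb h
    simpa using this
  refine ⟨c, hc, fun a b => ⟨fun h => lt_of_le_of_ne (key a b h) fun h' => ?_, fun h => ?_⟩⟩
  · rw [hr h'] at h
    exact lt_irrefl _ h
  · rcases lt_trichotomy (c.idxOf a) (c.idxOf b) with h1 | h1 | h1
    · exact h1
    · rw [(List.idxOf_inj (hc.mem a)).1 h1] at h
      exact absurd h (lt_irrefl _)
    · exact absurd h (key b a h1).not_gt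

/-- Every acyclic orientation of the cycle is given by a Coxeter word. -/
theorem exists_orientation_eq (hn : 1 ≤ n) {x : Fin (n + 1) → ℝ} (hx : ∀ i, x i = 0 ∨ x i = 1)
    {p : Fin (n + 1)} (hp : x (p - 1) ≠ x p) :
    ∃ c : List (Fin (n + 1)), IsCoxeterWord c ∧ orientation c = x := by
  classical
  -- The rank is the cyclic distance from p with the sign prescribed by x. Away from p it grows in
  -- absolute value, so its sign decides the comparison of i - 1 with i; across p the comparison is
  -- right because x changes there.
  let r : Fin (n + 1) → ℤ := fun i => if x i = 1 then ((i - p : Fin (n + 1)) : ℕ)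
    else -(((i - p : Fin (n + 1)) : ℕ) : ℤ)
  have habs : ∀ i, (r i).natAbs = ((i - p : Fin (n + 1)) : ℕ) := by
    intro i
    simp only [r]
    split_ifs <;> simp
  have hr : Function.Injective r := by
    intro a b h
    have h1 := congrArg Int.natAbs h
    rw [habs, habs, ← Fin.ext_iff] at h1
    exact sub_left_injective h1
  obtain ⟨c, hc, hcr⟩ := exists_isCoxeterWord_rank hr
  refine ⟨c, hc, funext fun i => ?_⟩
  have key : r (i - 1) < r i ↔ x i = 1 := by
    by_cases hi : i = p
    · subst hi
      have h1 : ((i - 1 - i : Fin (n + 1)) : ℕ) = n := by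
        rw [sub_right_comm, sub_self, zero_sub, Fin.coe_neg_one]
      simp only [r, h1, sub_self, Fin.val_zero]
      rcases hx i with h2 | h2 <;> rcases hx (i - 1) with h3 | h3 <;> rw [h2, h3] at hp ⊢ <;>
        (simp at hp ⊢; try omega)
    · have h1 : ((i - 1 - p : Fin (n + 1)) : ℕ) = ((i - p : Fin (n + 1)) : ℕ) - 1 := by
        rw [sub_right_comm, Fin.val_sub_one_of_ne_zero (sub_ne_zero.2 hi)]
      have h2 : ((i - p : Fin (n + 1)) : ℕ) ≠ 0 := fun h => sub_ne_zero.2 hi (Fin.ext h)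
      have h3 := habs (i - 1)
      rw [h1] at h3
      constructor
      · intro h
        by_contra h4
        simp only [r, if_neg h4] at h
        simp only [r] at h3
        omega
      · intro h
        simp only [r, if_pos h]
        simp only [r] at h3
        omega
  rw [orientation]
  simp only [hcr, key]
  rcases hx i with h | h <;> simp [h]

theorem fcw_eq_coordA {j : Fin (n + 1)} (hj : j ≠ 0) : fcw (fun _ => 1) j =
    coordA fun m : Fin (n + 1) => if m ≠ 0 ∧ m ≤ j then 1 else 0 := by
  have hj0 : (j : ℕ) ≠ 0 := fun h => hj (Fin.ext h)
  have hjn := j.2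
  have h01 : (0 : Fin (n + 1)) + 1 ≠ 0 := succ_ne_self (by omega) 0
  funext k
  have hkn := k.2
  rw [coordA]
  by_cases hk : k = 0
  · subst hk
    rw [fcw_zero, if_neg (by simp), if_pos]
    · norm_num
    · refine ⟨h01, ?_⟩
      rw [zero_add, Fin.le_def, Fin.val_one', Nat.mod_eq_of_lt (by omega)]
      omega
  · rw [fcw_of_ne hk]
    have hk0 : (k : ℕ) ≠ 0 := fun h => hk (Fin.ext h)
    by_cases hl : (k : ℕ) = n
    · have h1 : k + 1 = 0 := by
        apply Fin.ext
        rw [Fin.val_add, Fin.val_one', Nat.mod_eq_of_lt (show 1 < n + 1 by omega), hl]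
        simp
      rw [h1]
      simp only [ne_eq, hk, not_false_eq_true, true_and, not_true_eq_false, false_and, if_false,
        sub_zero, Fin.le_def, Fin.ext_iff]
      split_ifs <;> first | rfl | omega
    · have h1 : ((k + 1 : Fin (n + 1)) : ℕ) = k + 1 := by
        rw [Fin.val_add, Fin.val_one', Nat.mod_eq_of_lt (show 1 < n + 1 by omega),
          Nat.mod_eq_of_lt (by omega)]
      simp only [ne_eq, Fin.ext_iff, h1, Fin.val_zero, Fin.le_def, Nat.succ_ne_zero,
        not_false_eq_true, true_and]
      split_ifs <;> first | omega | norm_num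

/-- Every state in the orbit of a coweight is, up to scaling, given by 0-1 coordinates, hence by the
orientation of a Coxeter word c, and c^∞ can be fired from that state itself. This is why no initial
word w is needed. -/
theorem isInfFC_iff_A (hn : 1 ≤ n) {i : ℕ → Fin (n + 1)} (hi : IsInfReduced (cartanA n) i) :
    IsInfFC (cartanA n) i ↔ ∃ c : List (Fin (n + 1)), IsCoxeterWord c ∧
      Inv (cartanA n) i = Inv (cartanA n) (infWord [] c) := by
  have hA := isAffine_A hn
  constructor
  · intro h
    obtain ⟨e, he0, hel, heg, hen⟩ := h.exists_infNeg hA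
    obtain ⟨y, j, b, hj, hb, hy⟩ := heg.exists_fcw hA hel he0
    obtain ⟨x, hx, rfl⟩ : ∃ x : Fin (n + 1) → ℝ, (∀ i, x i = 0 ∨ x i = 1) ∧ b • coordA x = e := by
      have h1 : e = lin hA.toIsCartan ((system (cartanA n)).wordProd y) (b • fcw (fun _ => 1) j) := by
        rw [← hy, run_eq_lin hA.toIsCartan, lin_apply_inv]
      rw [h1]
      generalize (system (cartanA n)).wordProd y = w
      induction w using (system (cartanA n)).simple_induction_left with
      | one =>
        refine ⟨_, fun i => ?_, by rw [lin_one_apply, fcw_eq_coordA hj]⟩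
        split_ifs <;> simp
      | mul_simple_left w a ih =>
        obtain ⟨x, hx, h2⟩ := ih
        refine ⟨cyclicSwap a x, fun m => ?_, ?_⟩
        · unfold cyclicSwap
          split_ifs <;> exact hx _
        · rw [lin_mul_apply, ← h2, lin_simple, step_smul, coordA_step hn]
    -- Constant coordinates would give the zero state; a place where they change makes the
    -- orientation acyclic.
    obtain ⟨p, hp⟩ : ∃ p, x (p - 1) ≠ x p := by
      by_contra! hcon
      apply he0
      funext k
      have := hcon (k + 1)
      rw [add_sub_cancel_right] at this
      simp [coordA, this]
    obtain ⟨c, hc, rfl⟩ := exists_orientation_eq hn hx hp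
    have h1 : InfNeg (cartanA n) (b • coordA (orientation c)) (infWord [] c) := fun k =>
      (negWord_smul hb _ _).2 (IsCoxeterWord.infNeg hn hc k)
    exact ⟨c, hc, hen.inv_eq hA hel heg h1⟩
  · rintro ⟨c, hc, h⟩
    exact ((IsCoxeterWord.infNeg hn hc).of_inv_subset hA.toIsCartan hi h.le).isInfFC
      (good_coordA hn (orientation_cases c))

end AffineFC

theorem theorem6p5 :
    -- type A
    (∀ n : ℕ, 1 ≤ n →
      (∀ c : List (Fin (n + 1)), AffineFC.IsCoxeterWord c →
        AffineFC.IsInfFC (AffineFC.cartanA n) (AffineFC.infWord [] c)) ∧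
      (∀ i : ℕ → Fin (n + 1), AffineFC.IsInfReduced (AffineFC.cartanA n) i →
        (AffineFC.IsInfFC (AffineFC.cartanA n) i ↔
          ∃ c : List (Fin (n + 1)), AffineFC.IsCoxeterWord c ∧
            AffineFC.Inv (AffineFC.cartanA n) i =
              AffineFC.Inv (AffineFC.cartanA n) (AffineFC.infWord [] c)))) ∧
    -- type B
    (∀ n : ℕ, 2 ≤ n → AffineFC.IsFullList (AffineFC.cartanB n)
      [([2, 0, 1] ++ AffineFC.up 2 (n - 1) ++ AffineFC.down n 3, 1),
       ([2, 0] ++ AffineFC.up 3 n ++ [2, 1] ++ AffineFC.up 3 n, n)]) ∧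
    -- type C
    (∀ n : ℕ, 2 ≤ n → AffineFC.IsFullList (AffineFC.cartanC n)
      [([1, 0] ++ AffineFC.up 1 n ++ AffineFC.down (n - 1) 2, 1),
       (AffineFC.up 0 n, n)]) ∧
    -- type D
    (∀ n : ℕ, 4 ≤ n → AffineFC.IsFullList (AffineFC.cartanD n)
      [([2, 0, 1] ++ AffineFC.up 2 n ++ AffineFC.down (n - 2) 3, 1),
       ([2, 0] ++ AffineFC.up 3 (n - 1) ++ [2, 1] ++ AffineFC.up 3 (n - 2) ++ [n], n - 1),
       ([2, 1] ++ AffineFC.up 3 (n - 1) ++ [2, 0] ++ AffineFC.up 3 (n - 2) ++ [n], n)]) ∧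
    -- types E, F and G
    AffineFC.IsFullList AffineFC.cartanE6
      [([3, 2, 5, 4, 3, 1, 2, 6, 3, 4, 0, 6], 5),
       ([3, 2, 0, 6, 3, 1, 2, 4, 3, 5, 4, 6], 1)] ∧
    AffineFC.IsFullList AffineFC.cartanE7
      [([3, 7, 5, 4, 3, 2, 6, 5, 4, 3, 7, 1, 2, 3, 0, 1, 2, 4], 6)] ∧
    AffineFC.IsFullList AffineFC.cartanE8 [] ∧
    AffineFC.IsFullList AffineFC.cartanF4 [] ∧
    AffineFC.IsFullList AffineFC.cartanG2 [([0, 1, 2, 1, 2], 2)] := by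
  refine ⟨fun n hn => ⟨fun c hc => AffineFC.isInfFC_coxeter_A hn hc,
    fun i hi => AffineFC.isInfFC_iff_A hn hi⟩, fun n hn => AffineFC.isFullList_B hn,
    fun n hn => AffineFC.isFullList_C hn, fun n hn => AffineFC.isFullList_D hn, AffineFC.isFullList_E6,
    AffineFC.isFullList_E7, AffineFC.isFullList_E8, AffineFC.isFullList_F4, AffineFC.isFullList_G2⟩
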